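/- There are a constant $c$ and a deterministic algorithm $\mathcal A$ on a word RAM with the following property. Let $G=(V,E)$ be any finite undirected multigraph, possibly with self-loops, in which every pair of (not necessarily distinct) vertices is joined by at most two edges, given by adjacency lists in random-access memory (in arbitrary order, with $V=\{0,\dots,n-1\}$), and let $k$ be any non-negative integer. Then $\mathcal A$, given $G$ and $k$, runs in time $k^{\mathcal O(1)}\cdot|V|$ and in space polynomial in the input size, with machine words of $\mathcal O(\log(|V|+k+2))$ bits, and outputs either $k$ pairwise vertex-disjoint cycles of $G$ or a feedback vertex set of $G$ of size at most $c\,k\log k$ (where $0\log 0=0$). Here a cycle is a nonempty sequence of distinct vertices together with distinct edges joining cyclically consecutive vertices (so a self-loop and a double edge are cycles), a feedback vertex set is a set $F\subseteq V$ such that $G-F$ has no cycle, and time $k^{\mathcal O(1)}\cdot|V|$ means at most $a\,(k+1)^a(|V|+1)$ elementary steps for a constant $a$. -/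

import Mathlib

/-! ### A word RAM with a step count and a space bound

Programs are structured (`while`-) programs over a fixed finite set of registers and a fixed finite
set of random-access memory banks, together with a write-only output stream.  The machine has two
parameters: `S`, the number of cells of each memory bank, and `W`, such that machine words are the
natural numbers `< W` (so words have about `log₂ W` bits).  Reading or writing outside the
banks, and producing a number that does not fit into a word, blocks the machine. -/

namespace WordRAM

/-- The binary operations of the machine. Comparisons return `1` for true and `0` for false. -/
inductive Op
  | add | sub | mul | div | lt | eq

/-- The value of an operation (`sub` is truncated subtraction, `div` is integer division). -/
def Op.apply : Op → ℕ → ℕ → ℕ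
  | .add, x, y => x + y
  | .sub, x, y => x - y
  | .mul, x, y => x * y
  | .div, x, y => x / y
  | .lt, x, y => if x < y then 1 else 0
  | .eq, x, y => if x = y then 1 else 0

/-- Expressions: constants, registers, cells of a memory bank `b` at a computed address,
and binary operations. -/
inductive Expr
  | const (x : ℕ)
  | reg (r : ℕ)
  | mem (b : ℕ) (addr : Expr)
  | op (o : Op) (e₁ e₂ : Expr)

/-- Structured programs. -/
inductive Prog
  | skip
  | assign (r : ℕ) (e : Expr)
  | store (b : ℕ) (addr e : Expr)
  | emit (e : Expr)
  | seq (P Q : Prog)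
  | ite (e : Expr) (P Q : Prog)
  | while (e : Expr) (P : Prog)

/-- The state of the machine: registers, memory banks, and what has been output so far. -/
structure State where
  reg : ℕ → ℕ
  mem : ℕ → ℕ → ℕ
  out : List ℕ

/-- Assigning a value to a register. -/
def State.setReg (s : State) (r x : ℕ) : State :=
  { s with reg := Function.update s.reg r x }

/-- Writing a value into cell `i` of bank `b`. -/
def State.setMem (s : State) (b i x : ℕ) : State :=
  { s with mem := Function.update s.mem b (Function.update (s.mem b) i x) }

/-- Appending a value to the output stream. -/
def State.emit (s : State) (x : ℕ) : State :=
  { s with out := s.out ++ [x] }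

/-- The value of an expression. -/
def Expr.eval (s : State) : Expr → ℕ
  | .const x => x
  | .reg r => s.reg r
  | .mem b addr => s.mem b (addr.eval s)
  | .op o e₁ e₂ => o.apply (e₁.eval s) (e₂.eval s)

/-- The evaluation of the expression only reads cells with address `< S`, and all
(intermediate) values are words, i.e. `< W`. -/
def Expr.Fits (S W : ℕ) (s : State) : Expr → Prop
  | .const x => x < W
  | .reg r => s.reg r < W
  | .mem b addr => addr.Fits S W s ∧ addr.eval s < S ∧ s.mem b (addr.eval s) < W
  | .op o e₁ e₂ => e₁.Fits S W s ∧ e₂.Fits S W s ∧ o.apply (e₁.eval s) (e₂.eval s) < W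

/-- The number of elementary steps needed to evaluate an expression: one for each constant, each
register access, each memory access and each operation. -/
def Expr.cost : Expr → ℕ
  | .const _ => 1
  | .reg _ => 1
  | .mem _ addr => addr.cost + 1
  | .op _ e₁ e₂ => e₁.cost + e₂.cost + 1

/-- `Exec S W P s t s'`: on the machine with `S` cells per memory bank and words `< W`, the program
`P`, started in state `s`, halts after exactly `t` elementary steps in state `s'`.
A condition counts as true when its value is nonzero. -/
inductive Exec (S W : ℕ) : Prog → State → ℕ → State → Prop
  | skip (s : State) : Exec S W .skip s 1 s
  | assign (r : ℕ) (e : Expr) (s : State) : e.Fits S W s →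
      Exec S W (.assign r e) s (e.cost + 1) (s.setReg r (e.eval s))
  | store (b : ℕ) (addr e : Expr) (s : State) :
      addr.Fits S W s → addr.eval s < S → e.Fits S W s →
      Exec S W (.store b addr e) s (addr.cost + e.cost + 1) (s.setMem b (addr.eval s) (e.eval s))
  | emit (e : Expr) (s : State) : e.Fits S W s →
      Exec S W (.emit e) s (e.cost + 1) (s.emit (e.eval s))
  | seq {P Q : Prog} {s₁ s₂ s₃ : State} {t₁ t₂ : ℕ} :
      Exec S W P s₁ t₁ s₂ → Exec S W Q s₂ t₂ s₃ → Exec S W (.seq P Q) s₁ (t₁ + t₂) s₃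
  | ite_true {e : Expr} {P Q : Prog} {s s' : State} {t : ℕ} :
      e.Fits S W s → e.eval s ≠ 0 → Exec S W P s t s' →
      Exec S W (.ite e P Q) s (e.cost + 1 + t) s'
  | ite_false {e : Expr} {P Q : Prog} {s s' : State} {t : ℕ} :
      e.Fits S W s → e.eval s = 0 → Exec S W Q s t s' →
      Exec S W (.ite e P Q) s (e.cost + 1 + t) s'
  | while_true {e : Expr} {P : Prog} {s₁ s₂ s₃ : State} {t₁ t₂ : ℕ} :
      e.Fits S W s₁ → e.eval s₁ ≠ 0 → Exec S W P s₁ t₁ s₂ → Exec S W (.while e P) s₂ t₂ s₃ →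
      Exec S W (.while e P) s₁ (e.cost + 1 + t₁ + t₂) s₃
  | while_false {e : Expr} {P : Prog} {s : State} :
      e.Fits S W s → e.eval s = 0 → Exec S W (.while e P) s (e.cost + 1) s

/-- The initial state for an `n`-vertex graph with adjacency lists `adj 0, …, adj (n - 1)` and a
number `k`.  Register `0` holds `n` and register `1` holds `k`.  Bank `1` holds the concatenation of
the adjacency lists, and the list of vertex `v` occupies the cells of bank `1` from the address
stored in cell `v` of bank `0` up to, and excluding, the address stored in cell `v + 1` of
bank `0`.  Everything else is `0`, and nothing has been output. -/
def initialState (n k : ℕ) (adj : ℕ → List ℕ) : State where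
  reg r := if r = 0 then n else if r = 1 then k else 0
  mem b i :=
    if b = 0 then (if i ≤ n then ∑ v ∈ Finset.range i, (adj v).length else 0)
    else if b = 1 then ((List.range n).flatMap adj).getD i 0
    else 0
  out := []

end WordRAM

/-! ### Cycles, feedback vertex sets and adjacency lists in multigraphs -/

namespace Graph

/-- `l = [v₀, …, v_ℓ]` is a cycle of the multigraph `G`: a nonempty sequence of distinct vertices,
with distinct edges joining `v_i` to `v_{i+1}` cyclically.  A self-loop is a cycle with one vertex,
and a double edge gives a cycle with two vertices. -/
def IsCycleSeq {α β : Type*} (G : Graph α β) (l : List α) : Prop :=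
  l ≠ [] ∧ l.Nodup ∧ ∃ e : Fin l.length → β, Function.Injective e ∧
    ∀ i : Fin l.length, G.IsLink (e i) l[i]
      (l[((i : ℕ) + 1) % l.length]'(Nat.mod_lt _ (Nat.zero_lt_of_lt i.isLt)))

/-- `F` is a feedback vertex set of `G`: a set of vertices such that `G - F` has no cycle. -/
def IsFeedbackVertexSet {α β : Type*} (G : Graph α β) (F : Set α) : Prop :=
  F ⊆ G.vertexSet ∧ ∀ l : List α, ¬ (G.deleteVerts F).IsCycleSeq l

/-- `adj 0, …, adj (n - 1)` are adjacency lists, in an arbitrary order, of a multigraph `G` whose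
vertices are `0, …, n - 1`: each `w` occurs in the list of `v` as often as there are
edges joining `v` and `w`. -/
def IsAdjacencyLists {β : Type*} (G : Graph ℕ β) (n : ℕ) (adj : ℕ → List ℕ) : Prop :=
  G.vertexSet = {v | v < n} ∧
    ∀ v < n, ∀ w, {e | G.IsLink e v w}.encard = ((adj v).count w : ℕ∞)

end Graph

/-- The output stream that reports a list of cycles: a `0`, and then, for each cycle, its
length followed by its vertices. -/
def encodeCycles (Cs : List (List ℕ)) : List ℕ :=
  0 :: Cs.flatMap (fun C => C.length :: C)

/-- The output stream that reports a set of vertices: a `1`, and then the vertices. -/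
def encodeVertices (F : List ℕ) : List ℕ :=
  1 :: F

/-! A subgraph `H` of `G` is grown together with a set of flagged vertices. Each round searches `G`
minus the flagged vertices for a cycle disjoint from `H`, or for an ear: a path or closed trail
through new vertices whose ends are unflagged vertices of `H`. The trail is added to `H` and its
ends are flagged (for a cycle, one vertex). Unflagged vertices of `H` then have degree two, no
degree exceeds four, and `H` minus the flags is a forest. After `q` cycles and `p` ears, `H` has
exactly `p` more edges than vertices and at most `2p + q` flags (`Packing`).

Let `l` be the number of binary digits of `k`. There are three ways to stop. If `q = k`, the cycles
are the answer. If a search finds nothing, then `G` minus the flags is a forest, so the flags form a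
feedback vertex set; its size is `O(k log k)` because `p` never exceeds `1024 * k * l`. If `p`
reaches that limit while `q < k`, then `H` has so many surplus edges that `k` disjoint cycles, each
with few flags, can be removed from it greedily.

The last claim rests on ball growing (`TreeBall.exists_sdiff`, `edgeEnds_le_of_treeBall`). Give
flagged vertices weight 1 and the others weight 0, and suppose that all balls of radius `D = 56 * l`
around the flagged vertices are trees. The total weight is at most `3p < (5/4) ^ D`, so in each ball
some step of the radius increases the weight by a factor of at most `5/4`. Removing the ball at that
radius destroys at most |ball| + weight/4 edges. When no flagged vertex is left, all degrees are at
most two; altogether |E| ≤ |V| + 3p/4. But removing a cycle with at most `2 * D + 1` flags lowers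
|E| - |V| by at most `2 * (2 * D + 1)`, so fewer than `k` removals leave a surplus above 3p/4, as `p
> 8 * (2 * D + 1) * k` (`Packing.not_treeBall`). Hence some ball still contains a short cycle.

For the running time, the lists may have quadratic total length, but a search stops at the first
edge outside its forest. Every entry read leads to a flagged vertex, is one of at most two ignored
neighbours, discovers a vertex, or ends the search. As multiplicities are at most two, a search
costs `O((p + q + 1) n)` (`searchLoop_runs`), and the number of searches is polynomial in `k`. The
searches in `G` and in `H` are instances of one routine. Its invariant `Inv` certifies that nothing
was missed: by a forest ranking of `G` minus the flags (`Inv.isForestRanking`), or by a tree in `H`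
(`Inv.treeBall`). After a collision, `Climb` extracts the trail. -/

namespace WordRAM

/-! ### Effect of the elementary updates on a state -/

@[simp] lemma State.setReg_reg (s : State) (r x r' : ℕ) :
    (s.setReg r x).reg r' = if r' = r then x else s.reg r' := by
  simp [State.setReg, Function.update_apply]

@[simp] lemma State.setReg_mem (s : State) (r x : ℕ) : (s.setReg r x).mem = s.mem := rfl

@[simp] lemma State.setReg_out (s : State) (r x : ℕ) : (s.setReg r x).out = s.out := rfl

@[simp] lemma State.setMem_reg (s : State) (b i x : ℕ) : (s.setMem b i x).reg = s.reg := rfl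

@[simp] lemma State.setMem_mem (s : State) (b i x b' : ℕ) :
    (s.setMem b i x).mem b' = if b' = b then Function.update (s.mem b) i x else s.mem b' := by
  simp only [State.setMem, Function.update_apply]

@[simp] lemma State.setMem_out (s : State) (b i x : ℕ) : (s.setMem b i x).out = s.out := rfl

@[simp] lemma State.emit_reg (s : State) (x : ℕ) : (s.emit x).reg = s.reg := rfl

@[simp] lemma State.emit_mem (s : State) (x : ℕ) : (s.emit x).mem = s.mem := rfl

@[simp] lemma State.emit_out (s : State) (x : ℕ) : (s.emit x).out = s.out ++ [x] := rfl

/-! ### Writing programs -/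

instance : Add Expr := ⟨Expr.op .add⟩
instance : Sub Expr := ⟨Expr.op .sub⟩
instance : Mul Expr := ⟨Expr.op .mul⟩
instance (n : ℕ) : OfNat Expr n := ⟨Expr.const n⟩

/-- Comparison of two expressions. -/
def Expr.less (e₁ e₂ : Expr) : Expr := .op .lt e₁ e₂

/-- Equality test of two expressions. -/
def Expr.same (e₁ e₂ : Expr) : Expr := .op .eq e₁ e₂

/-- Conjunction of two conditions. -/
def Expr.both (e₁ e₂ : Expr) : Expr := .op .sub (.op .lt (.const 0) e₁) (.op .eq e₂ (.const 0))

infixr:30 " ;; " => Prog.seq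
infix:40 " ≔ " => Prog.assign

/-- All words stored in registers and memory cells are smaller than `W`. -/
def State.Ok (W : ℕ) (s : State) : Prop :=
  2 ≤ W ∧ (∀ r, s.reg r < W) ∧ ∀ b i, s.mem b i < W

/-- A sufficient condition for `Expr.Fits` in states all of whose words are small. -/
def Expr.Safe (S W : ℕ) (s : State) : Expr → Prop
  | .const x => x < W
  | .reg _ => True
  | .mem _ addr => addr.Safe S W s ∧ addr.eval s < S
  | .op .add e₁ e₂ => e₁.Safe S W s ∧ e₂.Safe S W s ∧ e₁.eval s + e₂.eval s < W
  | .op .mul e₁ e₂ => e₁.Safe S W s ∧ e₂.Safe S W s ∧ e₁.eval s * e₂.eval s < W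
  | .op _ e₁ e₂ => e₁.Safe S W s ∧ e₂.Safe S W s

section Simp

variable (S W : ℕ) (s : State) (e f : Expr) (x r b : ℕ)

@[simp] lemma Expr.eval_const : (Expr.const x).eval s = x := rfl
@[simp] lemma Expr.eval_ofNat : (no_index (OfNat.ofNat x : Expr)).eval s = x := rfl
@[simp] lemma Expr.eval_reg : (Expr.reg r).eval s = s.reg r := rfl
@[simp] lemma Expr.eval_mem : (Expr.mem b e).eval s = s.mem b (e.eval s) := rfl
@[simp] lemma Expr.eval_add : (e + f).eval s = e.eval s + f.eval s := rfl
@[simp] lemma Expr.eval_sub : (e - f).eval s = e.eval s - f.eval s := rfl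
@[simp] lemma Expr.eval_mul : (e * f).eval s = e.eval s * f.eval s := rfl
@[simp] lemma Expr.eval_div : (Expr.op .div e f).eval s = e.eval s / f.eval s := rfl
@[simp] lemma Expr.eval_less : (e.less f).eval s = if e.eval s < f.eval s then 1 else 0 := rfl
@[simp] lemma Expr.eval_same : (e.same f).eval s = if e.eval s = f.eval s then 1 else 0 := rfl
@[simp] lemma Expr.eval_both :
    (e.both f).eval s = if e.eval s ≠ 0 ∧ f.eval s ≠ 0 then 1 else 0 := by
  by_cases h₁ : e.eval s = 0 <;> by_cases h₂ : f.eval s = 0 <;>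
    simp [Expr.both, Expr.eval, Op.apply, h₁, h₂, Nat.pos_iff_ne_zero]

lemma Expr.both_eq_zero : (e.both f).eval s = 0 ↔ e.eval s = 0 ∨ f.eval s = 0 := by
  rw [Expr.eval_both]
  split_ifs with h
  · simp only [false_iff]; tauto
  · simp only [true_iff]; tauto

lemma Expr.less_eq_zero : (e.less f).eval s = 0 ↔ ¬ e.eval s < f.eval s := by simp

lemma Expr.same_eq_zero : (e.same f).eval s = 0 ↔ e.eval s ≠ f.eval s := by simp

@[simp] lemma Expr.safe_ofNat : (no_index (OfNat.ofNat x : Expr)).Safe S W s ↔ x < W := Iff.rfl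
@[simp] lemma Expr.safe_reg : (Expr.reg r).Safe S W s ↔ True := Iff.rfl
@[simp] lemma Expr.safe_mem : (Expr.mem b e).Safe S W s ↔ e.Safe S W s ∧ e.eval s < S := Iff.rfl
@[simp] lemma Expr.safe_add :
    (e + f).Safe S W s ↔ e.Safe S W s ∧ f.Safe S W s ∧ e.eval s + f.eval s < W := Iff.rfl
@[simp] lemma Expr.safe_sub : (e - f).Safe S W s ↔ e.Safe S W s ∧ f.Safe S W s := Iff.rfl
@[simp] lemma Expr.safe_mul :
    (e * f).Safe S W s ↔ e.Safe S W s ∧ f.Safe S W s ∧ e.eval s * f.eval s < W := Iff.rfl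
@[simp] lemma Expr.safe_div : (Expr.op .div e f).Safe S W s ↔ e.Safe S W s ∧ f.Safe S W s := Iff.rfl
@[simp] lemma Expr.safe_less : (e.less f).Safe S W s ↔ e.Safe S W s ∧ f.Safe S W s := Iff.rfl
@[simp] lemma Expr.safe_same : (e.same f).Safe S W s ↔ e.Safe S W s ∧ f.Safe S W s := Iff.rfl
@[simp] lemma Expr.safe_both :
    (e.both f).Safe S W s ↔ (0 < W ∧ e.Safe S W s) ∧ f.Safe S W s ∧ 0 < W := Iff.rfl

@[simp] lemma Expr.cost_const : (Expr.const x).cost = 1 := rfl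
@[simp] lemma Expr.cost_ofNat : (no_index (OfNat.ofNat x : Expr)).cost = 1 := rfl
@[simp] lemma Expr.cost_reg : (Expr.reg r).cost = 1 := rfl
@[simp] lemma Expr.cost_mem : (Expr.mem b e).cost = e.cost + 1 := rfl
@[simp] lemma Expr.cost_add : (e + f).cost = e.cost + f.cost + 1 := rfl
@[simp] lemma Expr.cost_sub : (e - f).cost = e.cost + f.cost + 1 := rfl
@[simp] lemma Expr.cost_mul : (e * f).cost = e.cost + f.cost + 1 := rfl
@[simp] lemma Expr.cost_div : (Expr.op .div e f).cost = e.cost + f.cost + 1 := rfl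
@[simp] lemma Expr.cost_less : (e.less f).cost = e.cost + f.cost + 1 := rfl
@[simp] lemma Expr.cost_same : (e.same f).cost = e.cost + f.cost + 1 := rfl
@[simp] lemma Expr.cost_both : (e.both f).cost = (1 + e.cost + 1) + (f.cost + 1 + 1) + 1 := rfl

end Simp

/-- When all stored words are below `W`, only constants, sums and products can overflow: truncated
differences and quotients are at most their first argument, and comparisons are at most `1 < W`. So
`Safe` checks only these and the addresses. -/
lemma Expr.Safe.fits {S W : ℕ} {s : State} (hs : s.Ok W) {e : Expr} (h : e.Safe S W s) :
    e.Fits S W s ∧ e.eval s < W := by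
  induction e with
  | const x => exact ⟨h, h⟩
  | reg r => exact ⟨hs.2.1 r, hs.2.1 r⟩
  | mem b a ih => exact ⟨⟨(ih h.1).1, h.2, hs.2.2 _ _⟩, hs.2.2 _ _⟩
  | op o e f ihe ihf =>
    have h2 := hs.1
    cases o with
    | add => exact ⟨⟨(ihe h.1).1, (ihf h.2.1).1, h.2.2⟩, h.2.2⟩
    | mul => exact ⟨⟨(ihe h.1).1, (ihf h.2.1).1, h.2.2⟩, h.2.2⟩
    | sub =>
      have := (Nat.sub_le (e.eval s) (f.eval s)).trans_lt (ihe h.1).2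
      exact ⟨⟨(ihe h.1).1, (ihf h.2).1, this⟩, this⟩
    | div =>
      have := (Nat.div_le_self (e.eval s) (f.eval s)).trans_lt (ihe h.1).2
      exact ⟨⟨(ihe h.1).1, (ihf h.2).1, this⟩, this⟩
    | lt =>
      have : Op.lt.apply (e.eval s) (f.eval s) < W := by
        simp only [Op.apply]; split_ifs <;> omega
      exact ⟨⟨(ihe h.1).1, (ihf h.2).1, this⟩, this⟩
    | eq =>
      have : Op.eq.apply (e.eval s) (f.eval s) < W := by
        simp only [Op.apply]; split_ifs <;> omega
      exact ⟨⟨(ihe h.1).1, (ihf h.2).1, this⟩, this⟩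

lemma State.Ok.setReg {W : ℕ} {s : State} (hs : s.Ok W) {r x : ℕ} (hx : x < W) :
    (s.setReg r x).Ok W := by
  refine ⟨hs.1, fun r' => ?_, hs.2.2⟩
  rw [State.setReg_reg]
  split_ifs
  exacts [hx, hs.2.1 _]

lemma State.Ok.setMem {W : ℕ} {s : State} (hs : s.Ok W) {b i x : ℕ} (hx : x < W) :
    (s.setMem b i x).Ok W := by
  refine ⟨hs.1, hs.2.1, fun b' i' => ?_⟩
  rw [State.setMem_mem]
  split_ifs
  · rw [Function.update_apply]
    split_ifs
    exacts [hx, hs.2.2 _ _]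
  · exact hs.2.2 _ _

/-! ### What a program leaves unchanged -/

/-- The registers that a program may write. -/
def Prog.wregs : Prog → List ℕ
  | .assign r _ => [r]
  | .seq P R => P.wregs ++ R.wregs
  | .ite _ P R => P.wregs ++ R.wregs
  | .while _ P => P.wregs
  | _ => []

/-- The memory banks that a program may write. -/
def Prog.wbanks : Prog → List ℕ
  | .store b _ _ => [b]
  | .seq P R => P.wbanks ++ R.wbanks
  | .ite _ P R => P.wbanks ++ R.wbanks
  | .while _ P => P.wbanks
  | _ => []

/-- Whether a program may produce output. -/
def Prog.emits : Prog → Bool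
  | .emit _ => true
  | .seq P R => P.emits || R.emits
  | .ite _ P R => P.emits || R.emits
  | .while _ P => P.emits
  | _ => false

/-- `s'` agrees with `s` on everything that `P` does not write. -/
structure Prog.Frame (P : Prog) (s s' : State) : Prop where
  reg : ∀ r, r ∉ P.wregs → s'.reg r = s.reg r
  mem : ∀ b, b ∉ P.wbanks → s'.mem b = s.mem b
  out : P.emits = false → s'.out = s.out

lemma Prog.Frame.refl (P : Prog) (s : State) : P.Frame s s :=
  ⟨fun _ _ => rfl, fun _ _ => rfl, fun _ => rfl⟩

lemma Prog.Frame.trans {P : Prog} {s₁ s₂ s₃ : State} (h : P.Frame s₁ s₂) (h' : P.Frame s₂ s₃) :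
    P.Frame s₁ s₃ :=
  ⟨fun r hr => (h'.reg r hr).trans (h.reg r hr), fun b hb => (h'.mem b hb).trans (h.mem b hb),
    fun he => (h'.out he).trans (h.out he)⟩

lemma Prog.Frame.mono {P R : Prog} {s s' : State} (h : P.Frame s s')
    (hr : ∀ r ∈ P.wregs, r ∈ R.wregs) (hb : ∀ b ∈ P.wbanks, b ∈ R.wbanks)
    (he : R.emits = false → P.emits = false) : R.Frame s s' :=
  ⟨fun r h' => h.reg r fun hh => h' (hr r hh), fun b h' => h.mem b fun hh => h' (hb b hh),
    fun h' => h.out (he h')⟩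

lemma Prog.Frame.seq_left {P R : Prog} {s s' : State} (h : P.Frame s s') : (P ;; R).Frame s s' :=
  h.mono (by simp +contextual [Prog.wregs]) (by simp +contextual [Prog.wbanks])
    (by simp +contextual [Prog.emits])

lemma Prog.Frame.seq_right {P R : Prog} {s s' : State} (h : R.Frame s s') : (P ;; R).Frame s s' :=
  h.mono (by simp +contextual [Prog.wregs]) (by simp +contextual [Prog.wbanks])
    (by simp +contextual [Prog.emits])

lemma Prog.Frame.ite_left {e : Expr} {P R : Prog} {s s' : State} (h : P.Frame s s') :
    (Prog.ite e P R).Frame s s' :=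
  h.mono (by simp +contextual [Prog.wregs]) (by simp +contextual [Prog.wbanks])
    (by simp +contextual [Prog.emits])

lemma Prog.Frame.ite_right {e : Expr} {P R : Prog} {s s' : State} (h : R.Frame s s') :
    (Prog.ite e P R).Frame s s' :=
  h.mono (by simp +contextual [Prog.wregs]) (by simp +contextual [Prog.wbanks])
    (by simp +contextual [Prog.emits])

/-! ### Total correctness with time bounds -/

/-- Started in `s`, whose words fit, `P` halts after at most `T` steps in a state satisfying `Q`. -/
def Runs (S W : ℕ) (P : Prog) (s : State) (T : ℕ) (Q : State → Prop) : Prop :=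
  s.Ok W → ∃ t s', t ≤ T ∧ Exec S W P s t s' ∧ s'.Ok W ∧ P.Frame s s' ∧ Q s'

/-- The weakest precondition of a loop-free program. -/
def Prog.wp (S W : ℕ) : Prog → (State → Prop) → State → Prop
  | .skip, Q, s => Q s
  | .assign r e, Q, s => e.Safe S W s ∧ Q (s.setReg r (e.eval s))
  | .store b a e, Q, s =>
      a.Safe S W s ∧ a.eval s < S ∧ e.Safe S W s ∧ Q (s.setMem b (a.eval s) (e.eval s))
  | .emit e, Q, s => e.Safe S W s ∧ Q (s.emit (e.eval s))
  | .seq P R, Q, s => P.wp S W (R.wp S W Q) s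
  | .ite e P R, Q, s =>
      e.Safe S W s ∧ (e.eval s ≠ 0 → P.wp S W Q s) ∧ (e.eval s = 0 → R.wp S W Q s)
  | .while _ _, _, _ => False

/-- An upper bound for the running time of a loop-free program. -/
def Prog.maxCost : Prog → ℕ
  | .skip => 1
  | .assign _ e => e.cost + 1
  | .store _ a e => a.cost + e.cost + 1
  | .emit e => e.cost + 1
  | .seq P R => P.maxCost + R.maxCost
  | .ite e P R => e.cost + 1 + max P.maxCost R.maxCost
  | .while _ _ => 0

variable {S W : ℕ}

lemma Runs.mono {P : Prog} {s : State} {T T' : ℕ} {Q Q' : State → Prop} (h : Runs S W P s T Q)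
    (hT : T ≤ T') (hQ : ∀ s', s'.Ok W → P.Frame s s' → Q s' → Q' s') : Runs S W P s T' Q' := by
  intro hs
  obtain ⟨t, s', ht, he, ho, hf, hq⟩ := h hs
  exact ⟨t, s', ht.trans hT, he, ho, hf, hQ s' ho hf hq⟩

lemma Runs.seq {P R : Prog} {s : State} {T₁ T₂ T : ℕ} {Q₁ Q : State → Prop}
    (h₁ : Runs S W P s T₁ Q₁)
    (h₂ : ∀ s', s'.Ok W → P.Frame s s' → Q₁ s' → Runs S W R s' T₂ Q) (hT : T₁ + T₂ ≤ T) :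
    Runs S W (P ;; R) s T Q := by
  intro hs
  obtain ⟨t, s', ht, he, ho, hf, hq⟩ := h₁ hs
  obtain ⟨t', s'', ht', he', ho', hf', hq'⟩ := h₂ s' ho hf hq ho
  exact ⟨t + t', s'', by omega, .seq he he', ho', hf.seq_left.trans hf'.seq_right, hq'⟩

lemma Runs.ite {e : Expr} {P R : Prog} {s : State} {T₁ T : ℕ} {Q : State → Prop}
    (he : e.Safe S W s) (h₁ : e.eval s ≠ 0 → Runs S W P s T₁ Q)
    (h₂ : e.eval s = 0 → Runs S W R s T₁ Q) (hT : e.cost + 1 + T₁ ≤ T) :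
    Runs S W (.ite e P R) s T Q := by
  intro hs
  by_cases h : e.eval s = 0
  · obtain ⟨t, s', ht, hx, ho, hf, hq⟩ := h₂ h hs
    exact ⟨_, s', by omega, .ite_false (he.fits hs).1 h hx, ho, hf.ite_right, hq⟩
  · obtain ⟨t, s', ht, hx, ho, hf, hq⟩ := h₁ h hs
    exact ⟨_, s', by omega, .ite_true (he.fits hs).1 h hx, ho, hf.ite_left, hq⟩

lemma Runs.of_wp {P : Prog} {s : State} {T : ℕ} {Q : State → Prop} (h : P.wp S W Q s)
    (hT : P.maxCost ≤ T) : Runs S W P s T Q := by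
  induction P generalizing s T Q with
  | skip => exact fun hs => ⟨1, s, hT, .skip s, hs, .refl _ _, h⟩
  | assign r e =>
    refine fun hs => ⟨_, _, hT, .assign r e s (h.1.fits hs).1, hs.setReg (h.1.fits hs).2,
      ⟨fun r' hr' => ?_, fun _ _ => rfl, fun _ => rfl⟩, h.2⟩
    rw [State.setReg_reg, if_neg (by simpa [Prog.wregs] using hr')]
  | store b a e =>
    refine fun hs => ⟨_, _, hT, .store b a e s (h.1.fits hs).1 h.2.1 (h.2.2.1.fits hs).1,
      hs.setMem (h.2.2.1.fits hs).2, ⟨fun _ _ => rfl, fun b' hb' => ?_, fun _ => rfl⟩, h.2.2.2⟩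
    rw [State.setMem_mem, if_neg (by simpa [Prog.wbanks] using hb')]
  | emit e =>
    exact fun hs => ⟨_, _, hT, .emit e s (h.1.fits hs).1, hs,
      ⟨fun _ _ => rfl, fun _ _ => rfl, fun h => by simp [Prog.emits] at h⟩, h.2⟩
  | seq P R ihP ihR =>
    exact Runs.seq (ihP h le_rfl) (fun s' _ _ h' => ihR h' le_rfl) hT
  | ite e P R ihP ihR =>
    exact Runs.ite (T₁ := max P.maxCost R.maxCost) h.1 (fun h0 => ihP (h.2.1 h0) (le_max_left _ _))
      (fun h0 => ihR (h.2.2 h0) (le_max_right _ _)) hT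
  | _ => exact h.elim

/-- The postcondition becomes a variable `Q'`, so that the precondition can be simplified without
disturbing the statement that is eventually to be proved about the final state. -/
lemma Runs.of_wp' {P : Prog} {s : State} {T : ℕ} {Q : State → Prop}
    (h : ∀ Q' : State → Prop, (∀ s', Q s' → Q' s') → P.wp S W Q' s) (hT : P.maxCost ≤ T) :
    Runs S W P s T Q :=
  Runs.of_wp (h Q fun _ h => h) hT

/-- Started in `s`, whose words fit, `P` halts, after `t` steps in a state `s'` with `Q s' t`. -/
def RunsT (S W : ℕ) (P : Prog) (s : State) (Q : State → ℕ → Prop) : Prop :=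
  s.Ok W → ∃ t s', Exec S W P s t s' ∧ s'.Ok W ∧ P.Frame s s' ∧ Q s' t

lemma Runs.toT {P : Prog} {s : State} {T : ℕ} {Q : State → Prop} (h : Runs S W P s T Q) :
    RunsT S W P s fun s' t => t ≤ T ∧ Q s' := fun hs =>
  let ⟨t, s', ht, hx, ho, hf, hq⟩ := h hs
  ⟨t, s', hx, ho, hf, ht, hq⟩

lemma RunsT.mono {P : Prog} {s : State} {Q Q' : State → ℕ → Prop} (h : RunsT S W P s Q)
    (hQ : ∀ s' t, s'.Ok W → P.Frame s s' → Q s' t → Q' s' t) : RunsT S W P s Q' := fun hs =>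
  let ⟨t, s', hx, ho, hf, hq⟩ := h hs
  ⟨t, s', hx, ho, hf, hQ s' t ho hf hq⟩

lemma RunsT.toRuns {P : Prog} {s : State} {T : ℕ} {Q : State → ℕ → Prop} {Q' : State → Prop}
    (h : RunsT S W P s Q) (hQ : ∀ s' t, s'.Ok W → P.Frame s s' → Q s' t → t ≤ T ∧ Q' s') :
    Runs S W P s T Q' := fun hs =>
  let ⟨t, s', hx, ho, hf, hq⟩ := h hs
  ⟨t, s', (hQ s' t ho hf hq).1, hx, ho, hf, (hQ s' t ho hf hq).2⟩

lemma RunsT.seq {P R : Prog} {s : State} {Q₁ Q : State → ℕ → Prop} (h₁ : RunsT S W P s Q₁)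
    (h₂ : ∀ s' t, s'.Ok W → P.Frame s s' → Q₁ s' t →
      RunsT S W R s' fun s'' t' => Q s'' (t + t')) :
    RunsT S W (P ;; R) s Q := by
  intro hs
  obtain ⟨t, s', he, ho, hf, hq⟩ := h₁ hs
  obtain ⟨t', s'', he', ho', hf', hq'⟩ := h₂ s' t ho hf hq ho
  exact ⟨t + t', s'', .seq he he', ho', hf.seq_left.trans hf'.seq_right, hq'⟩

lemma RunsT.ite {e : Expr} {P R : Prog} {s : State} {Q : State → ℕ → Prop}
    (he : e.Safe S W s)
    (h₁ : e.eval s ≠ 0 → RunsT S W P s fun s' t => Q s' (e.cost + 1 + t))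
    (h₂ : e.eval s = 0 → RunsT S W R s fun s' t => Q s' (e.cost + 1 + t)) :
    RunsT S W (.ite e P R) s Q := by
  intro hs
  by_cases h : e.eval s = 0
  · obtain ⟨t, s', hx, ho, hf, hq⟩ := h₂ h hs
    exact ⟨_, s', .ite_false (he.fits hs).1 h hx, ho, hf.ite_right, hq⟩
  · obtain ⟨t, s', hx, ho, hf, hq⟩ := h₁ h hs
    exact ⟨_, s', .ite_true (he.fits hs).1 h hx, ho, hf.ite_left, hq⟩

lemma RunsT.skip {s : State} {Q : State → ℕ → Prop} (h : Q s 1) : RunsT S W .skip s Q :=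
  fun hs => ⟨1, s, .skip s, hs, .refl _ _, h⟩

lemma RunsT.assign_seq {r : ℕ} {e : Expr} {R : Prog} {s : State} {Q : State → ℕ → Prop}
    (he : e.Safe S W s)
    (h : RunsT S W R (s.setReg r (e.eval s)) fun s' t => Q s' (e.cost + 1 + t)) :
    RunsT S W (r ≔ e ;; R) s Q := by
  intro hs
  obtain ⟨t, s', hx, ho, hf, hq⟩ := h (hs.setReg (he.fits hs).2)
  refine ⟨_, s', .seq (.assign r e s (he.fits hs).1) hx, ho, ?_, hq⟩
  refine Prog.Frame.trans (s₂ := s.setReg r (e.eval s)) (Prog.Frame.seq_left ⟨fun r' hr' => ?_,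
    fun _ _ => rfl, fun _ => rfl⟩) (Prog.Frame.seq_right hf)
  rw [State.setReg_reg, if_neg (by simpa [Prog.wregs] using hr')]

lemma RunsT.store_seq {b : ℕ} {a e : Expr} {R : Prog} {s : State} {Q : State → ℕ → Prop}
    (ha : a.Safe S W s) (ha' : a.eval s < S) (he : e.Safe S W s)
    (h : RunsT S W R (s.setMem b (a.eval s) (e.eval s)) fun s' t =>
      Q s' (a.cost + e.cost + 1 + t)) :
    RunsT S W (.store b a e ;; R) s Q := by
  intro hs
  obtain ⟨t, s', hx, ho, hf, hq⟩ := h (hs.setMem (he.fits hs).2)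
  refine ⟨_, s', .seq (.store b a e s (ha.fits hs).1 ha' (he.fits hs).1) hx, ho, ?_, hq⟩
  refine Prog.Frame.trans (s₂ := s.setMem b (a.eval s) (e.eval s))
    (Prog.Frame.seq_left ⟨fun _ _ => rfl, fun b' hb' => ?_, fun _ => rfl⟩) (Prog.Frame.seq_right hf)
  rw [State.setMem_mem, if_neg (by simpa [Prog.wbanks] using hb')]

lemma RunsT.emit_seq {e : Expr} {R : Prog} {s : State} {Q : State → ℕ → Prop}
    (he : e.Safe S W s)
    (h : RunsT S W R (s.emit (e.eval s)) fun s' t => Q s' (e.cost + 1 + t)) :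
    RunsT S W (.emit e ;; R) s Q := by
  intro hs
  obtain ⟨t, s', hx, ho, hf, hq⟩ := h hs
  refine ⟨_, s', .seq (.emit e s (he.fits hs).1) hx, ho, ?_, hq⟩
  exact ⟨fun r hr => (Prog.Frame.seq_right hf).reg r hr, fun b hb =>
    (Prog.Frame.seq_right hf).mem b hb, fun h => by simp [Prog.emits] at h⟩

/-- The rule for loops with amortized running time: `f` is a potential. -/
lemma RunsT.loop {e : Expr} {P : Prog} {s : State} (I : State → Prop) (f : State → ℕ) (h₀ : I s)
    (h : ∀ s', I s' → s'.Ok W → P.Frame s s' → e.Safe S W s' ∧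
      (e.eval s' ≠ 0 → RunsT S W P s' fun s'' t => I s'' ∧ e.cost + 1 + t + f s'' ≤ f s')) :
    RunsT S W (.while e P) s fun s' t => t + f s' ≤ f s + (e.cost + 1) ∧ I s' ∧ e.eval s' = 0 := by
  -- Induction on a bound for the potential. An iteration lowers the potential by its own running
  -- time, which is positive, so at potential zero the loop must stop. The frame condition back to
  -- `s` is carried along for the invariant step.
  suffices H : ∀ m s', f s' ≤ m → I s' → P.Frame s s' → RunsT S W (.while e P) s' fun s'' t =>
      t + f s'' ≤ f s' + (e.cost + 1) ∧ I s'' ∧ e.eval s'' = 0 from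
    H _ s le_rfl h₀ (.refl _ _)
  intro m
  induction m with
  | zero =>
    intro s' hm hI hF hs
    obtain ⟨hS, h2⟩ := h s' hI hs hF
    by_cases h0 : e.eval s' = 0
    · exact ⟨_, s', .while_false (hS.fits hs).1 h0, hs, .refl _ _, by omega, hI, h0⟩
    · obtain ⟨t, s'', -, -, -, -, hq⟩ := h2 h0 hs
      omega
  | succ m ih =>
    intro s' hm hI hF hs
    obtain ⟨hS, h2⟩ := h s' hI hs hF
    by_cases h0 : e.eval s' = 0
    · exact ⟨_, s', .while_false (hS.fits hs).1 h0, hs, .refl _ _, by omega, hI, h0⟩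
    · obtain ⟨t, s'', hx, ho, hf, hI', hq⟩ := h2 h0 hs
      obtain ⟨t', s₃, hx', ho', hf', hq', hI'', h0'⟩ := ih s'' (by omega) hI' (hF.trans hf) ho
      exact ⟨_, s₃, .while_true (hS.fits hs).1 h0 hx hx', ho',
        Prog.Frame.trans ⟨hf.reg, hf.mem, hf.out⟩ hf', by omega, hI'', h0'⟩

end WordRAM

/-! ### Searching a graph for a collision -/

namespace GraphSearch

/-- The fixed data of a search: the number `n` of vertices, adjacency lists `L`, flags `xb` of the
excluded vertices, weights `fw`, a depth limit `D`, and the initial roots `R`, of which there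
are `rc`; the search ignores `h v w` of the edges between initial roots `v` and `w`. -/
structure Ctx where
  n : ℕ
  rc : ℕ
  D : ℕ
  L : ℕ → List ℕ
  xb : ℕ → ℕ
  fw : ℕ → ℕ
  h : ℕ → ℕ → ℕ
  R : ℕ → Prop

/-- The consistency conditions for the data of a search. -/
structure Ctx.Valid (c : Ctx) : Prop where
  lt : ∀ v < c.n, ∀ w ∈ c.L v, w < c.n
  symm : ∀ v < c.n, ∀ w < c.n, w ∈ c.L v → v ∈ c.L w
  fw_le : ∀ v, c.fw v ≤ 1
  h_root : ∀ v w, c.R v → c.xb w = 0 → c.h v w ≠ 0 → c.R w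

/-- The arrays of a search: `pos v` is the position, counted from `1`, of `v` in the queue `que`;
`sk v` and `sl v` are the (at most two) neighbours of `v`, shifted by one, that are ignored once
when the adjacency list of `v` is scanned. -/
structure Data where
  pos : ℕ → ℕ
  que : ℕ → ℕ
  sk : ℕ → ℕ
  sl : ℕ → ℕ
  dep : ℕ → ℕ

/-- Appending the vertex `w` to the queue. -/
def Data.push (d : Data) (t w a b e : ℕ) : Data where
  pos := Function.update d.pos w (t + 1)
  que := Function.update d.que t w
  sk := Function.update d.sk w a
  sl := Function.update d.sl w b
  dep := Function.update d.dep w e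

/-- How often `w` is to be ignored in the adjacency list of `v`. -/
def Data.skip (d : Data) (v w : ℕ) : ℕ :=
  (if d.sk v = w + 1 then 1 else 0) + (if d.sl v = w + 1 then 1 else 0)

/-- `w` was found from `v`. -/
def Data.Child (d : Data) (rc v w : ℕ) : Prop := rc < d.pos w ∧ d.sk w = v + 1

instance (d : Data) (rc v w : ℕ) : Decidable (d.Child rc v w) := inferInstanceAs (Decidable (_ ∧ _))

/-- The invariant of a search. The tree under construction occupies the positions from `lo`, its
roots those below `rtop`; the first `hs` vertices of the queue have been scanned, and only the
first `hb` vertices have children. -/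
structure Inv (c : Ctx) (lo rtop hs hb tail : ℕ) (d : Data) : Prop where
  rc_le : c.rc ≤ rtop
  lo_le : lo ≤ rtop
  rtop_le : rtop ≤ tail
  hb_le : hb ≤ tail
  hs_le : hs ≤ tail
  stage : (lo = 0 ∧ rtop = c.rc) ∨ (c.rc ≤ lo ∧ rtop = lo + 1)
  que : ∀ i < tail, d.pos (d.que i) = i + 1
  vis : ∀ v, d.pos v ≠ 0 → v < c.n ∧ d.pos v ≤ tail ∧ d.que (d.pos v - 1) = v ∧ c.xb v = 0 ∧
    c.fw v ≤ d.dep v ∧ d.dep v ≤ c.D + 1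
  flat : (∀ v, c.xb v = 0 → c.fw v = 0) → ∀ v, d.pos v ≠ 0 → d.dep v = 0
  par : ∀ v, rtop < d.pos v → ∃ u, d.sk v = u + 1 ∧ lo < d.pos u ∧ d.pos u < d.pos v ∧
    v ∈ c.L u ∧ d.dep v = d.dep u + c.fw v
  glob : ∀ v, c.rc < d.pos v → d.sl v = 0 ∧
    (d.sk v = 0 ∨ ∃ u, d.sk v = u + 1 ∧ d.pos u ≠ 0 ∧ d.pos u < d.pos v)
  root_dep : ∀ v, c.rc < d.pos v → d.sk v = 0 → d.dep v = c.fw v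
  child : ∀ v w, d.Child c.rc v w → d.pos v ≤ hb
  scan : ∀ v, d.pos v ≠ 0 → d.pos v ≤ hs → d.dep v ≤ c.D → ∀ w, c.xb w = 0 →
    (c.L v).count w ≤ d.skip v w + if d.Child c.rc v w then 1 else 0
  closed : ∀ v, d.pos v ≠ 0 → d.pos v ≤ lo → ∀ w ∈ c.L v, c.xb w = 0 → d.pos w ≠ 0 ∧ d.pos w ≤ lo
  root : ∀ v, c.R v ↔ d.pos v ≠ 0 ∧ d.pos v ≤ c.rc
  root_skip : ∀ v, c.R v → ∀ w, c.xb w = 0 → d.skip v w = c.h v w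

variable {c : Ctx} {lo rtop hs hb tail : ℕ} {d : Data}

/-- While the list of a vertex is being read, the vertex may already have children although it does
not yet count as scanned, so `hb` runs one ahead of `hs`. -/
lemma Inv.mono (hI : Inv c lo rtop hs hb tail d) {hs' hb' : ℕ} (h₁ : hs' ≤ hs) (h₂ : hb ≤ hb')
    (h₃ : hb' ≤ tail) : Inv c lo rtop hs' hb' tail d :=
  { hI with
    hb_le := h₃
    hs_le := h₁.trans hI.hs_le
    child := fun v w h => (hI.child v w h).trans h₂
    scan := fun v h h' => hI.scan v h (h'.trans h₁) }

lemma Inv.que_ne (hI : Inv c lo rtop hs hb tail d) {w : ℕ} (hw : d.pos w = 0) {i : ℕ}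
    (hi : i < tail) : d.que i ≠ w := by
  rintro rfl
  have := hI.que i hi
  omega

lemma Inv.que_lt (hI : Inv c lo rtop hs hb tail d) {i : ℕ} (hi : i < tail) : d.que i < c.n :=
  (hI.vis _ (by rw [hI.que i hi]; omega)).1

lemma Inv.pos_le (hI : Inv c lo rtop hs hb tail d) (v : ℕ) : d.pos v ≤ tail := by
  by_cases h : d.pos v = 0
  · omega
  · exact (hI.vis v h).2.1

lemma Inv.pos_inj (hI : Inv c lo rtop hs hb tail d) {v w : ℕ} (hv : d.pos v ≠ 0)
    (h : d.pos v = d.pos w) : v = w := by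
  rw [← (hI.vis v hv).2.2.1, ← (hI.vis w (h ▸ hv)).2.2.1, h]

lemma Inv.tail_le (hI : Inv c lo rtop hs hb tail d) : tail ≤ c.n := by
  have := Finset.card_le_card_of_injOn (s := Finset.range tail) (t := Finset.range c.n) d.que
    (fun i hi => by simpa using hI.que_lt (by simpa using hi))
    (fun i hi j hj h => by
      have h₁ := hI.que i (by simpa using hi)
      have h₂ := hI.que j (by simpa using hj)
      rw [h] at h₁
      omega)
  simpa using this

lemma Inv.tail_lt (hI : Inv c lo rtop hs hb tail d) {w : ℕ} (hw : d.pos w = 0) (hn : w < c.n) :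
    tail < c.n := by
  have := Finset.card_le_card_of_injOn (s := Finset.range tail) (t := (Finset.range c.n).erase w)
    d.que
    (fun i hi => by
      have hi : i < tail := by simpa using hi
      simp [hI.que_ne hw hi, hI.que_lt hi])
    (fun i hi j hj h => by
      have h₁ := hI.que i (by simpa using hi)
      have h₂ := hI.que j (by simpa using hj)
      rw [h] at h₁
      omega)
  rw [Finset.card_erase_of_mem (by simpa using hn)] at this
  simp at this
  omega

lemma push_pos (t w a b e v : ℕ) :
    (d.push t w a b e).pos v = if v = w then t + 1 else d.pos v := by
  simp [Data.push, Function.update_apply]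

lemma push_que (t w a b e v : ℕ) :
    (d.push t w a b e).que v = if v = t then w else d.que v := by
  simp [Data.push, Function.update_apply]

lemma push_sk (t w a b e v : ℕ) :
    (d.push t w a b e).sk v = if v = w then a else d.sk v := by
  simp [Data.push, Function.update_apply]

lemma push_sl (t w a b e v : ℕ) :
    (d.push t w a b e).sl v = if v = w then b else d.sl v := by
  simp [Data.push, Function.update_apply]

lemma push_dep (t w a b e v : ℕ) :
    (d.push t w a b e).dep v = if v = w then e else d.dep v := by
  simp [Data.push, Function.update_apply]

lemma push_skip {t w a b e v : ℕ} (h : v ≠ w) (u : ℕ) :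
    (d.push t w a b e).skip v u = d.skip v u := by
  simp [Data.skip, push_sk, push_sl, h]

lemma push_child {rc t w a b e u v : ℕ} (h : v ≠ w) :
    (d.push t w a b e).Child rc u v ↔ d.Child rc u v := by
  simp [Data.Child, push_sk, push_pos, h]

/-- Finding a new vertex `w` from `v`. -/
lemma Inv.push_child (hc : c.Valid) (hI : Inv c lo rtop hs hb tail d) {v w : ℕ} (hv : d.pos v ≠ 0)
    (hlo : lo < d.pos v) (hhb : d.pos v ≤ hb) (hD : d.dep v ≤ c.D) (hw : w ∈ c.L v)
    (hx : c.xb w = 0) (hw0 : d.pos w = 0) :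
    Inv c lo rtop hs hb (tail + 1) (d.push tail w (v + 1) 0 (d.dep v + c.fw w)) := by
  have hvw : v ≠ w := fun h => hv (h ▸ hw0)
  have hwn := hc.lt v (hI.vis v hv).1 w hw
  have hrc := hI.rc_le
  have hrt := hI.rtop_le
  have hll := hI.lo_le
  refine ⟨hI.rc_le, hI.lo_le, by omega, by have := hI.hb_le; omega, by have := hI.hs_le; omega,
    hI.stage, ?_, ?_, ?_, ?_, ?_, ?_,
    ?_, ?_, ?_, ?_, ?_⟩
  · intro i hi
    rw [push_que]
    split_ifs with h
    · simp [push_pos, h]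
    · rw [push_pos, if_neg (hI.que_ne hw0 (by omega)), hI.que i (by omega)]
  · intro u hu
    rw [push_pos] at hu ⊢
    by_cases h : u = w
    · subst h
      have := hc.fw_le u
      simp [hwn, push_que, push_dep, hx]
      omega
    · rw [if_neg h] at hu ⊢
      obtain ⟨h₁, h₂, h₃, h₄⟩ := hI.vis u hu
      refine ⟨h₁, by omega, ?_, ?_⟩
      · rw [push_que, if_neg (by omega), h₃]
      · rw [push_dep, if_neg h]
        exact h₄
  · intro hf u hu
    rw [push_pos] at hu
    rw [push_dep]
    split_ifs with h
    · rw [hI.flat hf v hv, hf w hx]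
    · exact hI.flat hf u (by simpa [h] using hu)
  · intro u hu
    rw [push_pos] at hu
    by_cases h : u = w
    · subst h
      refine ⟨v, by simp [push_sk], ?_⟩
      rw [push_pos, if_neg hvw, push_pos, if_pos rfl, push_dep, if_pos rfl, push_dep, if_neg hvw]
      exact ⟨hlo, by have := hI.pos_le v; omega, hw, rfl⟩
    · rw [if_neg h] at hu
      obtain ⟨u', h₁, h₂, h₃, h₄, h₅⟩ := hI.par u hu
      have h' : u' ≠ w := by rintro rfl; omega
      refine ⟨u', ?_⟩
      rw [push_sk, if_neg h, push_pos, if_neg h', push_pos, if_neg h, push_dep, if_neg h, push_dep,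
        if_neg h']
      exact ⟨h₁, h₂, h₃, h₄, h₅⟩
  · intro u hu
    rw [push_pos] at hu
    by_cases h : u = w
    · subst h
      refine ⟨by simp [push_sl], .inr ⟨v, by simp [push_sk], ?_⟩⟩
      rw [push_pos, if_neg hvw, push_pos, if_pos rfl]
      exact ⟨hv, by have := hI.pos_le v; omega⟩
    · rw [if_neg h] at hu
      obtain ⟨h₁, h₂⟩ := hI.glob u hu
      rw [push_sl, if_neg h, push_sk, if_neg h]
      refine ⟨h₁, h₂.imp_right ?_⟩
      rintro ⟨u', h₃, h₄, h₅⟩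
      have h' : u' ≠ w := fun h => h₄ (h ▸ hw0)
      exact ⟨u', h₃, by rwa [push_pos, if_neg h'], by rwa [push_pos, if_neg h', push_pos, if_neg h]⟩
  · intro u hu hu0
    rw [push_pos] at hu
    rw [push_sk] at hu0
    by_cases h : u = w
    · rw [if_pos h] at hu0
      omega
    · rw [if_neg h] at hu hu0
      rw [push_dep, if_neg h]
      exact hI.root_dep u hu hu0
  · intro u u' hu
    by_cases h : u' = w
    · subst h
      have h' := hu.2
      rw [push_sk, if_pos rfl] at h'
      obtain rfl : v = u := by omega
      rwa [push_pos, if_neg hvw]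
    · rw [GraphSearch.push_child h] at hu
      rw [push_pos]
      split_ifs with h'
      -- A vertex that is not yet in the queue has no children, since by `glob` every recorded
      -- parent has been visited.
      · subst h'
        obtain ⟨h₁, h₂⟩ := hI.glob u' hu.1
        have h₃ := hu.2
        obtain h₂ | ⟨u'', h₂, h₄, -⟩ := h₂
        · omega
        · obtain rfl : u = u'' := by omega
          exact absurd hw0 h₄
      · exact hI.child u u' hu
  · intro u hu hs' hd w' hw'
    have h : u ≠ w := by
      rintro rfl
      rw [push_pos, if_pos rfl] at hs'
      have := hI.hs_le
      omega
    rw [push_pos, if_neg h] at hu hs'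
    rw [push_dep, if_neg h] at hd
    rw [push_skip h]
    refine (hI.scan u hu hs' hd w' hw').trans ?_
    by_cases h' : w' = w
    · subst h'
      rw [if_neg fun h => absurd h.1 (by omega)]
      omega
    · simp only [GraphSearch.push_child h', le_refl]
  · intro u hu hu' w' hw' hx'
    rw [push_pos] at hu hu'
    have h : u ≠ w := by rintro rfl; rw [if_pos rfl] at hu'; omega
    rw [if_neg h] at hu hu'
    have := hI.closed u hu hu' w' hw' hx'
    rw [push_pos, if_neg (by rintro rfl; exact this.1 hw0)]
    exact this
  · intro u
    rw [hI.root, push_pos]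
    split_ifs with h
    · subst h; omega
    · rfl
  · intro u hu w' hw'
    rw [push_skip, hI.root_skip u hu w' hw']
    rintro rfl
    exact ((hI.root u).1 hu).1 hw0

/-- Starting a new tree at `w`. -/
lemma Inv.push_root (hI : Inv c lo rtop tail hb tail d) {w : ℕ}
    (hwn : w < c.n) (hx : c.xb w = 0) (hw0 : d.pos w = 0) (hrc : c.rc ≤ tail)
    (hfl : (∀ v, c.xb v = 0 → c.fw v = 0) ∨ tail = 0) (hc : c.Valid) :
    Inv c tail (tail + 1) tail hb (tail + 1) (d.push tail w 0 0 (c.fw w)) := by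
  refine ⟨by omega, by omega, by omega, by have := hI.hb_le; omega, by omega,
    .inr ⟨hrc, rfl⟩, ?_, ?_, ?_, ?_, ?_, ?_, ?_, ?_, ?_, ?_, ?_⟩
  · intro i hi
    rw [push_que]
    split_ifs with h
    · simp [push_pos, h]
    · rw [push_pos, if_neg (hI.que_ne hw0 (by omega)), hI.que i (by omega)]
  · intro u hu
    rw [push_pos] at hu ⊢
    by_cases h : u = w
    · subst h
      have := hc.fw_le u
      simp [hwn, push_que, push_dep, hx]
      omega
    · rw [if_neg h] at hu ⊢
      obtain ⟨h₁, h₂, h₃, h₄⟩ := hI.vis u hu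
      refine ⟨h₁, by omega, ?_, ?_⟩
      · rw [push_que, if_neg (by omega), h₃]
      · rw [push_dep, if_neg h]
        exact h₄
  · intro hf u hu
    rw [push_pos] at hu
    rw [push_dep]
    split_ifs with h
    · rw [hf w hx]
    · exact hI.flat hf u (by simpa [h] using hu)
  · intro u hu
    rw [push_pos] at hu
    have := hI.pos_le u
    split_ifs at hu <;> omega
  · intro u hu
    rw [push_pos] at hu
    by_cases h : u = w
    · subst h
      exact ⟨by simp [push_sl], .inl (by simp [push_sk])⟩
    · rw [if_neg h] at hu
      obtain ⟨h₁, h₂⟩ := hI.glob u hu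
      rw [push_sl, if_neg h, push_sk, if_neg h]
      refine ⟨h₁, h₂.imp_right ?_⟩
      rintro ⟨u', h₃, h₄, h₅⟩
      have h' : u' ≠ w := fun h => h₄ (h ▸ hw0)
      exact ⟨u', h₃, by rwa [push_pos, if_neg h'], by rwa [push_pos, if_neg h', push_pos, if_neg h]⟩
  · intro u hu hu0
    rw [push_pos] at hu
    rw [push_sk] at hu0
    by_cases h : u = w
    · rw [push_dep, if_pos h, h]
    · rw [if_neg h] at hu hu0
      rw [push_dep, if_neg h]
      exact hI.root_dep u hu hu0
  · intro u u' hu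
    by_cases h : u' = w
    · subst h
      have h' := hu.2
      rw [push_sk, if_pos rfl] at h'
      omega
    · rw [GraphSearch.push_child h] at hu
      rw [push_pos]
      split_ifs with h'
      · subst h'
        obtain ⟨h₁, h₂⟩ := hI.glob u' hu.1
        have h₃ := hu.2
        obtain h₂ | ⟨u'', h₂, h₄, -⟩ := h₂
        · omega
        · obtain rfl : u = u'' := by omega
          exact absurd hw0 h₄
      · exact hI.child u u' hu
  · intro u hu hs' hd w' hw'
    have h : u ≠ w := by
      rintro rfl
      rw [push_pos, if_pos rfl] at hs'
      omega
    rw [push_pos, if_neg h] at hu hs'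
    rw [push_dep, if_neg h] at hd
    rw [push_skip h]
    refine (hI.scan u hu hs' hd w' hw').trans ?_
    by_cases h' : w' = w
    · subst h'
      rw [if_neg fun h => absurd h.1 (by omega)]
      omega
    · simp only [GraphSearch.push_child h', le_refl]
  · intro u hu hu' w' hw' hx'
    rw [push_pos] at hu hu'
    have h : u ≠ w := by rintro rfl; rw [if_pos rfl] at hu'; omega
    rw [if_neg h] at hu hu'
    -- `scan` speaks only of vertices within the depth limit. By `hfl`, all visited vertices are
    -- within it, or there are none.
    have hd : d.dep u ≤ c.D := by
      obtain hfl | hfl := hfl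
      · rw [hI.flat hfl u hu]; omega
      · omega
    have h₁ := hI.scan u hu hu' hd w' hx'
    have h₂ : 0 < (c.L u).count w' := List.count_pos_iff.2 hw'
    -- Every entry of a scanned list is explained by a visited vertex: an edge ignored at an initial
    -- root leads to another initial root by `h_root`, and otherwise the entry is the parent or a
    -- child. So, when the queue is exhausted, the visited set is closed under adjacency.
    have h₃ : d.pos w' ≠ 0 := by
      by_cases hR : c.R u
      · rw [hI.root_skip u hR w' hx'] at h₁
        by_cases h₄ : c.h u w' = 0
        · rw [h₄] at h₁
          split_ifs at h₁ with h₅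
          · have := h₅.1
            omega
          · omega
        · exact ((hI.root w').1 (hc.h_root u w' hR hx' h₄)).1
      · have h₄ : c.rc < d.pos u := by
          by_contra h₄
          exact hR ((hI.root u).2 ⟨hu, by omega⟩)
        obtain ⟨h₅, h₆⟩ := hI.glob u h₄
        rw [Data.skip, h₅] at h₁
        by_cases h₇ : d.Child c.rc u w'
        · have := h₇.1
          omega
        · rw [if_neg h₇, if_neg (by omega : ¬ 0 = w' + 1)] at h₁
          split_ifs at h₁ with h₈
          · obtain h₆ | ⟨u'', h₆, h₉, -⟩ := h₆
            · omega
            · obtain rfl : u'' = w' := by omega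
              exact h₉
          · omega
    have := hI.pos_le w'
    rw [push_pos, if_neg (by rintro rfl; exact h₃ hw0)]
    exact ⟨h₃, this⟩
  · intro u
    rw [hI.root, push_pos]
    split_ifs with h
    · subst h; omega
    · rfl
  · intro u hu w' hw'
    rw [push_skip, hI.root_skip u hu w' hw']
    rintro rfl
    exact ((hI.root u).1 hu).1 hw0

/-- The entry `w` of the adjacency list of `v` closes a cycle, or it joins two trees. -/
structure Coll (c : Ctx) (lo : ℕ) (d : Data) (v w : ℕ) : Prop where
  pos_left : lo < d.pos v
  pos_right : lo < d.pos w
  dep : d.dep v ≤ c.D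
  mem : w ∈ c.L v
  count : d.skip v w + (if d.Child c.rc v w then 1 else 0) + 1 ≤ (c.L v).count w

/-- The state of the scan of the first `i` entries of the adjacency list of `v`. -/
def Scanned (c : Ctx) (d : Data) (v i f₁ f₂ : ℕ) : Prop :=
  ∀ w, c.xb w = 0 → ((c.L v).take i).count w =
    (if f₁ ≠ 0 ∧ d.sk v = w + 1 then 1 else 0) + (if f₂ ≠ 0 ∧ d.sl v = w + 1 then 1 else 0) +
    if d.Child c.rc v w then 1 else 0

lemma Inv.scanned_zero (hI : Inv c lo rtop hs hb tail d) {v : ℕ} (hv : hb < d.pos v) :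
    Scanned c d v 0 0 0 := by
  intro w _
  have : ¬ d.Child c.rc v w := fun h => by
    have := hI.child v w h
    omega
  simp [this]

lemma count_take_succ {l : List ℕ} {i : ℕ} (hi : i < l.length) (w : ℕ) :
    (l.take (i + 1)).count w = (l.take i).count w + if l[i] = w then 1 else 0 := by
  rw [List.take_succ_eq_append_getElem hi, List.count_append, List.count_singleton]
  simp [beq_iff_eq]

/-- This and the next three lemmas are the harmless outcomes of reading an entry: an excluded
vertex, the first or the second ignored neighbour, or a new vertex. Each keeps the balance between
the entries read and the explanations used up. -/
lemma Scanned.excluded {v i f₁ f₂ : ℕ} (h : Scanned c d v i f₁ f₂) (hi : i < (c.L v).length)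
    (hx : c.xb (c.L v)[i] ≠ 0) : Scanned c d v (i + 1) f₁ f₂ := by
  intro w hw
  rw [count_take_succ hi, if_neg (by rintro rfl; exact hx hw), add_zero, h w hw]

lemma Scanned.skip_left {v i f₂ : ℕ} (h : Scanned c d v i 0 f₂) (hi : i < (c.L v).length)
    (hx : d.sk v = (c.L v)[i] + 1) : Scanned c d v (i + 1) 1 f₂ := by
  intro w hw
  rw [count_take_succ hi, h w hw, hx]
  simp
  omega

lemma Scanned.skip_right {v i f₁ : ℕ} (h : Scanned c d v i f₁ 0) (hi : i < (c.L v).length)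
    (hx : d.sl v = (c.L v)[i] + 1) : Scanned c d v (i + 1) f₁ 1 := by
  intro w hw
  rw [count_take_succ hi, h w hw, hx]
  simp
  omega

lemma Scanned.push {v i f₁ f₂ : ℕ} (h : Scanned c d v i f₁ f₂) (hi : i < (c.L v).length)
    (hx : d.pos (c.L v)[i] = 0) (hv : d.pos v ≠ 0) (e : ℕ) (hrc : c.rc ≤ tail) :
    Scanned c (d.push tail (c.L v)[i] (v + 1) 0 e) v (i + 1) f₁ f₂ := by
  intro w hw
  have hne : v ≠ (c.L v)[i] := fun h => hv (by rw [h]; exact hx)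
  rw [count_take_succ hi, h w hw, push_sk, if_neg hne, push_sl, if_neg hne]
  by_cases hw' : w = (c.L v)[i]
  · subst hw'
    have h₁ : ¬ d.Child c.rc v (c.L v)[i] := fun h => by have := h.1; omega
    have h₂ : (d.push tail (c.L v)[i] (v + 1) 0 e).Child c.rc v (c.L v)[i] := by
      exact ⟨by rw [push_pos, if_pos rfl]; omega, by rw [push_sk, if_pos rfl]⟩
    simp [h₁, h₂]
  · simp [push_child hw', Ne.symm hw']

/-- Since both matching explanations are used up, this entry exceeds what ignored neighbours and
children account for. The other end cannot lie in a finished tree: that tree is closed under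
adjacency, so it would contain `v` as well. -/
lemma Scanned.coll {v i f₁ f₂ : ℕ} (h : Scanned c d v i f₁ f₂) (hc : c.Valid)
    (hI : Inv c lo rtop hs hb tail d) (hi : i < (c.L v).length)
    (hx : c.xb (c.L v)[i] = 0) (hD : d.dep v ≤ c.D) (hlo : lo < d.pos v)
    (h₁ : ¬ (f₁ = 0 ∧ d.sk v = (c.L v)[i] + 1)) (h₂ : ¬ (f₂ = 0 ∧ d.sl v = (c.L v)[i] + 1))
    (hw : d.pos (c.L v)[i] ≠ 0) : Coll c lo d v (c.L v)[i] := by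
  refine ⟨hlo, ?_, hD, List.getElem_mem hi, ?_⟩
  · by_contra hlo'
    have hmem := List.getElem_mem hi
    have hv := hI.vis v (by omega)
    have := hI.closed _ hw (by omega) v (hc.symm v hv.1 _ (hI.vis _ hw).1 hmem) hv.2.2.2.1
    omega
  · have h₃ := h _ hx
    have h₄ : ((c.L v).take (i + 1)).count (c.L v)[i] ≤ (c.L v).count (c.L v)[i] :=
      (List.take_sublist _ _).count_le _
    rw [count_take_succ hi, if_pos rfl, h₃] at h₄
    refine le_trans ?_ h₄
    gcongr ?_ + _ + 1
    unfold Data.skip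
    gcongr ?_ + ?_
    all_goals split_ifs <;> omega

/-- A vertex beyond the depth limit is passed over without reading its list; this is why `h` is
conditional. -/
lemma Inv.scan_vertex (hI : Inv c lo rtop hs hb tail d) {v f₁ f₂ : ℕ} (hv : d.pos v = hs + 1)
    (h : d.dep v ≤ c.D → Scanned c d v (c.L v).length f₁ f₂) (hb' : hs + 1 ≤ tail) :
    Inv c lo rtop (hs + 1) hb tail d :=
  { hI with
    hs_le := hb'
    scan := by
      intro u hu hu' hd w hw
      by_cases h' : d.pos u = hs + 1
      · obtain rfl := hI.pos_inj hu (h'.trans hv.symm)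
        have := h hd w hw
        rw [List.take_length] at this
        rw [this]
        gcongr ?_ + _
        unfold Data.skip
        gcongr ?_ + ?_
        all_goals split_ifs <;> omega
      · exact hI.scan u hu (by omega) hd w hw }

end GraphSearch

/-! ### The registers and memory banks of the program -/

notation "rN" => (0 : ℕ)
notation "rK" => (1 : ℕ)
notation "rSize" => (2 : ℕ)
notation "rLimit" => (3 : ℕ)
notation "rDepth" => (4 : ℕ)
notation "rEars" => (5 : ℕ)
notation "rCycles" => (6 : ℕ)
notation "rFound" => (7 : ℕ)
notation "rHead" => (8 : ℕ)
notation "rTail" => (9 : ℕ)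
notation "rTop" => (10 : ℕ)
notation "rV" => (11 : ℕ)
notation "rW" => (12 : ℕ)
notation "rJ" => (13 : ℕ)
notation "rEnd" => (14 : ℕ)
notation "rA" => (15 : ℕ)
notation "rB" => (16 : ℕ)
notation "rX" => (17 : ℕ)
notation "rY" => (18 : ℕ)
notation "rLo" => (19 : ℕ)
notation "rHi" => (20 : ℕ)
notation "rI" => (21 : ℕ)
notation "rBuf" => (22 : ℕ)
notation "rR" => (23 : ℕ)
notation "rStart" => (24 : ℕ)
notation "rRound" => (25 : ℕ)
notation "bOff" => (0 : ℕ)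
notation "bAdj" => (1 : ℕ)
notation "bInf" => (2 : ℕ)
notation "bDeg" => (3 : ℕ)
notation "bHadj" => (4 : ℕ)
notation "bPos" => (5 : ℕ)
notation "bQue" => (6 : ℕ)
notation "bSk" => (7 : ℕ)
notation "bSl" => (8 : ℕ)
notation "bDep" => (9 : ℕ)
notation "bTrail" => (10 : ℕ)
notation "bBuf" => (11 : ℕ)
notation "bDead" => (12 : ℕ)

/-! ### The search as a program, and its amortized running time -/

namespace WordRAM

open GraphSearch Prog WordRAM.Expr

/-- The search arrays of a state. -/
def State.sd (s : State) : Data := ⟨s.mem bPos, s.mem bQue, s.mem bSk, s.mem bSl, s.mem bDep⟩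

/-- Append the vertex in register `rR` to the queue, as a root. -/
def pushRoot (a b : Expr) : Prog :=
  store bQue (reg rTail) (reg rR) ;;
  rTail ≔ reg rTail + 1 ;;
  store bPos (reg rR) (reg rTail) ;;
  store bSk (reg rR) a ;;
  store bSl (reg rR) b ;;
  store bDep (reg rR) (mem bInf (reg rR))

/-- Process one entry of the adjacency list of the vertex in register `rV`. -/
def scanEntry (bX bL : ℕ) : Prog :=
  rW ≔ mem bL (reg rJ) ;;
  rJ ≔ reg rJ + 1 ;;
  ite (mem bX (reg rW)) skip
    (ite (((reg rA).same 0).both ((mem bSk (reg rV)).same (reg rW + 1))) (rA ≔ 1)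
      (ite (((reg rB).same 0).both ((mem bSl (reg rV)).same (reg rW + 1))) (rB ≔ 1)
        (ite (mem bPos (reg rW)) (rFound ≔ 1)
          (store bQue (reg rTail) (reg rW) ;;
          rTail ≔ reg rTail + 1 ;;
          store bPos (reg rW) (reg rTail) ;;
          store bSk (reg rW) (reg rV + 1) ;;
          store bSl (reg rW) 0 ;;
          store bDep (reg rW) (mem bDep (reg rV) + mem bInf (reg rW))))))

/-- Process the remaining entries of the adjacency list of the vertex in register `rV`. -/
def scanList (bX bL : ℕ) : Prog :=
  .while (((reg rFound).same 0).both ((reg rJ).less (reg rEnd))) (scanEntry bX bL)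

/-- Process the next vertex of the queue. -/
def scanVertex (bX bL : ℕ) (eS eE : Expr) : Prog :=
  rV ≔ mem bQue (reg rHead) ;;
  rHead ≔ reg rHead + 1 ;;
  ite ((reg rDepth).less (mem bDep (reg rV))) skip
    (rJ ≔ eS ;; rEnd ≔ eE ;; rA ≔ 0 ;; rB ≔ 0 ;; scanList bX bL)

/-- Start a new tree at the vertex in register `rR`, unless it is excluded or already visited. -/
def freshRoot (bX : ℕ) : Prog :=
  ite (((mem bX (reg rR)).same 0).both ((mem bPos (reg rR)).same 0))
    (pushRoot 0 0 ;; rTop ≔ reg rTail) skip ;;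
  rR ≔ reg rR + 1

/-- Search until a collision is found, or the queue and the supply of roots are exhausted. -/
def searchLoop (bX bL : ℕ) (eS eE : Expr) : Prog :=
  .while (((reg rFound).same 0).both ((reg rHead + reg rR).less (reg rTail + reg rN)))
    (ite ((reg rHead).less (reg rTail)) (scanVertex bX bL eS eE) (freshRoot bX))

variable {S W : ℕ} {c : Ctx} {bX bL : ℕ}

/-- The adjacency lists, the flags and the parameters of a search are stored in the state `s`. -/
structure GraphRep (S W : ℕ) (c : Ctx) (b bX bL : ℕ) (eS eE : Expr) (s : State) : Prop where
  n_lt : 2 * c.n + 2 < S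
  n_lt' : 2 * c.n + 2 < W
  D_lt : c.D + 2 < W
  notmem_X : bX < 5 ∨ 9 < bX
  notmem_L : bL < 5 ∨ 9 < bL
  costS : eS.cost ≤ 10
  costE : eE.cost ≤ 10
  regN : s.reg rN = c.n
  regD : s.reg rDepth = c.D
  memX : s.mem bX = c.xb
  memF : s.mem bInf = c.fw
  few : ∀ v < c.n, (c.L v).countP (fun w => c.xb w ≠ 0) ≤ b
  lists : ∃ st : ℕ → ℕ, ∀ v < c.n,
    (∀ s' : State, s'.mem bOff = s.mem bOff → s'.mem bDeg = s.mem bDeg → s'.reg rV = v →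
      eS.Safe S W s' ∧ eS.eval s' = st v ∧ eE.Safe S W s' ∧ eE.eval s' = st v + (c.L v).length) ∧
    ∀ i (h : i < (c.L v).length), s.mem bL (st v + i) = (c.L v)[i] ∧ st v + i + 1 < S ∧
      st v + i + 1 < W

lemma GraphRep.congr {b : ℕ} {eS eE : Expr} {s s' : State} (h : GraphRep S W c b bX bL eS eE s)
    (hm : ∀ b, b < 5 ∨ 9 < b → s'.mem b = s.mem b) (hN : s'.reg rN = s.reg rN)
    (hD : s'.reg rDepth = s.reg rDepth) : GraphRep S W c b bX bL eS eE s' :=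
  { h with
    regN := hN.trans h.regN
    regD := hD.trans h.regD
    memX := (hm _ h.notmem_X).trans h.memX
    memF := (hm _ (by omega)).trans h.memF
    lists := by
      rw [hm bOff (by omega), hm bDeg (by omega), hm bL h.notmem_L]
      exact h.lists }

/-- The invariant for the scan of the adjacency list of the vertex `v` at position `hd`. -/
structure ScanInv (c : Ctx) (lo rtop hd v st i : ℕ) (s : State) : Prop where
  regV : s.reg rV = v
  regJ : s.reg rJ = st + i
  le : i ≤ (c.L v).length
  flagA : s.reg rA ≤ 1
  flagB : s.reg rB ≤ 1
  pos : s.sd.pos v = hd + 1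
  lo_le : lo ≤ hd
  dep : s.sd.dep v ≤ c.D
  inv : Inv c lo rtop hd (hd + 1) (s.reg rTail) s.sd
  found : (s.reg rFound = 0 ∧ Scanned c s.sd v i (s.reg rA) (s.reg rB)) ∨
    (s.reg rFound = 1 ∧ Coll c lo s.sd v (s.reg rW))

@[simp] lemma State.sd_setReg (s : State) (r x : ℕ) : (s.setReg r x).sd = s.sd := rfl

@[simp] lemma State.sd_setMem (s : State) (b i x : ℕ) (h : b < 5 ∨ 9 < b) :
    (s.setMem b i x).sd = s.sd := by
  simp only [State.sd, State.setMem_mem]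
  rw [if_neg (by omega), if_neg (by omega), if_neg (by omega), if_neg (by omega),
    if_neg (by omega)]

lemma countP_drop_succ {l : List ℕ} {i : ℕ} (hi : i < l.length) (p : ℕ → Bool) :
    (l.drop i).countP p = (l.drop (i + 1)).countP p + if p l[i] then 1 else 0 := by
  rw [List.drop_eq_getElem_cons hi, List.countP_cons]

/-- The potential for the time of the scan of an adjacency list. -/
def scanPot (c : Ctx) (v i : ℕ) (s : State) : ℕ :=
  200 * (((c.L v).drop i).countP (fun w => c.xb w ≠ 0) + (1 - s.reg rA) + (1 - s.reg rB) +
    (c.n - s.reg rTail) + (1 - s.reg rFound))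

/-- Every entry consumes a resource counted by `scanPot`: an excluded entry, one of the two flags
for ignored neighbours, a vertex outside the queue, or the single collision. Thus the time does not
depend on the length of the list. The potential falls by 120, which covers the body and the loop
test. -/
lemma scanEntry_runs (hc : c.Valid) {lo rtop hd v st i : ℕ} {s : State}
    (hS : c.n < S) (hW : c.n + 2 ≤ W)
    (hX : s.mem bX = c.xb) (hf : s.mem bInf = c.fw)
    (hL : ∀ i (h : i < (c.L v).length), s.mem bL (st + i) = (c.L v)[i] ∧ st + i + 1 < S ∧
      st + i + 1 < W) (hD : c.D + 2 < W)
    (hI : ScanInv c lo rtop hd v st i s) (hi : i < (c.L v).length) (h0 : s.reg rFound = 0) :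
    Runs S W (scanEntry bX bL) s 100 fun s' => ScanInv c lo rtop hd v st (i + 1) s' ∧
      (∀ u, s.sd.pos u ≠ 0 → s'.sd.pos u = s.sd.pos u) ∧
      120 + scanPot c v (i + 1) s' ≤ scanPot c v i s := by
  obtain ⟨hw, hS', hW'⟩ := hL i hi
  have hv : s.mem bPos v ≠ 0 := by have := hI.pos; simp only [State.sd] at this; omega
  have hvis := hI.inv.vis v hv
  have hwn : (c.L v)[i] < c.n := hc.lt v hvis.1 _ (List.getElem_mem hi)
  obtain hsc : Scanned c s.sd v i (s.reg rA) (s.reg rB) := by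
    have := hI.found
    simpa [h0] using this
  have hA := hI.flagA
  have hB := hI.flagB
  have htail := hI.inv.tail_le
  have hpot := countP_drop_succ hi (fun w => decide (c.xb w ≠ 0))
  have hlo : lo < s.sd.pos v := by rw [hI.pos]; have := hI.lo_le; omega
  have hregJ := hI.regJ
  have hregV := hI.regV
  have hdv : s.mem bDep v ≤ c.D := hI.dep
  have hfw := hc.fw_le (c.L v)[i]
  have hle := hI.le
  have hpv := hI.pos
  have hdep := hI.dep
  refine Runs.of_wp' (fun Q' hQ => ?_) (by simp [scanEntry, maxCost])
  simp only [scanEntry, wp]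
  simp only [eval_reg, eval_mem, eval_add, eval_ofNat, eval_same, eval_both, safe_reg, safe_mem,
    safe_add, safe_ofNat, safe_same, safe_both, State.setReg_reg, State.setReg_mem,
    State.setMem_reg, State.setMem_mem, hI.regJ, hI.regV, hw, hX, hf,
    true_and,
    Nat.reduceEqDiff, if_true, if_false, ne_eq, Classical.not_imp, ite_eq_right_iff, one_ne_zero,
    imp_false, not_not, not_and]
  refine ⟨by omega, by omega, by omega, fun hx => ?_, fun hx => ⟨by omega,
    fun hsk => ⟨by omega, ?_⟩, fun hsk => ⟨by omega, fun hsl => ⟨by omega, ?_⟩, fun hsl =>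
    ⟨by omega, fun hp => ⟨by omega, ?_⟩, fun hp => ?_⟩⟩⟩⟩
  · refine hQ _ ⟨⟨by simp [hregV], by simp; omega, hi, by simpa, by simpa, hpv, hI.lo_le, hdep,
      by simpa using hI.inv, .inl ⟨by simpa, by simpa using hsc.excluded hi hx⟩⟩,
      fun _ _ => rfl, ?_⟩
    simp [scanPot] at hpot ⊢
    rw [if_neg hx] at hpot
    omega
  · have hA0 := hsk.1
    rw [hA0] at hsc
    refine hQ _ ⟨⟨by simp [hregV], by simp; omega, hi, by simp, by simpa, hpv, hI.lo_le, hdep,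
      by simpa using hI.inv, .inl ⟨by simpa, by simpa using hsc.skip_left hi hsk.2⟩⟩,
      fun _ _ => rfl, ?_⟩
    simp [scanPot] at hpot ⊢
    omega
  · have hB0 := hsl.1
    rw [hB0] at hsc
    refine hQ _ ⟨⟨by simp [hregV], by simp; omega, hi, by simpa, by simp, hpv, hI.lo_le, hdep,
      by simpa using hI.inv, .inl ⟨by simpa, by simpa using hsc.skip_right hi hsl.2⟩⟩,
      fun _ _ => rfl,
      ?_⟩
    simp [scanPot] at hpot ⊢
    omega
  · refine hQ _ ⟨⟨by simp [hregV], by simp; omega, hi, by simpa, by simpa, hpv, hI.lo_le, hdep,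
      by simpa using hI.inv, .inr ⟨by simp, ?_⟩⟩, fun _ _ => rfl, ?_⟩
    · simpa using hsc.coll hc hI.inv hi hx hdep hlo (fun h => hsk h.1 h.2)
        (fun h => hsl h.1 h.2) hp
    · simp [scanPot] at hpot ⊢
      omega
  · have htl := hI.inv.tail_lt hp hwn
    repeat refine ⟨by omega, ?_⟩
    have hne : v ≠ (c.L v)[i] := by rintro h; rw [← h] at hp; exact hv hp
    suffices H : ∀ s' : State, s'.sd = s.sd.push (s.reg rTail) (c.L v)[i] (v + 1) 0
        (s.mem bDep v + c.fw (c.L v)[i]) → (∀ r, r ≠ rW → r ≠ rJ → r ≠ rTail →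
        s'.reg r = s.reg r) → s'.reg rJ = st + i + 1 → s'.reg rTail = s.reg rTail + 1 →
        ScanInv c lo rtop hd v st (i + 1) s' ∧ (∀ u, s.sd.pos u ≠ 0 → s'.sd.pos u = s.sd.pos u) ∧
          120 + scanPot c v (i + 1) s' ≤ scanPot c v i s from
      hQ _ <| H _ (by simp [State.sd, Data.push]) (by intro r; simp +contextual) (by simp) (by simp)
    intro s' hsd hreg hJ hT
    refine ⟨⟨by simp [hreg, hregV], by omega, hi, by simpa [hreg], by simpa [hreg], ?_, hI.lo_le,
      ?_, ?_, .inl ⟨by simpa [hreg], ?_⟩⟩, ?_, ?_⟩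
    · rw [hsd, push_pos, if_neg hne, hpv]
    · rw [hsd, push_dep, if_neg hne]
      exact hdep
    · rw [hsd, hT]
      exact hI.inv.push_child hc hv hlo hpv.le hdep (List.getElem_mem hi) hx hp
    · rw [hsd, hreg _ (by simp) (by simp) (by simp), hreg _ (by simp) (by simp) (by simp)]
      have := hI.inv.rc_le
      have := hI.inv.rtop_le
      exact hsc.push hi hp hv _ (by omega)
    · intro u hu
      rw [hsd, push_pos, if_neg]
      rintro rfl
      exact hu hp
    · simp [scanPot, hreg, hT] at hpot ⊢
      omega

/-- The terms `c.n - s'.reg rTail` and `c.n - s.reg rTail` are kept in the bound so that the cost of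
appending vertices telescopes over the whole search. -/
lemma scanList_runs (hc : c.Valid) {lo rtop hd v st i : ℕ} {s : State}
    (hS : c.n < S) (hW : c.n + 2 ≤ W) (hX : s.mem bX = c.xb) (hf : s.mem bInf = c.fw)
    (hbX : bX < 5 ∨ 9 < bX) (hbL : bL < 5 ∨ 9 < bL)
    (hL : ∀ i (h : i < (c.L v).length), s.mem bL (st + i) = (c.L v)[i] ∧ st + i + 1 < S ∧
      st + i + 1 < W) (hD : c.D + 2 < W) (hE : s.reg rEnd = st + (c.L v).length)
    (hI : ScanInv c lo rtop hd v st i s) :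
    RunsT S W (scanList bX bL) s fun s' t => ∃ i, ScanInv c lo rtop hd v st i s' ∧
      (s'.reg rFound = 0 → i = (c.L v).length) ∧
      (∀ u, s.sd.pos u ≠ 0 → s'.sd.pos u = s.sd.pos u) ∧
      t + 200 * (c.n - s'.reg rTail) ≤
        200 * ((c.L v).countP (fun w => c.xb w ≠ 0) + 3 + (c.n - s.reg rTail)) + 12 := by
  refine (RunsT.loop (fun s' => (∃ i, ScanInv c lo rtop hd v st i s') ∧
    ∀ u, s.sd.pos u ≠ 0 → s'.sd.pos u = s.sd.pos u)
    (fun s' => scanPot c v (s'.reg rJ - st) s') ⟨⟨i, hI⟩, fun _ _ => rfl⟩ ?_).mono ?_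
  · rintro s' ⟨⟨i, hI⟩, hmon⟩ hOk hF
    have hX' : s'.mem bX = s.mem bX :=
      hF.mem bX (by simp [scanEntry, Prog.wbanks]; omega)
    have hL' : s'.mem bL = s.mem bL :=
      hF.mem bL (by simp [scanEntry, Prog.wbanks]; omega)
    have hf' : s'.mem bInf = s.mem bInf := hF.mem _ (by simp [scanEntry, Prog.wbanks])
    have hE' : s'.reg rEnd = s.reg rEnd := hF.reg _ (by simp [scanEntry, Prog.wregs])
    have hJ := hI.regJ
    refine ⟨by simp; omega, fun he => ?_⟩
    simp only [ne_eq, both_eq_zero, same_eq_zero, less_eq_zero, eval_reg, eval_ofNat,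
      not_or, not_not] at he
    refine (scanEntry_runs (bX := bX) (bL := bL) hc hS hW (hX'.trans hX) (hf'.trans hf)
      (by rw [hL']; exact hL) hD hI (by omega) he.1).toT.mono ?_
    rintro s'' t - - ⟨ht, hI', hmon', hp⟩
    refine ⟨⟨⟨_, hI'⟩, fun u hu => (hmon' u (by rwa [hmon u hu])).trans (hmon u hu)⟩, ?_⟩
    have hJ' := hI'.regJ
    rw [hJ, hJ', Nat.add_sub_cancel_left, Nat.add_sub_cancel_left]
    simp
    omega
  · rintro s' t hOk hF ⟨ht, ⟨⟨j, hj⟩, hmon⟩, he⟩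
    have hE' : s'.reg rEnd = s.reg rEnd := hF.reg _ (by simp [scanEntry, Prog.wregs])
    have hJ := hj.regJ
    have hJ' := hI.regJ
    have hle := hj.le
    refine ⟨j, hj, fun h0 => ?_, hmon, ?_⟩
    · simp only [both_eq_zero, same_eq_zero, less_eq_zero, eval_reg, eval_ofNat, h0] at he
      omega
    · rw [hJ, hJ', Nat.add_sub_cancel_left, Nat.add_sub_cancel_left] at ht
      simp only [scanPot, ne_eq, decide_not, cost_both, cost_same, cost_reg, cost_ofNat,
        cost_less] at ht ⊢
      have h₁ : ((c.L v).drop i).countP (fun w => !decide (c.xb w = 0)) ≤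
          (c.L v).countP (fun w => !decide (c.xb w = 0)) := (List.drop_sublist _ _).countP_le
      omega

end WordRAM

namespace WordRAM

open GraphSearch Prog WordRAM.Expr
variable {S W : ℕ} {c : Ctx} {bX bL : ℕ}

/-- After a collision the invariant is only claimed with `hs = 0`: the list of the current vertex
has been left half read, and extracting a trail needs only the tree structure. -/
lemma scanVertex_runs (hc : c.Valid) {b lo rtop : ℕ} {eS eE : Expr} {s : State}
    (hG : GraphRep S W c b bX bL eS eE s)
    (hI : Inv c lo rtop (s.reg rHead) (s.reg rHead) (s.reg rTail) s.sd)
    (hlo : lo ≤ s.reg rHead) (h0 : s.reg rFound = 0) (hht : s.reg rHead < s.reg rTail) :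
    RunsT S W (scanVertex bX bL eS eE) s fun s' t => s'.reg rHead = s.reg rHead + 1 ∧
      s'.reg rHead ≤ s'.reg rTail ∧
      ((s'.reg rFound = 0 ∧ Inv c lo rtop (s'.reg rHead) (s'.reg rHead) (s'.reg rTail) s'.sd) ∨
        (s'.reg rFound = 1 ∧ Inv c lo rtop 0 (s'.reg rTail) (s'.reg rTail) s'.sd ∧
          Coll c lo s'.sd (s'.reg rV) (s'.reg rW))) ∧
        (∀ u, s.sd.pos u ≠ 0 → s'.sd.pos u = s.sd.pos u) ∧
      t + 200 * (c.n - s'.reg rTail) ≤ 200 * (b + 4 + (c.n - s.reg rTail)) := by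
  obtain ⟨st, hst⟩ := hG.lists
  have hn := hG.n_lt
  have hn' := hG.n_lt'
  have hD := hG.D_lt
  have hq := hI.que _ hht
  have hvis := hI.vis (s.sd.que (s.reg rHead)) (by omega)
  have htl := hI.tail_le
  set v := s.sd.que (s.reg rHead) with hv
  have hv' : s.mem bQue (s.reg rHead) = v := rfl
  have hcS := hG.costS
  have hcE := hG.costE
  obtain ⟨hexp, hlist⟩ := hst v hvis.1
  refine .assign_seq (by simp; omega) (.assign_seq (by simp; omega) ?_)
  refine .ite (by simp [hv']; omega) (fun hd => ?_) (fun hd => ?_)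
  · refine .skip ?_
    simp [hv'] at hd
    have hd' : ¬ s.sd.dep v ≤ c.D := by rw [← hG.regD]; exact Nat.not_le.2 hd
    have := hI.mono (hs' := s.reg rHead) (hb' := s.reg rHead + 1) le_rfl (by omega) (by omega)
    refine ⟨by simp, by simp; omega, .inl ⟨by simpa, ?_⟩, fun _ _ => rfl, by simp; omega⟩
    simpa using this.scan_vertex (f₁ := 0) (f₂ := 0) hq (fun h => absurd h hd') (by omega)
  · simp [hv'] at hd
    have hd' : s.sd.dep v ≤ c.D := by rw [← hG.regD]; exact hd
    simp only [eval_reg, eval_mem, eval_add, eval_ofNat, State.setReg_reg, hv', if_false,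
      Nat.reduceEqDiff]
    have h₁ := hexp ((s.setReg rV v).setReg rHead (s.reg rHead + 1)) rfl rfl (by simp)
    have h₂ := hexp (((s.setReg rV v).setReg rHead (s.reg rHead + 1)).setReg rJ (st v)) rfl rfl
      (by simp)
    refine .assign_seq h₁.1 ?_
    rw [h₁.2.1]
    refine .assign_seq h₂.2.2.1 ?_
    rw [h₂.2.2.2]
    refine .assign_seq (by simp; omega) (.assign_seq (by simp; omega) ?_)
    refine (scanList_runs (c := c) (lo := lo) (rtop := rtop) (hd := s.reg rHead) (v := v)
      (st := st v) (i := 0) hc (by omega) (by omega) (by exact hG.memX) (by exact hG.memF)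
      hG.notmem_X hG.notmem_L (by exact hlist) hD ?_ ?_).mono ?_
    · simp
    · refine ⟨by simp, by simp, by omega, by simp, by simp, hq, hlo, hd', ?_, .inl ⟨by simpa, ?_⟩⟩
      · simpa using hI.mono (hs' := s.reg rHead) (hb' := s.reg rHead + 1) le_rfl (by omega)
          (by omega)
      · simpa using hI.scanned_zero (v := v) (by omega)
    · rintro s' t - hF ⟨i, hi, hfd, hmon, ht⟩
      have hH := hF.reg rHead (by simp [scanList, scanEntry, Prog.wregs])
      simp at hH
      have hple := hi.inv.pos_le v
      have hpos := hi.pos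
      have hfew := hG.few v hvis.1
      simp at ht hfew ⊢
      refine ⟨hH, by omega, ?_, hmon, by omega⟩
      rcases hi.found with ⟨hf0, hsc⟩ | ⟨hf1, hcoll⟩
      · refine .inl ⟨hf0, ?_⟩
        rw [hfd hf0] at hsc
        rw [hH]
        exact hi.inv.scan_vertex hpos (fun _ => hsc) (by omega)
      · exact .inr ⟨hf1, hi.inv.mono (by omega) hi.inv.hb_le le_rfl, hi.regV ▸ hcoll⟩

/-- The hypothesis `hI` has `hs` equal to the tail, so everything found so far has been scanned and
becomes a finished, closed part when the new tree starts. -/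
lemma freshRoot_runs (hc : c.Valid) {b lo : ℕ} {eS eE : Expr} {s : State}
    (hG : GraphRep S W c b bX bL eS eE s)
    (hI : Inv c lo (s.reg rTop) (s.reg rTail) (s.reg rTail) (s.reg rTail) s.sd)
    (hflat : (∀ v, c.xb v = 0 → c.fw v = 0) ∨ s.reg rTail = 0) (hr : s.reg rR < c.n) :
    Runs S W (freshRoot bX) s 100 fun s' => s'.reg rHead = s.reg rHead ∧
      s'.reg rR = s.reg rR + 1 ∧ s'.reg rFound = s.reg rFound ∧ s.reg rTail ≤ s'.reg rTail ∧
      (c.xb (s.reg rR) = 0 → s'.sd.pos (s.reg rR) ≠ 0) ∧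
      (∀ v, s.sd.pos v ≠ 0 → s'.sd.pos v = s.sd.pos v) ∧
      ((s'.reg rTail = s.reg rTail ∧ s'.reg rTop = s.reg rTop ∧ s'.sd = s.sd) ∨
        Inv c (s.reg rTail) (s'.reg rTop) (s.reg rTail) (s.reg rTail) (s'.reg rTail) s'.sd) := by
  have hn := hG.n_lt
  have hn' := hG.n_lt'
  have htl := hI.tail_le
  refine Runs.of_wp' (fun Q' hQ => ?_) (by simp [freshRoot, pushRoot, maxCost])
  simp only [freshRoot, pushRoot, wp]
  simp only [eval_reg, eval_mem, eval_add, eval_ofNat, both_eq_zero, same_eq_zero, safe_reg,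
    safe_mem, safe_add, safe_ofNat, safe_same, safe_both, State.setReg_reg, State.setReg_mem,
    State.setMem_reg, State.setMem_mem, hG.memX, hG.memF, true_and,
    Nat.reduceEqDiff, if_true, if_false, ne_eq, not_or, not_not]
  refine ⟨by omega, fun hx => ?_, fun hx => ?_⟩
  · have htl' := hI.tail_lt hx.2 hr
    repeat refine ⟨by omega, ?_⟩
    have key := hI.push_root hr hx.1 hx.2 (hI.rc_le.trans hI.rtop_le) hflat hc
    suffices H : ∀ s' : State, s'.sd = s.sd.push (s.reg rTail) (s.reg rR) 0 0
        (c.fw (s.reg rR)) → (∀ r, r ≠ rTop → r ≠ rR → r ≠ rTail →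
        s'.reg r = s.reg r) → s'.reg rTop = s.reg rTail + 1 → s'.reg rTail = s.reg rTail + 1 →
        s'.reg rR = s.reg rR + 1 → Q' s' from
      H _ (by simp [State.sd, Data.push]) (by intro r; simp +contextual) (by simp) (by simp)
        (by simp)
    intro s' hsd hreg hTop hT hR
    refine hQ _ ⟨hreg _ (by simp) (by simp) (by simp), hR, hreg _ (by simp) (by simp) (by simp),
      by omega, ?_, ?_, .inr ?_⟩
    · rw [hsd, push_pos, if_pos rfl]
      simp
    · intro v hv
      rw [hsd, push_pos, if_neg]
      rintro rfl
      exact hv hx.2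
    · rw [hsd, hTop, hT]
      exact key
  · refine ⟨by omega, hQ _ ⟨rfl, by simp, rfl, by simp, fun h => ?_, fun _ _ => rfl,
      .inl ⟨rfl, rfl, rfl⟩⟩⟩
    tauto

/-- What is known while a search is running, and when it stops. -/
structure SearchInv (c : Ctx) (r₀ st : ℕ) (s : State) : Prop where
  head_le : s.reg rHead ≤ s.reg rTail
  le_root : r₀ ≤ s.reg rR
  root_le : s.reg rR ≤ c.n
  visited : s.reg rFound = 0 → ∀ v, r₀ ≤ v → v < s.reg rR → c.xb v = 0 → s.sd.pos v ≠ 0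
  fixed : r₀ = c.n → r₀ ≠ 0 → s.reg rTop = 1 ∧ s.sd.pos st = 1
  inv : ∃ lo ≤ s.reg rHead,
    (s.reg rFound = 0 ∧ Inv c lo (s.reg rTop) (s.reg rHead) (s.reg rHead) (s.reg rTail) s.sd) ∨
    (s.reg rFound = 1 ∧ Inv c lo (s.reg rTop) 0 (s.reg rTail) (s.reg rTail) s.sd ∧
      Coll c lo s.sd (s.reg rV) (s.reg rW))

/-- The time is `O(b + 1)` for each vertex taken from the queue, plus constant amounts for each
vertex appended and each candidate root. With `r₀ = 0` all vertices are tried as roots. With `r₀ =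
c.n` no tree is started after the given roots, and only then may the depth limit be effective; this
is the alternative in `hfl`. -/
lemma searchLoop_runs (hc : c.Valid) {b r₀ st : ℕ} {eS eE : Expr} {s : State}
    (hG : GraphRep S W c b bX bL eS eE s) (hI : SearchInv c r₀ st s)
    (hfl : r₀ = c.n ∨ ∀ v, c.xb v = 0 → c.fw v = 0) :
    Runs S W (searchLoop bX bL eS eE) s (200 * ((b + 11) * (c.n + 1))) fun s' =>
      SearchInv c r₀ st s' ∧
        (s'.reg rFound = 0 → s'.reg rHead = s'.reg rTail ∧ s'.reg rR = c.n) := by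
  have hn := hG.n_lt
  have hn' := hG.n_lt'
  refine (RunsT.loop (SearchInv c r₀ st) (fun s' => 200 * ((b + 8) * (c.n - s'.reg rHead)) +
    200 * (c.n - s'.reg rTail) + 200 * (c.n - s'.reg rR)) hI ?_).toRuns ?_
  · intro s' hI hOk hF
    have hG' : GraphRep S W c b bX bL eS eE s' := by
      refine hG.congr (fun b hb => hF.mem b ?_) (hF.reg _ ?_) (hF.reg _ ?_)
      · simp [scanVertex, scanList, scanEntry, freshRoot, pushRoot, Prog.wbanks]
        omega
      all_goals simp [scanVertex, scanList, scanEntry, freshRoot, pushRoot, Prog.wregs]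
    have hN := hG'.regN
    obtain ⟨hht, hr₀, hrn, hvis, hfix, lo, hlo, hinv⟩ := hI
    have htl : s'.reg rTail ≤ c.n := by
      rcases hinv with ⟨-, h⟩ | ⟨-, h, -⟩ <;> exact h.tail_le
    refine ⟨by simp; omega, fun he => ?_⟩
    simp only [ne_eq, both_eq_zero, same_eq_zero, less_eq_zero, eval_reg, eval_ofNat, eval_add,
      not_or, not_not] at he
    obtain ⟨h0, he⟩ := he
    have hinv : Inv c lo (s'.reg rTop) (s'.reg rHead) (s'.reg rHead) (s'.reg rTail) s'.sd := by
      rcases hinv with ⟨-, h⟩ | ⟨h, -⟩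
      · exact h
      · omega
    refine .ite (by simp) (fun hlt => ?_) (fun hlt => ?_)
    · rw [ne_eq, less_eq_zero, not_not] at hlt
      refine (scanVertex_runs hc hG' hinv hlo h0 hlt).mono ?_
      rintro s'' t - hF' ⟨hH, hle, hcase, hmon, ht⟩
      have hR : s''.reg rR = s'.reg rR :=
        hF'.reg _ (by simp [scanVertex, scanList, scanEntry, Prog.wregs])
      have hT : s''.reg rTop = s'.reg rTop :=
        hF'.reg _ (by simp [scanVertex, scanList, scanEntry, Prog.wregs])
      refine ⟨⟨hle, by omega, by omega, fun _ v h₁ h₂ h₃ =>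
        by rw [hmon v (hvis h0 v h₁ (by omega) h₃)]; exact hvis h0 v h₁ (by omega) h₃,
        fun h h' => ?_, lo, by omega, by rwa [hT]⟩, ?_⟩
      · obtain ⟨h₁, h₂⟩ := hfix h h'
        exact ⟨hT.trans h₁, (hmon _ (by omega)).trans h₂⟩
      simp only [eval_reg] at hlt
      have : c.n - s'.reg rHead = c.n - s''.reg rHead + 1 := by omega
      rw [this, hR, mul_add]
      simp
      omega
    · rw [less_eq_zero] at hlt
      simp only [eval_reg] at hlt
      have hheq : s'.reg rHead = s'.reg rTail := by omega
      rw [hheq] at hinv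
      have hfl' : (∀ v, c.xb v = 0 → c.fw v = 0) ∨ s'.reg rTail = 0 := by
        rcases hfl with h | h
        · omega
        · exact .inl h
      refine (freshRoot_runs hc hG' hinv hfl' (by omega)).toT.mono ?_
      rintro s'' t - hF' ⟨ht, hH, hR, hfd, hTl, hnew, hmon, hcase⟩
      refine ⟨⟨by omega, by omega, by omega, fun _ v h₁ h₂ h₃ => ?_, fun _ _ => by omega, ?_⟩, ?_⟩
      · by_cases h : v = s'.reg rR
        · rw [h] at h₃ ⊢
          exact hnew h₃
        · rw [hmon v (hvis h0 v h₁ (by omega) h₃)]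
          exact hvis h0 v h₁ (by omega) h₃
      · rw [hfd, hH, hheq]
        rcases hcase with ⟨h₁, h₂, h₃⟩ | h
        · exact ⟨lo, by omega, .inl ⟨h0, by rwa [h₁, h₂, h₃]⟩⟩
        · exact ⟨_, le_rfl, .inl ⟨h0, h⟩⟩
      · rw [hH, hR]
        simp
        omega
  · rintro s' t hOk hF ⟨ht, hI, he⟩
    have hN' : s'.reg rN = s.reg rN := hF.reg _ (by
      simp [scanVertex, scanList, scanEntry, freshRoot, pushRoot, Prog.wregs])
    have hN := hG.regN
    refine ⟨?_, hI, fun h0 => ?_⟩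
    · simp at ht
      have h₁ : (b + 8) * (c.n - s.reg rHead) ≤ (b + 8) * c.n := by gcongr; omega
      have h₂ : (b + 11) * (c.n + 1) = (b + 8) * c.n + 3 * c.n + b + 11 := by ring
      omega
    -- As the head is at most the tail and the next root is at most `c.n`, the comparison of the two
    -- sums fails only when both inequalities are equalities.
    · simp only [both_eq_zero, same_eq_zero, less_eq_zero, eval_reg, eval_ofNat, eval_add,
        h0] at he
      have h₁ := hI.head_le
      have h₂ := hI.root_le
      omega

end WordRAM

/-! ### From a collision to a trail -/

namespace GraphSearch

variable {c : Ctx} {lo rtop hs hb tail : ℕ} {d : Data}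

/-- Walking up the trees from a collision `v`, `w`: the walk has reached `x` from `v` and `y` from
`w`, and `y :: (m ++ [x])` is the trail that has been collected. -/
structure Climb (c : Ctx) (lo rtop : ℕ) (d : Data) (v w x y : ℕ) (m : List ℕ) : Prop where
  pos_x : lo < d.pos x
  pos_y : lo < d.pos y
  chain : (y :: (m ++ [x])).IsChain fun a b => b ∈ c.L a
  nodup : m.Nodup
  big : ∀ z ∈ m, d.pos x < d.pos z ∧ d.pos y < d.pos z
  nonroot : ∀ z ∈ m, rtop < d.pos z
  weight : (m.map c.fw).sum + d.dep x + d.dep y = d.dep v + d.dep w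
  shape_zero : m = [] → y = w ∧ x = v
  shape_one : ∀ a, m = [a] → (a = v ∧ y = w ∧ d.sk v = x + 1) ∨ (a = w ∧ x = v ∧ d.sk w = y + 1)

lemma Climb.start (hc : c.Valid) (hI : Inv c lo rtop hs hb tail d) {v w : ℕ}
    (h : Coll c lo d v w) : Climb c lo rtop d v w v w [] where
  pos_x := h.pos_left
  pos_y := h.pos_right
  chain := by
    have h₁ := h.pos_left
    have h₂ := h.pos_right
    have := hc.symm v (hI.vis v (by omega)).1 w (hI.vis w (by omega)).1 h.mem
    simpa
  nodup := List.nodup_nil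
  big := by simp
  nonroot := by simp
  weight := by simp
  shape_zero := by simp
  shape_one := by simp

/-- Only the end that is later in the queue moves to its parent. All collected vertices are
therefore later than both ends, which keeps them distinct and lets the two walks meet at their first
common ancestor. A step moves the weight of `x` from its depth into the list, so `weight` is
preserved. -/
lemma Climb.left (hc : c.Valid) (hI : Inv c lo rtop hs hb tail d) {v w x y : ℕ} {m : List ℕ}
    (h : Climb c lo rtop d v w x y m) (hx : rtop < d.pos x) (hxy : d.pos y < d.pos x) :
    ∃ x', d.sk x = x' + 1 ∧ d.pos x' < d.pos x ∧ Climb c lo rtop d v w x' y (m ++ [x]) := by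
  obtain ⟨x', h₁, h₂, h₃, h₄, h₅⟩ := hI.par x hx
  have hvx := hI.vis x (by omega)
  have hvx' := hI.vis x' (by omega)
  refine ⟨x', h₁, h₃, h₂, h.pos_y, ?_, ?_, ?_, ?_, ?_, by simp, ?_⟩
  · have := h.chain
    rw [← List.cons_append] at this ⊢
    rw [List.isChain_append]
    refine ⟨this, by simp, ?_⟩
    intro a ha b hb
    rw [← List.cons_append, List.getLast?_concat] at ha
    simp at ha hb
    subst ha hb
    exact hc.symm _ hvx'.1 _ hvx.1 h₄
  · refine List.Nodup.append h.nodup (by simp) ?_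
    intro z hz hz'
    obtain rfl : z = x := by simpa using hz'
    have := (h.big z hz).1
    omega
  · intro z hz
    rw [List.mem_append, List.mem_singleton] at hz
    obtain hz | rfl := hz
    · have := h.big z hz
      omega
    · omega
  · intro z hz
    rw [List.mem_append, List.mem_singleton] at hz
    obtain hz | rfl := hz
    · exact h.nonroot z hz
    · exact hx
  · have := h.weight
    simp
    omega
  · intro a ha
    obtain ⟨rfl, rfl⟩ : m = [] ∧ x = a := by
      cases m <;> simp_all
    obtain ⟨rfl, rfl⟩ := h.shape_zero rfl
    exact .inl ⟨rfl, rfl, h₁⟩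

lemma Climb.right (hI : Inv c lo rtop hs hb tail d) {v w x y : ℕ} {m : List ℕ}
    (h : Climb c lo rtop d v w x y m) (hy : rtop < d.pos y) (hxy : d.pos x < d.pos y) :
    ∃ y', d.sk y = y' + 1 ∧ d.pos y' < d.pos y ∧ Climb c lo rtop d v w x y' (y :: m) := by
  obtain ⟨y', h₁, h₂, h₃, h₄, h₅⟩ := hI.par y hy
  refine ⟨y', h₁, h₃, h.pos_x, h₂, ?_, ?_, ?_, ?_, ?_, by simp, ?_⟩
  · exact List.isChain_cons_cons.2 ⟨h₄, h.chain⟩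
  · refine List.nodup_cons.2 ⟨fun hz => ?_, h.nodup⟩
    have := (h.big y hz).2
    omega
  · intro z hz
    rw [List.mem_cons] at hz
    obtain rfl | hz := hz
    · omega
    · have := h.big z hz
      omega
  · intro z hz
    rw [List.mem_cons] at hz
    obtain rfl | hz := hz
    · exact hy
    · exact h.nonroot z hz
  · have := h.weight
    simp
    omega
  · intro a ha
    obtain ⟨rfl, rfl⟩ : m = [] ∧ y = a := by
      cases m <;> simp_all
    obtain ⟨rfl, rfl⟩ := h.shape_zero rfl
    exact .inr ⟨rfl, rfl, h₁⟩

end GraphSearch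

/-- The list of the values `A lo, …, A (hi - 1)`. -/
def arraySlice (A : ℕ → ℕ) (lo hi : ℕ) : List ℕ := (List.range' lo (hi - lo)).map A

lemma arraySlice_congr {A B : ℕ → ℕ} {lo hi : ℕ} (h : ∀ i, lo ≤ i → i < hi → A i = B i) :
    arraySlice A lo hi = arraySlice B lo hi := by
  refine List.map_congr_left fun i hi => ?_
  rw [List.mem_range'_1] at hi
  exact h i hi.1 (by omega)

lemma arraySlice_succ {A : ℕ → ℕ} {lo hi : ℕ} (h : lo ≤ hi) :
    arraySlice A lo (hi + 1) = arraySlice A lo hi ++ [A hi] := by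
  unfold arraySlice
  rw [Nat.succ_sub h, Nat.succ_eq_add_one, List.range'_concat, List.map_append]
  simp [Nat.add_sub_cancel' h]

lemma arraySlice_pred {A : ℕ → ℕ} {lo hi : ℕ} (h : lo < hi) :
    arraySlice A lo hi = A lo :: arraySlice A (lo + 1) hi := by
  unfold arraySlice
  rw [show hi - lo = (hi - (lo + 1)) + 1 by omega, List.range'_succ, List.map_cons]

lemma length_arraySlice (A : ℕ → ℕ) (lo hi : ℕ) : (arraySlice A lo hi).length = hi - lo := by
  simp [arraySlice]

lemma getElem_arraySlice {A : ℕ → ℕ} {lo hi i : ℕ} (h : i < (arraySlice A lo hi).length) :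
    (arraySlice A lo hi)[i] = A (lo + i) := by
  simp [arraySlice]

/-! ### Climbing to the roots as a program -/

namespace WordRAM

open GraphSearch Prog WordRAM.Expr

variable {S W : ℕ} {c : Ctx}

/-- Walk up the trees from the two ends of a collision, collecting the trail in `bTrail`. -/
def climbLoop : Prog :=
  .while ((((reg rX).same (reg rY)).same 0).both
      ((reg rTop).less (mem bPos (reg rX)) + (reg rTop).less (mem bPos (reg rY))))
    (ite ((mem bPos (reg rY)).less (mem bPos (reg rX)))
      (rX ≔ mem bSk (reg rX) - 1 ;; store bTrail (reg rHi) (reg rX) ;; rHi ≔ reg rHi + 1)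
      (rLo ≔ reg rLo - 1 ;; store bTrail (reg rLo) (reg rY) ;; rY ≔ mem bSk (reg rY) - 1))

/-- Collect the trail of a collision. -/
def climb : Prog :=
  rX ≔ reg rV ;; rY ≔ reg rW ;; rLo ≔ reg rN ;; rHi ≔ reg rN + 1 ;;
  store bTrail (reg rN) (reg rV) ;;
  climbLoop ;;
  rLo ≔ reg rLo - 1 ;; store bTrail (reg rLo) (reg rY)

/-- The state during `climbLoop`. -/
structure ClimbInv (c : Ctx) (lo rtop : ℕ) (d : Data) (v w : ℕ) (m : List ℕ) (s : State) :
    Prop where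
  climb : Climb c lo rtop d v w (s.reg rX) (s.reg rY) m
  seg : arraySlice (s.mem bTrail) (s.reg rLo) (s.reg rHi) = m ++ [s.reg rX]
  lo_le : s.reg rLo ≤ c.n
  lt_hi : c.n < s.reg rHi
  hi_le : s.reg rHi + d.pos (s.reg rX) ≤ 2 * c.n + 1
  le_lo : d.pos (s.reg rY) ≤ s.reg rLo

lemma arraySlice_snoc {A : ℕ → ℕ} {lo hi : ℕ} (h : lo ≤ hi) (x : ℕ) :
    arraySlice (Function.update A hi x) lo (hi + 1) = arraySlice A lo hi ++ [x] := by
  rw [arraySlice_succ h, Function.update_self]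
  congr 1
  exact arraySlice_congr fun i _ hi => Function.update_of_ne (by omega) _ _

lemma arraySlice_cons {A : ℕ → ℕ} {lo hi : ℕ} (h : lo ≤ hi) (h0 : lo ≠ 0) (x : ℕ) :
    arraySlice (Function.update A (lo - 1) x) (lo - 1) hi = x :: arraySlice A lo hi := by
  rw [arraySlice_pred (by omega), Function.update_self, Nat.sub_add_cancel (by omega)]
  congr 1
  exact arraySlice_congr fun i hi _ => Function.update_of_ne (by omega) _ _

/-- The potential is the sum of the positions of the two ends. The trail is written outwards from
cell `c.n`; since each written cell costs at least one unit of position, it stays inside an array of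
about `2 * c.n` cells. -/
lemma climbLoop_runs (hc : c.Valid) {lo rtop hs hb tail v w : ℕ} {s : State}
    (hS : 2 * c.n + 2 < S) (hW : 2 * c.n + 2 < W) (hT : s.reg rTop = rtop)
    (hI : Inv c lo rtop hs hb tail s.sd)
    (h : ∃ m, ClimbInv c lo rtop s.sd v w m s) :
    RunsT S W climbLoop s fun s' t => t ≤ 100 * (2 * c.n + 1) ∧
      (∃ m, ClimbInv c lo rtop s.sd v w m s') ∧
      (s'.reg rX = s'.reg rY ∨
        s.sd.pos (s'.reg rX) ≤ rtop ∧ s.sd.pos (s'.reg rY) ≤ rtop) := by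
  have htl := hI.tail_le
  have hple := fun v => (hI.pos_le v).trans htl
  refine (RunsT.loop (fun s' => ∃ m, ClimbInv c lo rtop s.sd v w m s')
    (fun s' => 100 * (s.sd.pos (s'.reg rX) + s.sd.pos (s'.reg rY))) h ?_).mono ?_
  · rintro s' ⟨m, hm⟩ - hF
    have hpos : s'.mem bPos = s.sd.pos := hF.mem _ (by simp [Prog.wbanks])
    have hsk : s'.mem bSk = s.sd.sk := hF.mem _ (by simp [Prog.wbanks])
    have hT' : s'.reg rTop = rtop := (hF.reg _ (by simp [Prog.wregs])).trans hT
    have hvx := (hI.vis (s'.reg rX) (by have := hm.climb.pos_x; omega)).1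
    have hvy := (hI.vis (s'.reg rY) (by have := hm.climb.pos_y; omega)).1
    have h₁ := hm.lo_le
    have h₂ := hm.lt_hi
    have h₃ := hm.hi_le
    have h₄ := hm.le_lo
    have h₅ := hm.climb.pos_x
    have h₆ := hm.climb.pos_y
    have hite : ∀ p : Prop, ∀ _ : Decidable p, (if p then 1 else 0 : ℕ) ≤ 1 := by
      intro p _
      split_ifs <;> omega
    refine ⟨by
      simp
      exact ⟨by omega, ⟨by omega, by omega,
        lt_of_le_of_lt (add_le_add (hite _ _) (hite _ _)) (by omega)⟩, by omega⟩, fun he => ?_⟩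
    simp only [ne_eq, both_eq_zero, same_eq_zero, not_or, not_not, eval_ofNat, eval_add,
      eval_reg, eval_less, eval_mem, hpos, hT'] at he
    obtain ⟨hne, hnr⟩ := he
    -- Different vertices have different positions, so one end is strictly later. If either end lies
    -- beyond the roots, then the later one does, and it has a parent.
    have hpne : s.sd.pos (s'.reg rX) ≠ s.sd.pos (s'.reg rY) :=
      fun h => hne (hI.pos_inj (by omega) h)
    refine .ite (by simp; omega) (fun hlt => ?_) (fun hlt => ?_)
    · simp only [ne_eq, less_eq_zero, eval_mem, eval_reg, hpos, not_not] at hlt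
      have hxr : rtop < s.sd.pos (s'.reg rX) := by split_ifs at hnr <;> omega
      obtain ⟨x', hx', hpx', hcl⟩ := hm.climb.left hc hI hxr hlt
      refine (Runs.of_wp' (T := 40) (Q := fun s'' => (∃ m, ClimbInv c lo rtop s.sd v w m s'') ∧
          s.sd.pos (s''.reg rX) + s.sd.pos (s''.reg rY) <
            s.sd.pos (s'.reg rX) + s.sd.pos (s'.reg rY))
        (fun Q' hQ => ?_) (by simp [maxCost])).toT.mono ?_
      rotate_left
      · rintro s'' t - - ⟨ht, h, hlt'⟩
        refine ⟨h, ?_⟩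
        simp
        omega
      · simp only [wp]
        simp [hsk, hx']
        refine ⟨by omega, by omega, by omega, hQ _ ⟨⟨m ++ [s'.reg rX], ?_⟩, ?_⟩⟩
        · refine ⟨by simpa using hcl, ?_, by simpa, by simp; omega, by simp; omega, by simpa⟩
          simp [arraySlice_snoc (show s'.reg rLo ≤ s'.reg rHi by omega), hm.seg]
        · simpa
    · simp only [less_eq_zero, eval_mem, eval_reg, hpos] at hlt
      have hlt : s.sd.pos (s'.reg rX) < s.sd.pos (s'.reg rY) := by omega
      have hyr : rtop < s.sd.pos (s'.reg rY) := by split_ifs at hnr <;> omega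
      obtain ⟨y', hy', hpy', hcl⟩ := hm.climb.right hI hyr hlt
      refine (Runs.of_wp' (T := 40) (Q := fun s'' => (∃ m, ClimbInv c lo rtop s.sd v w m s'') ∧
          s.sd.pos (s''.reg rX) + s.sd.pos (s''.reg rY) <
            s.sd.pos (s'.reg rX) + s.sd.pos (s'.reg rY))
        (fun Q' hQ => ?_) (by simp [maxCost])).toT.mono ?_
      rotate_left
      · rintro s'' t - - ⟨ht, h, hlt'⟩
        refine ⟨h, ?_⟩
        simp
        omega
      · simp only [wp]
        simp [hsk, hy']
        refine ⟨by omega, by omega, by omega, hQ _ ⟨⟨s'.reg rY :: m, ?_⟩, ?_⟩⟩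
        · refine ⟨by simpa using hcl, ?_, by simp; omega, by simpa, by simpa, by simp; omega⟩
          simp [arraySlice_cons (show s'.reg rLo ≤ s'.reg rHi by omega) (by omega), hm.seg]
        · simpa
  · rintro s' t - hF ⟨ht, ⟨m, hm⟩, he⟩
    have hpos : s'.mem bPos = s.sd.pos := hF.mem _ (by simp [Prog.wbanks])
    have hT' : s'.reg rTop = rtop := (hF.reg _ (by simp [Prog.wregs])).trans hT
    have h₁ := hple (s.reg rX)
    have h₂ := hple (s.reg rY)
    have h₅ := hm.climb.pos_x
    have h₆ := hm.climb.pos_y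
    refine ⟨?_, ⟨m, hm⟩, ?_⟩
    · simp at ht
      omega
    · simp only [both_eq_zero, same_eq_zero, eval_ofNat, eval_add,
        eval_reg, eval_less, eval_mem, hpos, hT'] at he
      by_cases hxy : s'.reg rX = s'.reg rY
      · exact .inl hxy
      · simp [hxy] at he
        exact .inr he

/-- During the loop the left end `y` is stored only when it is left, whereas `x` is stored on
arrival; the last store therefore completes the trail. For a closed trail the common vertex is
stored at both ends. -/
lemma climb_runs (hc : c.Valid) {lo rtop hs hb tail : ℕ} {s : State} (hS : 2 * c.n + 2 < S)
    (hW : 2 * c.n + 2 < W) (hN : s.reg rN = c.n) (hT : s.reg rTop = rtop)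
    (hI : Inv c lo rtop hs hb tail s.sd) (hv : Coll c lo s.sd (s.reg rV) (s.reg rW)) :
    Runs S W climb s (300 * (c.n + 1)) fun s' => ∃ m,
      Climb c lo rtop s.sd (s.reg rV) (s.reg rW) (s'.reg rX) (s'.reg rY) m ∧
      (s'.reg rX = s'.reg rY ∨ s.sd.pos (s'.reg rX) ≤ rtop ∧ s.sd.pos (s'.reg rY) ≤ rtop) ∧
      arraySlice (s'.mem bTrail) (s'.reg rLo) (s'.reg rHi) =
        s'.reg rY :: (m ++ [s'.reg rX]) ∧ s'.reg rLo < s'.reg rHi ∧ s'.reg rHi ≤ 2 * c.n := by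
  have hpl := hv.pos_left
  have hpr := hv.pos_right
  have hvl := hI.vis _ (show s.sd.pos (s.reg rV) ≠ 0 by omega)
  have hvr := hI.vis _ (show s.sd.pos (s.reg rW) ≠ 0 by omega)
  have htl := hI.tail_le
  unfold climb
  refine RunsT.toRuns (Q := fun s' t => t ≤ 300 * (c.n + 1) ∧ _) ?_ fun _ _ _ _ h => h
  refine .assign_seq (by simp) (.assign_seq (by simp) (.assign_seq (by simp)
    (.assign_seq (by simp; omega) (.store_seq (by simp) (by simp; omega) (by simp) ?_))))
  simp only [eval_reg, eval_add, eval_ofNat, State.setReg_reg, hN, Nat.reduceEqDiff, if_false]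
  refine (climbLoop_runs (v := s.reg rV) (w := s.reg rW) hc hS hW (by simpa) (by exact hI)
    ⟨[], ?_, ?_, ?_, ?_, ?_, ?_⟩).seq ?_
  · simpa using Climb.start hc hI hv
  · simp [arraySlice]
  · simp
  · simp
  · simp; omega
  · simp; omega
  · rintro s' t - hF ⟨ht, ⟨m, hm⟩, hfin⟩
    have h₁ := hm.lo_le
    have h₂ := hm.lt_hi
    have h₃ := hm.hi_le
    have h₄ := hm.le_lo
    have h₅ := hm.climb.pos_x
    have h₆ := hm.climb.pos_y
    refine (Runs.of_wp' (T := 40) (Q := fun s'' => ∃ m,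
      Climb c lo rtop s.sd (s.reg rV) (s.reg rW) (s''.reg rX) (s''.reg rY) m ∧
      (s''.reg rX = s''.reg rY ∨ s.sd.pos (s''.reg rX) ≤ rtop ∧ s.sd.pos (s''.reg rY) ≤ rtop) ∧
      arraySlice (s''.mem bTrail) (s''.reg rLo) (s''.reg rHi) =
        s''.reg rY :: (m ++ [s''.reg rX]) ∧ s''.reg rLo < s''.reg rHi ∧ s''.reg rHi ≤ 2 * c.n)
        (fun Q' hQ => ?_) (by simp [maxCost])).toT.mono ?_
    · simp only [wp]
      simp
      refine ⟨by omega, by omega, hQ _ ⟨m, by simpa using hm.climb, by simpa using hfin, ?_,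
        by simp; omega, by simp; omega⟩⟩
      simp [arraySlice_cons (show s'.reg rLo ≤ s'.reg rHi by omega) (by omega), hm.seg]
    · rintro s'' t' - - ⟨ht', h⟩
      refine ⟨?_, h⟩
      simp
      omega

end WordRAM

/-! ### Trails, and the edges of a trail -/

/-- `y, m, x` is a trail in the multigraph with adjacency lists `L`: a path, or a cycle
if `x = y`. -/
structure IsTrail (L : ℕ → List ℕ) (y : ℕ) (m : List ℕ) (x : ℕ) : Prop where
  chain : (y :: (m ++ [x])).IsChain fun a b => b ∈ L a
  nodup_right : (m ++ [x]).Nodup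
  nodup_left : (y :: m).Nodup
  two : ∀ a, m = [a] → x = y → 2 ≤ (L x).count a

/-- The pairs of consecutive vertices of a trail. -/
def trailEdges (y : ℕ) (m : List ℕ) (x : ℕ) : List (ℕ × ℕ) := (y :: m).zip (m ++ [x])

/-- The vertices of a cycle in the multigraph with adjacency lists `L`. -/
def IsCycleList (L : ℕ → List ℕ) (C : List ℕ) : Prop := ∃ m x, C = m ++ [x] ∧ IsTrail L x m x

section Trail

variable {L : ℕ → List ℕ} {y x : ℕ} {m : List ℕ}

lemma length_trailEdges : (trailEdges y m x).length = m.length + 1 := by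
  simp [trailEdges]

lemma trailEdges_fst : (trailEdges y m x).map Prod.fst = y :: m := by
  rw [trailEdges, List.map_fst_zip (by simp)]

lemma trailEdges_snd : (trailEdges y m x).map Prod.snd = m ++ [x] := by
  rw [trailEdges, List.map_snd_zip (by simp)]

lemma mem_trailEdges {a b : ℕ} : (a, b) ∈ trailEdges y m x ↔
    ∃ (i : ℕ) (h : i < m.length + 1), (y :: m)[i] = a ∧ (m ++ [x])[i]'(by simp; omega) = b := by
  rw [trailEdges, List.mem_iff_getElem]
  simp only [List.length_zip, List.length_cons, List.length_append, List.length_nil, zero_add,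
    min_self, List.getElem_zip, Prod.mk.injEq]

lemma IsTrail.mem (h : IsTrail L y m x) {a b : ℕ} (hab : (a, b) ∈ trailEdges y m x) : b ∈ L a := by
  obtain ⟨i, hi, rfl, rfl⟩ := mem_trailEdges.1 hab
  have := List.isChain_iff_getElem.1 h.chain i (by simp; omega)
  have h₁ : (y :: (m ++ [x]))[i]'(by simp; omega) = (y :: m)[i] := by
    simp only [← List.cons_append]
    rw [List.getElem_append_left]
  simpa [h₁] using this

lemma count_le_one_of_map {E : List (ℕ × ℕ)} (h : (E.map Prod.snd).Nodup) (a : ℕ × ℕ) :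
    E.count a ≤ 1 := List.nodup_iff_count_le_one.1 (List.Nodup.of_map _ h) a

/-- A trail which traverses an edge in both directions is a cycle of length two. -/
lemma IsTrail.shape (h : IsTrail L y m x) {v w : ℕ} (hvw : v ≠ w)
    (h₁ : (v, w) ∈ trailEdges y m x) (h₂ : (w, v) ∈ trailEdges y m x) :
    x = y ∧ ((m = [w] ∧ x = v) ∨ (m = [v] ∧ x = w)) := by
  obtain ⟨i, hi, h₃, h₄⟩ := mem_trailEdges.1 h₁
  obtain ⟨j, hj, h₅, h₆⟩ := mem_trailEdges.1 h₂
  wlog hij : i ≤ j generalizing v w i j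
  · have := this hvw.symm h₂ h₁ j hj h₅ h₆ i hi h₃ h₄ (by omega)
    tauto
  have key : ∀ k (hk : k + 1 < m.length + 1), (y :: m)[k + 1] = (m ++ [x])[k]'(by simp; omega) := by
    intro k hk
    rw [List.getElem_cons_succ, List.getElem_append_left]
  obtain ⟨j, rfl⟩ : ∃ j', j = j' + 1 := by
    obtain - | j := j
    · obtain rfl : i = 0 := by omega
      exact absurd (h₃.symm.trans h₅) hvw
    · exact ⟨j, rfl⟩
  have hji : j = i := by
    rw [key j hj, ← h₄] at h₅
    exact (h.nodup_right.getElem_inj_iff).1 h₅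
  subst hji
  obtain rfl : j = 0 := by
    obtain - | i := j
    · rfl
    · rw [key i hi, ← h₆] at h₃
      have := (h.nodup_right.getElem_inj_iff).1 h₃
      omega
  have hyv : y = v := by simpa using h₃
  rcases m with - | ⟨a, - | ⟨b, m'⟩⟩
  · simp at hj
  · simp_all
  · have : y = b := by simp_all
    have h₇ := h.nodup_left
    simp [this] at h₇

/-- A trail uses no more parallel edges than exist. It passes a pair at most once in each direction
because the second components are distinct, and it passes it in both directions only as a cycle of
length two, where `two` provides the second edge. -/
lemma IsTrail.count_le (h : IsTrail L y m x) (hs : ∀ v w, (L v).count w = (L w).count v) {v w : ℕ}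
    (hvw : v ≠ w) :
    (trailEdges y m x).count (v, w) + (trailEdges y m x).count (w, v) ≤ (L v).count w := by
  have h₁ := count_le_one_of_map (trailEdges_snd (y := y) (m := m) (x := x) ▸ h.nodup_right) (v, w)
  have h₂ := count_le_one_of_map (trailEdges_snd (y := y) (m := m) (x := x) ▸ h.nodup_right) (w, v)
  by_cases h₃ : (v, w) ∈ trailEdges y m x
  · have h₅ := List.count_pos_iff.2 (h.mem h₃)
    by_cases h₄ : (w, v) ∈ trailEdges y m x
    · obtain ⟨rfl, ⟨rfl, rfl⟩ | ⟨rfl, rfl⟩⟩ := h.shape hvw h₃ h₄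
      · have := h.two _ rfl rfl
        omega
      · have := h.two _ rfl rfl
        have := hs v x
        omega
    · rw [List.count_eq_zero.2 h₄]
      omega
  · rw [List.count_eq_zero.2 h₃]
    by_cases h₄ : (w, v) ∈ trailEdges y m x
    · have h₅ := List.count_pos_iff.2 (h.mem h₄)
      rw [hs w v] at h₅
      omega
    · rw [List.count_eq_zero.2 h₄]
      omega

/-- Only a loop joins a vertex of a trail to itself. -/
lemma sum_count_le (l : List ℕ) (s : Finset ℕ) : ∑ w ∈ s, l.count w ≤ l.length := by
  induction l with
  | nil => simp
  | cons a l ih =>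
    simp only [List.count_cons, Finset.sum_add_distrib, List.length_cons, beq_iff_eq,
      Finset.sum_ite_eq]
    split_ifs <;> omega

lemma sum_count_eq {l : List ℕ} {s : Finset ℕ} (h : ∀ a ∈ l, a ∈ s) :
    ∑ w ∈ s, l.count w = l.length := by
  induction l with
  | nil => simp
  | cons a l ih =>
    simp only [List.mem_cons, forall_eq_or_imp] at h
    simp only [List.count_cons, Finset.sum_add_distrib, List.length_cons, beq_iff_eq,
      Finset.sum_ite_eq, ih h.2, if_pos h.1]

lemma sum_count_pair_eq {l : List (ℕ × ℕ)} {s : Finset ℕ} (h : ∀ a ∈ l, a.1 ∈ s ∧ a.2 ∈ s) :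
    ∑ v ∈ s, ∑ w ∈ s, l.count (v, w) = l.length := by
  induction l with
  | nil => simp
  | cons a l ih =>
    simp only [List.mem_cons, forall_eq_or_imp] at h
    have : ∑ v ∈ s, ∑ w ∈ s, (if a = (v, w) then 1 else 0) = 1 := by
      rw [Finset.sum_eq_single_of_mem a.1 h.1.1, Finset.sum_eq_single_of_mem a.2 h.1.2]
      · simp
      · intro b _ hb
        rw [if_neg fun h => hb (by rw [h])]
      · intro b _ hb
        exact Finset.sum_eq_zero fun c _ => if_neg fun h => hb (by rw [h])
    simp only [List.count_cons, Finset.sum_add_distrib, List.length_cons, beq_iff_eq, ih h.2, this]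

/-! ### Growing balls -/

/-- The number of edge ends at vertices of `s` that lead into `t`. -/
def edgeEnds (L : ℕ → List ℕ) (s t : Finset ℕ) : ℕ := ∑ v ∈ s, ∑ w ∈ t, (L v).count w

lemma edgeEnds_comm (hs : ∀ v w, (L v).count w = (L w).count v) (s t : Finset ℕ) :
    edgeEnds L s t = edgeEnds L t s := by
  unfold edgeEnds
  rw [Finset.sum_comm]
  simp only [hs]

lemma edgeEnds_sdiff (hs : ∀ v w, (L v).count w = (L w).count v) {s b : Finset ℕ} (hb : b ⊆ s) :
    edgeEnds L s s =
      edgeEnds L (s \ b) (s \ b) + edgeEnds L b s + edgeEnds L b (s \ b) := by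
  rw [edgeEnds_comm hs b (s \ b)]
  unfold edgeEnds
  rw [← Finset.sum_sdiff hb, add_right_comm, ← Finset.sum_add_distrib]
  congr 1
  exact Finset.sum_congr rfl fun v _ => (Finset.sum_sdiff hb).symm

/-- The vertices at weighted distance at most `D` from `r` induce a tree in the multigraph induced
on `A`. -/
def TreeBall (L : ℕ → List ℕ) (A : Finset ℕ) (fw : ℕ → ℕ) (D r : ℕ) : Prop :=
  ∃ pos par dep : ℕ → ℕ, pos r ≠ 0 ∧ dep r = 1 ∧
    (∀ v, pos v ≠ 0 → v ≠ r → pos (par v) ≠ 0 ∧ pos (par v) < pos v ∧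
      dep v = dep (par v) + fw v) ∧
    ∀ v, pos v ≠ 0 → dep v ≤ D → ∀ w ∈ A, (L v).count w ≤
      (if v ≠ r ∧ w = par v then 1 else 0) + (if (pos w ≠ 0 ∧ w ≠ r) ∧ par w = v then 1 else 0)

/-- `v` is reached from the root `r` of a tree inside `s`. -/
inductive TreeReach (s : Finset ℕ) (pos par : ℕ → ℕ) (r : ℕ) : ℕ → Prop
  | root : TreeReach s pos par r r
  | step {v : ℕ} : pos v ≠ 0 → v ≠ r → v ∈ s → TreeReach s pos par r (par v) →
      TreeReach s pos par r v

lemma sum_child (b t : Finset ℕ) (p : ℕ → Prop) [DecidablePred p] (par : ℕ → ℕ) :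
    ∑ v ∈ b, ∑ w ∈ t, (if p w ∧ par w = v then 1 else 0) =
      (t.filter fun w => p w ∧ par w ∈ b).card := by
  rw [Finset.sum_comm, Finset.card_filter]
  refine Finset.sum_congr rfl fun w _ => ?_
  by_cases h : p w
  · simp [h]
  · simp [h]

-- Ball growing. Inside `s`, consider the balls around `r` along the tree. If the weight grew by
-- more than `5/4` at each of `D` radii, it would exceed the total weight, against `hD`. At a radius
-- with slow growth, the ball spans one edge fewer than it has vertices, and the edges leaving it
-- are at most a quarter of its weight. The tree was found in `A`, but restricting it to the
-- vertices reached inside `s` preserves the argument.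
open Classical in
lemma TreeBall.exists_sdiff {A s : Finset ℕ} {fw : ℕ → ℕ} {D r : ℕ} (h : TreeBall L A fw D r)
    (hfw : ∀ v, fw v ≤ 1) (hsA : s ⊆ A) (hr : r ∈ s) (hfr : fw r = 1)
    (hs : ∀ v w, (L v).count w = (L w).count v) (hD : 4 ^ D * ∑ v ∈ A, fw v < 5 ^ D) :
    ∃ b ⊆ s, r ∈ b ∧ 4 * edgeEnds L s s ≤
      4 * edgeEnds L (s \ b) (s \ b) + 8 * b.card + 2 * ∑ v ∈ b, fw v := by
  obtain ⟨pos, par, dep, hpr, hdr, hpar, hcnt⟩ := h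
  set B : ℕ → Finset ℕ := fun d => s.filter fun v => TreeReach s pos par r v ∧ dep v ≤ d with hB
  have hpos : ∀ v, TreeReach s pos par r v → pos v ≠ 0 := by
    rintro v (_ | ⟨h, _⟩)
    exacts [hpr, h]
  have hBs : ∀ d, B d ⊆ s := fun d => Finset.filter_subset _ _
  have hrB : ∀ d, 1 ≤ d → r ∈ B d := fun d hd =>
    Finset.mem_filter.2 ⟨hr, .root, hdr.trans_le hd⟩
  have hmono : ∀ d, B d ⊆ B (d + 1) := fun d v hv => by
    rw [hB, Finset.mem_filter] at hv ⊢
    exact ⟨hv.1, hv.2.1, by omega⟩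
  have hup : ∀ d v, v ∈ B d → v ≠ r → par v ∈ s ∧ par v ∈ B d := by
    intro d v hv hvr
    rw [hB, Finset.mem_filter] at hv
    obtain ⟨h₁, h₂, h₃⟩ := hv
    have h₄ := hpar v (hpos v h₂) hvr
    cases h₂ with
    | root => exact absurd rfl hvr
    | step h₅ h₆ h₇ h₈ =>
      have h₉ : par v ∈ s := by
        cases h₈ with
        | root => exact hr
        | step _ _ h _ => exact h
      exact ⟨h₉, Finset.mem_filter.2 ⟨h₉, h₈, by omega⟩⟩
  -- Weights are 0 or 1, so a child that leaves the ball has weight exactly 1 and lies in the next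
  -- ball. Leaving edges are thus paid by new weight.
  have hdown : ∀ d w, w ∈ s → (pos w ≠ 0 ∧ w ≠ r) → par w ∈ B d → w ∉ B d →
      fw w = 1 ∧ w ∈ B (d + 1) := by
    intro d w hw h₁ h₂ h₃
    rw [hB, Finset.mem_filter] at h₂ h₃
    have h₄ := (hpar w h₁.1 h₁.2).2.2
    have h₅ : TreeReach s pos par r w := .step h₁.1 h₁.2 hw h₂.2.1
    have h₆ := hfw w
    have h₇ : ¬ dep w ≤ d := fun h => h₃ ⟨hw, h₅, h⟩
    refine ⟨by omega, Finset.mem_filter.2 ⟨hw, h₅, by omega⟩⟩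
  -- The ball has `(B d).card - 1` inner edges with two ends each. The edges to the set `N` of
  -- outside children are counted once in each of the first two terms, and `N` is at most the gain
  -- of weight from `B d` to `B (d + 1)`.
  have hmain : ∀ d, 1 ≤ d → d ≤ D →
      edgeEnds L (B d) s + edgeEnds L (B d) (s \ B d) + 2 + 2 * ∑ v ∈ B d, fw v ≤
        2 * (B d).card + 2 * ∑ v ∈ B (d + 1), fw v := by
    intro d hd hdD
    have hc : ∀ v ∈ B d, ∀ w ∈ s, (L v).count w ≤ (if v ≠ r ∧ w = par v then 1 else 0) +
        (if (pos w ≠ 0 ∧ w ≠ r) ∧ par w = v then 1 else 0) := by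
      intro v hv w hw
      rw [hB, Finset.mem_filter] at hv
      exact hcnt v (hpos v hv.2.1) (hv.2.2.trans hdD) w (hsA hw)
    set N := (s \ B d).filter fun w => (pos w ≠ 0 ∧ w ≠ r) ∧ par w ∈ B d with hN
    have h₁ : edgeEnds L (B d) (s \ B d) ≤ N.card := by
      rw [hN, ← sum_child]
      refine Finset.sum_le_sum fun v hv => Finset.sum_le_sum fun w hw => ?_
      refine (hc v hv w (Finset.sdiff_subset hw)).trans ?_
      rw [if_neg, zero_add]
      rintro ⟨h₁, rfl⟩
      exact (Finset.mem_sdiff.1 hw).2 (hup d v hv h₁).2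
    have h₂ : edgeEnds L (B d) s ≤ ((B d).erase r).card +
        (s.filter fun w => (pos w ≠ 0 ∧ w ≠ r) ∧ par w ∈ B d).card := by
      rw [← sum_child, ← Finset.filter_ne', Finset.card_filter, ← Finset.sum_add_distrib]
      refine Finset.sum_le_sum fun v hv => ?_
      refine (Finset.sum_le_sum fun w hw => hc v hv w hw).trans ?_
      rw [Finset.sum_add_distrib]
      gcongr
      by_cases h : v ≠ r
      · simp only [h, ne_eq, not_false_eq_true, true_and, Finset.sum_ite_eq', if_true]
        split_ifs <;> omega
      · simp [h]
    have h₃ : (s.filter fun w => (pos w ≠ 0 ∧ w ≠ r) ∧ par w ∈ B d).card ≤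
        ((B d).erase r).card + N.card := by
      refine (Finset.card_le_card (t := (B d).erase r ∪ N) ?_).trans (Finset.card_union_le _ _)
      intro w hw
      rw [Finset.mem_filter] at hw
      by_cases h : w ∈ B d
      · exact Finset.mem_union_left _ (Finset.mem_erase.2 ⟨hw.2.1.2, h⟩)
      · exact Finset.mem_union_right _
          (Finset.mem_filter.2 ⟨Finset.mem_sdiff.2 ⟨hw.1, h⟩, hw.2⟩)
    have h₄ : ∑ v ∈ B d, fw v + N.card ≤ ∑ v ∈ B (d + 1), fw v := by
      have hdisj : Disjoint (B d) N :=
        (Finset.disjoint_sdiff).mono_right (Finset.filter_subset _ _)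
      have hNs : ∀ w ∈ N, fw w = 1 ∧ w ∈ B (d + 1) := by
        intro w hw
        rw [hN, Finset.mem_filter, Finset.mem_sdiff] at hw
        exact hdown d w hw.1.1 hw.2.1 hw.2.2 hw.1.2
      have : N.card = ∑ v ∈ N, fw v := by
        rw [Finset.card_eq_sum_ones]
        exact Finset.sum_congr rfl fun w hw => ((hNs w hw).1).symm
      rw [this, ← Finset.sum_union hdisj]
      exact Finset.sum_le_sum_of_subset (Finset.union_subset (hmono d) fun w hw => (hNs w hw).2)
    have h₅ := Finset.card_erase_add_one (hrB d hd)
    omega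
  -- The growth starts from weight at least 1, since `r` has weight 1 and lies in `B 1`.
  have hex : ∃ d, 1 ≤ d ∧ d ≤ D ∧ 4 * ∑ v ∈ B (d + 1), fw v ≤ 5 * ∑ v ∈ B d, fw v := by
    by_contra! hcon
    have hgrow : ∀ d ≤ D, 5 ^ d ≤ 4 ^ d * ∑ v ∈ B (d + 1), fw v := by
      intro d hd
      induction d with
      | zero =>
        have := Finset.single_le_sum (f := fw) (fun _ _ => Nat.zero_le _) (hrB 1 le_rfl)
        simp
        omega
      | succ d ih =>
        have h₁ := ih (by omega)
        have h₂ := hcon (d + 1) (by omega) hd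
        calc 5 ^ (d + 1) = 5 ^ d * 5 := pow_succ _ _
          _ ≤ 4 ^ d * (∑ v ∈ B (d + 1), fw v) * 5 := by gcongr
          _ = 4 ^ d * (5 * ∑ v ∈ B (d + 1), fw v) := by ring
          _ ≤ 4 ^ d * (4 * ∑ v ∈ B (d + 1 + 1), fw v) := by gcongr
          _ = 4 ^ (d + 1) * ∑ v ∈ B (d + 1 + 1), fw v := by ring
    have h₁ := hgrow D le_rfl
    have h₂ : ∑ v ∈ B (D + 1), fw v ≤ ∑ v ∈ A, fw v :=
      Finset.sum_le_sum_of_subset ((hBs _).trans hsA)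
    have h₃ := Nat.mul_le_mul_left (4 ^ D) h₂
    omega
  obtain ⟨d, hd₁, hd₂, hd₃⟩ := hex
  refine ⟨B d, hBs d, hrB d hd₁, ?_⟩
  have h₁ := hmain d hd₁ hd₂
  have h₂ := edgeEnds_sdiff hs (hBs d)
  omega

/-- If all balls of radius `D` are trees, then there are few edges. -/
lemma edgeEnds_le_of_treeBall {A : Finset ℕ} {fw : ℕ → ℕ} {D : ℕ}
    (hb : ∀ r ∈ A, fw r = 1 → TreeBall L A fw D r)
    (hfw : ∀ v, fw v ≤ 1) (hdeg : ∀ v ∈ A, fw v = 0 → (L v).length ≤ 2)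
    (hs : ∀ v w, (L v).count w = (L w).count v) (hD : 4 ^ D * ∑ v ∈ A, fw v < 5 ^ D) :
    4 * edgeEnds L A A ≤ 8 * A.card + 2 * ∑ v ∈ A, fw v := by
  suffices H : ∀ k (s : Finset ℕ), s.card ≤ k → s ⊆ A →
      4 * edgeEnds L s s ≤ 8 * s.card + 2 * ∑ v ∈ s, fw v from H _ A le_rfl le_rfl
  intro k
  induction k with
  | zero =>
    intro s hk _
    obtain rfl : s = ∅ := Finset.card_eq_zero.1 (by omega)
    simp [edgeEnds]
  | succ k ih =>
    intro s hk hsA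
    -- Remove a ball as long as there is a vertex of weight one. Afterwards all degrees are at most
    -- two, so there are no more edges than vertices.
    by_cases h : ∃ r ∈ s, fw r = 1
    · obtain ⟨r, hr, hfr⟩ := h
      obtain ⟨b, hbs, hrb, hle⟩ := (hb r (hsA hr) hfr).exists_sdiff hfw hsA hr hfr hs hD
      have h₁ := Finset.card_sdiff_add_card_eq_card hbs
      have h₂ := Finset.sum_sdiff hbs (f := fw)
      have h₃ : 0 < b.card := Finset.card_pos.2 ⟨r, hrb⟩
      have h₄ := ih (s \ b) (by omega) (Finset.sdiff_subset.trans hsA)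
      omega
    · push Not at h
      have : edgeEnds L s s ≤ ∑ v ∈ s, 2 := by
        refine Finset.sum_le_sum fun v hv => (sum_count_le _ _).trans (hdeg v (hsA hv) ?_)
        have := hfw v
        have := h v hv
        omega
      rw [Finset.sum_const, smul_eq_mul] at this
      omega

/-- Deleting a cycle removes few edges. -/
lemma IsTrail.edgeEnds_sdiff {A : Finset ℕ} {fw : ℕ → ℕ} (h : IsTrail L x m x)
    (hs : ∀ v w, (L v).count w = (L w).count v) (hloop : ∀ v, v ∈ L v → 2 ≤ (L v).count v)
    (hdeg : ∀ v ∈ A, (L v).length ≤ 2 + 2 * fw v) (hC : (m ++ [x]).toFinset ⊆ A) :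
    edgeEnds L A A + 2 * (A \ (m ++ [x]).toFinset).card ≤
      edgeEnds L (A \ (m ++ [x]).toFinset) (A \ (m ++ [x]).toFinset) + 2 * A.card +
        4 * ∑ v ∈ (m ++ [x]).toFinset, fw v := by
  set C := (m ++ [x]).toFinset with hCdef
  have hcard : C.card = m.length + 1 := by
    rw [hCdef, List.toFinset_card_of_nodup h.nodup_right]
    simp
  have h₁ := _root_.edgeEnds_sdiff hs hC
  have h₂ := Finset.card_sdiff_add_card_eq_card hC
  have h₃ : edgeEnds L C A = edgeEnds L C (A \ C) + edgeEnds L C C := by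
    unfold edgeEnds
    rw [← Finset.sum_add_distrib]
    exact Finset.sum_congr rfl fun v _ => (Finset.sum_sdiff hC).symm
  have h₄ : edgeEnds L C A ≤ 2 * C.card + 2 * ∑ v ∈ C, fw v := by
    rw [mul_comm 2 C.card, ← smul_eq_mul, ← Finset.sum_const, Finset.mul_sum,
      ← Finset.sum_add_distrib]
    exact Finset.sum_le_sum fun v hv => (sum_count_le _ _).trans (hdeg v (hC hv))
  -- The loss is `2 * edgeEnds L C A - edgeEnds L C C`. The degree bound controls the first term;
  -- the edges of the cycle itself, with both ends in `C`, bound the second from below.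
  have h₅ : 2 * C.card ≤ edgeEnds L C C := by
    have h₆ : ∀ e ∈ trailEdges x m x, e.1 ∈ C ∧ e.2 ∈ C := by
      intro e he
      have h₇ := List.mem_map_of_mem (f := Prod.fst) he
      have h₈ := List.mem_map_of_mem (f := Prod.snd) he
      rw [trailEdges_fst] at h₇
      rw [trailEdges_snd] at h₈
      simp only [hCdef, List.mem_toFinset, List.mem_append,
        List.mem_cons] at h₇ h₈ ⊢
      tauto
    calc 2 * C.card = ∑ v ∈ C, ∑ w ∈ C, (trailEdges x m x).count (v, w) +
          ∑ v ∈ C, ∑ w ∈ C, (trailEdges x m x).count (w, v) := by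
          rw [Finset.sum_comm (f := fun v w => (trailEdges x m x).count (w, v)),
            sum_count_pair_eq h₆, length_trailEdges, hcard]
          ring
      _ ≤ edgeEnds L C C := by
          unfold edgeEnds
          simp only [← Finset.sum_add_distrib]
          refine Finset.sum_le_sum fun v _ => Finset.sum_le_sum fun w _ => ?_
          by_cases hvw : v = w
          · subst hvw
            by_cases hv : (v, v) ∈ trailEdges x m x
            · have := hloop v (h.mem hv)
              have := count_le_one_of_map
                (trailEdges_snd (y := x) (m := m) (x := x) ▸ h.nodup_right) (v, v)
              omega
            · rw [List.count_eq_zero.2 hv]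
              omega
          · exact h.count_le hs hvw
  omega

end Trail

/-- A ranking of the vertices in `P` that shows that the multigraph with adjacency lists `L` has no
cycle inside `P`: each vertex is joined to at most one vertex of smaller rank, by one edge. -/
def IsForestRanking (L : ℕ → List ℕ) (P : ℕ → Prop) (rk : ℕ → ℕ) : Prop :=
  ∀ v, P v → ∀ w ∈ L v, P w → rk w ≠ rk v ∧ (rk w < rk v → (L v).count w ≤ 1 ∧
    ∀ w' ∈ L v, P w' → rk w' < rk v → w' = w)

namespace GraphSearch

variable {c : Ctx} {lo rtop hs hb tail : ℕ} {d : Data}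

/-- The delicate point is a cycle of length two. It arises when one end of the collision is the tree
parent of the other; the tree edge is already accounted for in `Coll.count`, so the colliding entry
is a second parallel edge. -/
lemma Climb.isTrail {v w x y : ℕ} {m : List ℕ} (h : Climb c lo rtop d v w x y m)
    (hrc : c.rc ≤ rtop) (hC : Coll c lo d v w)
    (hs : ∀ v w, (c.L v).count w = (c.L w).count v) : IsTrail c.L y m x where
  chain := h.chain
  nodup_right := by
    refine List.Nodup.append h.nodup (by simp) fun z hz hz' => ?_
    obtain rfl : z = x := by simpa using hz'
    have := h.big z hz
    omega
  nodup_left := by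
    refine List.nodup_cons.2 ⟨fun hz => ?_, h.nodup⟩
    have := h.big y hz
    omega
  two := by
    rintro a rfl rfl
    have h₁ := hC.count
    obtain ⟨rfl, rfl, h₂⟩ | ⟨rfl, rfl, h₂⟩ := h.shape_one a rfl
    · rw [Data.skip, if_pos h₂] at h₁
      rw [hs]
      omega
    · have h₃ := h.nonroot a (by simp)
      rw [if_pos ⟨by omega, h₂⟩] at h₁
      omega

/-- A completed search in which the initial roots induce a forest shows that everything is a
forest. -/
lemma Inv.isForestRanking {n : ℕ} (hI : Inv c lo rtop tail hb tail d) (hn : ∀ v, n ≤ v → c.L v = [])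
    (hD : ∀ v, d.pos v ≠ 0 → d.dep v ≤ c.D)
    (hall : ∀ v < n, c.xb v = 0 → d.pos v ≠ 0) (hs : ∀ v w, (c.L v).count w = (c.L w).count v)
    {H : ℕ → List ℕ} (hH : ∀ v w, c.h v w = (H v).count w) {rk : ℕ → ℕ} {M : ℕ}
    (hM : ∀ v, c.R v → rk v < M)
    (hrk : IsForestRanking H c.R rk) :
    IsForestRanking c.L (fun v => c.xb v = 0) fun v =>
      if d.pos v ≤ c.rc then rk v else M + d.pos v := by
  have hlt : ∀ v w, w ∈ c.L v → v < n := by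
    intro v w hw
    by_contra h
    rw [hn v (by omega)] at hw
    simp at hw
  have hlt' : ∀ v w, w ∈ c.L v → w < n := by
    intro v w hw
    have h₁ := List.count_pos_iff.2 hw
    rw [hs] at h₁
    exact hlt w v (List.count_pos_iff.1 h₁)
  have hcount : ∀ v w, w ∈ c.L v → c.xb v = 0 → c.xb w = 0 →
      (c.L v).count w ≤ d.skip v w + if d.Child c.rc v w then 1 else 0 := by
    intro v w hw hv hw'
    have h₁ := hall v (hlt v w hw) hv
    exact hI.scan v h₁ (hI.pos_le v) (hD v h₁) w hw'
  -- Outside the initial roots, the only neighbour earlier in the queue is the parent, by a single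
  -- edge: a child comes later, and nothing else explains an entry.
  have hskip : ∀ v w, w ∈ c.L v → c.xb v = 0 → c.xb w = 0 → c.rc < d.pos v →
      d.pos w < d.pos v → d.sk v = w + 1 ∧ (c.L v).count w ≤ 1 := by
    intro v w hw hv hw' h₁ h₂
    have h₃ := hcount v w hw hv hw'
    have h₄ := List.count_pos_iff.2 hw
    obtain ⟨h₅, h₆⟩ := hI.glob v h₁
    rw [Data.skip, h₅, if_neg (by omega : ¬ 0 = w + 1)] at h₃
    have h₇ : ¬ d.Child c.rc v w := by
      rintro ⟨h₇, h₈⟩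
      obtain ⟨-, h₉ | ⟨u, h₉, -, h₁₀⟩⟩ := hI.glob w h₇
      · omega
      · obtain rfl : u = v := by omega
        omega
    rw [if_neg h₇] at h₃
    split_ifs at h₃ with h₈
    · exact ⟨h₈, by omega⟩
    · omega
  intro v hv w hw hw0
  have hvp := hall v (hlt v w hw) hv
  have hwp := hall w (hlt' v w hw) hw0
  -- Equal positions would mean a loop, which is neither a parent edge nor a child edge.
  have hne : c.rc < d.pos v → d.pos w ≠ d.pos v := by
    intro h₁ h₂
    obtain rfl := hI.pos_inj hwp h₂
    have h₃ := hcount w w hw hv hv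
    have h₄ := List.count_pos_iff.2 hw
    obtain ⟨h₅, h₆⟩ := hI.glob w h₁
    rw [Data.skip, h₅, if_neg (by omega : ¬ 0 = w + 1)] at h₃
    have h₇ : ¬ d.sk w = w + 1 := by
      intro h₈
      obtain h₉ | ⟨u, h₉, -, h₁₀⟩ := h₆
      · omega
      · obtain rfl : u = w := by omega
        omega
    rw [if_neg h₇, if_neg fun h => h₇ h.2] at h₃
    omega
  have hroot : ∀ v, d.pos v ≠ 0 → d.pos v ≤ c.rc → c.R v := fun v h h' => (hI.root v).2 ⟨h, h'⟩
  by_cases h₁ : d.pos v ≤ c.rc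
  · have hvR := hroot v hvp h₁
    -- Two initial roots are joined only by edges of `H`, so among them the ranking of `H` applies;
    -- all other vertices have rank above `M`.
    have hin : ∀ u ∈ c.L v, c.xb u = 0 → d.pos u ≤ c.rc → (c.L v).count u ≤ (H v).count u := by
      intro u hu hu0 hur
      have := hcount v u hu hv hu0
      rw [if_neg fun h => by have := h.1; omega, hI.root_skip v hvR u hu0, hH] at this
      exact this
    have hmem : ∀ u ∈ c.L v, c.xb u = 0 → d.pos u ≤ c.rc → u ∈ H v := fun u hu hu0 hur =>
      List.count_pos_iff.1 ((List.count_pos_iff.2 hu).trans_le (hin u hu hu0 hur))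
    simp only [if_pos h₁]
    have hMv := hM v hvR
    by_cases h₂ : d.pos w ≤ c.rc
    · simp only [if_pos h₂]
      have hwR := hroot w hwp h₂
      obtain ⟨h₃, h₄⟩ := hrk v hvR w (hmem w hw hw0 h₂) hwR
      refine ⟨h₃, fun h₅ => ⟨(hin w hw hw0 h₂).trans (h₄ h₅).1, fun w' hw' hw'0 h₆ => ?_⟩⟩
      split_ifs at h₆ with h₇
      · have hw'p := hall w' (hlt' v w' hw') hw'0
        exact (h₄ h₅).2 w' (hmem w' hw' hw'0 h₇) (hroot w' hw'p h₇) h₆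
      · omega
    · simp only [if_neg h₂]
      exact ⟨by omega, fun h => by omega⟩
  · simp only [if_neg h₁]
    have hlow : ∀ u ∈ c.L v, c.xb u = 0 →
        (if d.pos u ≤ c.rc then rk u else M + d.pos u) < M + d.pos v → d.pos u < d.pos v := by
      intro u _ _ h
      split_ifs at h with h' <;> omega
    refine ⟨?_, fun h₂ => ?_⟩
    · split_ifs with h₂
      · have := hM w (hroot w hwp h₂)
        omega
      · have := hne (by omega)
        omega
    · obtain ⟨h₃, h₄⟩ := hskip v w hw hv hw0 (by omega) (hlow w hw hw0 h₂)
      refine ⟨h₄, fun w' hw' hw'0 h₅ => ?_⟩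
      obtain ⟨h₆, -⟩ := hskip v w' hw' hv hw'0 (by omega) (hlow w' hw' hw'0 h₅)
      omega

end GraphSearch

/-! ### Adding a trail to a subgraph -/

/-- Add an edge to adjacency lists; both ends of a loop are listed. -/
def addEdge (H : ℕ → List ℕ) (e : ℕ × ℕ) (v : ℕ) : List ℕ :=
  H v ++ (if v = e.1 then [e.2] else []) ++ (if v = e.2 then [e.1] else [])

lemma count_foldl_addEdge (E : List (ℕ × ℕ)) (H : ℕ → List ℕ) (v w : ℕ) :
    (E.foldl addEdge H v).count w = (H v).count w + E.count (v, w) + E.count (w, v) := by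
  induction E generalizing H with
  | nil => simp
  | cons e E ih =>
    rw [List.foldl_cons, ih, addEdge, List.count_append, List.count_append, List.count_cons,
      List.count_cons]
    have h₁ : (if v = e.1 then [e.2] else []).count w = if (e == (v, w)) = true then 1 else 0 := by
      simp only [beq_iff_eq, Prod.ext_iff]
      by_cases h : v = e.1
      · simp [h, List.count_singleton]
      · simp [h, Ne.symm h]
    have h₂ : (if v = e.2 then [e.1] else []).count w = if (e == (w, v)) = true then 1 else 0 := by
      simp only [beq_iff_eq, Prod.ext_iff]
      by_cases h : v = e.2
      · simp [h, List.count_singleton]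
      · simp [h, Ne.symm h]
    omega

lemma length_foldl_addEdge (E : List (ℕ × ℕ)) (H : ℕ → List ℕ) (v : ℕ) :
    (E.foldl addEdge H v).length =
      (H v).length + (E.map Prod.fst).count v + (E.map Prod.snd).count v := by
  induction E generalizing H with
  | nil => simp
  | cons e E ih =>
    rw [List.foldl_cons, ih, addEdge, List.length_append, List.length_append, List.map_cons,
      List.map_cons, List.count_cons, List.count_cons]
    have h₁ : (if v = e.1 then [e.2] else []).length = if (e.1 == v) = true then 1 else 0 := by
      simp only [beq_iff_eq]
      by_cases h : v = e.1
      · simp [h]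
      · simp [h, Ne.symm h]
    have h₂ : (if v = e.2 then [e.1] else []).length = if (e.2 == v) = true then 1 else 0 := by
      simp only [beq_iff_eq]
      by_cases h : v = e.2
      · simp [h]
      · simp [h, Ne.symm h]
    omega

/-- `H` is a subgraph, in which all degrees are `2` except at the flagged vertices, and which is
a forest after the deletion of the flagged vertices. -/
structure FlaggedSubgraph (n : ℕ) (L H : ℕ → List ℕ) (fl : ℕ → ℕ) : Prop where
  out : ∀ v, n ≤ v → H v = []
  symm : ∀ v w, (H v).count w = (H w).count v
  count_le : ∀ v w, v ≠ w → (H v).count w ≤ (L v).count w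
  loop : ∀ v, v ∈ H v → v ∈ L v ∧ 2 ≤ (H v).count v
  fl_le : ∀ v, fl v ≤ 1
  fl_ne : ∀ v, fl v ≠ 0 → H v ≠ []
  two : ∀ v, fl v = 0 → H v = [] ∨ (H v).length = 2
  four : ∀ v, (H v).length ≤ 4
  rank : ∃ rk, IsForestRanking H (fun v => fl v = 0) rk

/-- Setting flags at two vertices. -/
def setFlags (fl : ℕ → ℕ) (x y : ℕ) : ℕ → ℕ := fun v => if v = x ∨ v = y then 1 else fl v

section AddTrail

variable {n : ℕ} {L H : ℕ → List ℕ} {fl : ℕ → ℕ} {y x : ℕ} {m : List ℕ}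

lemma length_addTrail (v : ℕ) : ((trailEdges y m x).foldl addEdge H v).length =
    (H v).length + (y :: m).count v + (m ++ [x]).count v := by
  rw [length_foldl_addEdge, trailEdges_fst, trailEdges_snd]

lemma mem_trailEdges_inner {v w : ℕ} (h : (v, w) ∈ trailEdges y m x) (hv : v ≠ y) (hw : w ≠ x) :
    ∃ (i : ℕ) (hi : i + 1 < m.length), m[i] = v ∧ m[i + 1] = w := by
  obtain ⟨i, hi, h₁, h₂⟩ := mem_trailEdges.1 h
  obtain - | i := i
  · exact absurd h₁.symm hv
  · by_cases h₃ : i + 1 < m.length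
    · rw [List.getElem_append_left h₃] at h₂
      exact ⟨i, h₃, by simpa using h₁, h₂⟩
    · rw [List.getElem_append_right (by omega)] at h₂
      simp at h₂
      exact absurd h₂.symm hw

lemma addTrail_eq_nil {v : ℕ} : (trailEdges y m x).foldl addEdge H v = [] ↔
    H v = [] ∧ v ∉ m ∧ v ≠ x ∧ v ≠ y := by
  rw [← List.length_eq_zero_iff, length_addTrail, ← List.length_eq_zero_iff, Nat.add_eq_zero_iff,
    Nat.add_eq_zero_iff, List.count_eq_zero, List.count_eq_zero]
  simp
  tauto

lemma FlaggedSubgraph.lt (hH : FlaggedSubgraph n L H fl) {v w : ℕ} (h : w ∈ H v) : w < n := by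
  have h₁ := List.count_pos_iff.2 h
  rw [hH.symm] at h₁
  by_contra h₂
  rw [hH.out w (by omega)] at h₁
  simp at h₁

/-- Inner vertices are new and get degree two. An end was unflagged, hence had degree zero or two,
and gains at most two; being flagged from now on, it is never used again, so four is a lasting
bound. Deleting the flagged ends turns the new trail into a path detached from the old forest. -/
lemma FlaggedSubgraph.add_trail (hH : FlaggedSubgraph n L H fl) (ht : IsTrail L y m x)
    (hs : ∀ v w, (L v).count w = (L w).count v)
    (hlt : ∀ v ∈ y :: (m ++ [x]), v < n ∧ fl v = 0) (hm : ∀ v ∈ m, H v = [])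
    (hends : x = y ∨ H x ≠ [] ∧ H y ≠ [])
    (hopen : m = [] → x ≠ y → (H y).count x + 1 ≤ (L y).count x) :
    FlaggedSubgraph n L ((trailEdges y m x).foldl addEdge H) (setFlags fl x y) := by
  have hy : y ∉ m := (List.nodup_cons.1 ht.nodup_left).1
  have hx : x ∉ m := fun h => by
    have := ht.nodup_right
    rw [List.nodup_append] at this
    exact this.2.2 x h x (by simp) rfl
  have hmn : m.Nodup := (List.nodup_cons.1 ht.nodup_left).2
  have hcnt := count_le_one_of_map (trailEdges_snd (y := y) (m := m) (x := x) ▸ ht.nodup_right)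
  have hcm : ∀ v, m.count v = if v ∈ m then 1 else 0 := fun v => by
    split_ifs with h
    · exact List.count_eq_one_of_mem hmn h
    · exact List.count_eq_zero.2 h
  have hlen : ∀ v, ((trailEdges y m x).foldl addEdge H v).length = (H v).length +
      (if v ∈ m then 2 else 0) + (if v = x then 1 else 0) + (if v = y then 1 else 0) := by
    intro v
    rw [length_addTrail, List.count_cons, List.count_append, List.count_singleton, hcm]
    simp only [beq_iff_eq, eq_comm (a := v)]
    split_ifs <;> omega
  refine ⟨?_, ?_, ?_, ?_, ?_, ?_, ?_, ?_, ?_⟩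
  · intro v hv
    rw [addTrail_eq_nil]
    refine ⟨hH.out v hv, fun h => ?_, ?_, ?_⟩
    · have := hlt v (by simp [h])
      omega
    · rintro rfl
      have := hlt v (by simp)
      omega
    · rintro rfl
      have := hlt v (by simp)
      omega
  · intro v w
    rw [count_foldl_addEdge, count_foldl_addEdge, hH.symm v w]
    omega
  · intro v w hvw
    rw [count_foldl_addEdge]
    have h₁ := ht.count_le hs hvw
    by_cases h₂ : v ∈ m ∨ w ∈ m
    · have : (H v).count w = 0 := by
        obtain h₂ | h₂ := h₂
        · rw [hm v h₂]
          rfl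
        · rw [hH.symm, hm w h₂]
          rfl
      omega
    · push Not at h₂
      -- Only a trail without inner vertices has an edge between vertices that may both be old;
      -- `hopen` guarantees a copy of it not yet in `H`.
      have hE : ∀ a b, (a, b) ∈ trailEdges y m x → a ∉ m → b ∉ m → m = [] ∧ a = y ∧ b = x := by
        intro a b hab ha hb
        obtain ⟨i, hi, h₃, h₄⟩ := mem_trailEdges.1 hab
        obtain - | i := i
        · obtain - | ⟨z, m⟩ := m
          · exact ⟨rfl, by simpa using h₃.symm, by simpa using h₄.symm⟩
          · simp at h₄ hb
            exact absurd h₄.symm hb.1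
        · rw [List.getElem_cons_succ] at h₃
          exact absurd (h₃ ▸ List.getElem_mem _) ha
      have h₃ := hcnt (v, w)
      have h₄ := hcnt (w, v)
      have h₅ := hH.count_le v w hvw
      by_cases h₆ : (v, w) ∈ trailEdges y m x
      · obtain ⟨rfl, rfl, rfl⟩ := hE _ _ h₆ h₂.1 h₂.2
        have h₇ := hopen rfl hvw.symm
        have h₈ : (trailEdges v [] w).count (w, v) = 0 := by
          rw [List.count_eq_zero]
          intro h
          have := hE _ _ h (by simp) (by simp)
          omega
        omega
      · rw [List.count_eq_zero.2 h₆]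
        by_cases h₇ : (w, v) ∈ trailEdges y m x
        · obtain ⟨rfl, rfl, rfl⟩ := hE _ _ h₇ h₂.2 h₂.1
          have h₈ := hopen rfl hvw
          rw [hs, hH.symm] at h₈
          omega
        · rw [List.count_eq_zero.2 h₇]
          omega
  · intro v hv
    have h₁ := List.count_pos_iff.2 hv
    rw [count_foldl_addEdge] at h₁ ⊢
    by_cases h₂ : v ∈ H v
    · obtain ⟨h₃, h₄⟩ := hH.loop v h₂
      exact ⟨h₃, by omega⟩
    · rw [List.count_eq_zero.2 h₂] at h₁
      have h₃ : (v, v) ∈ trailEdges y m x := List.count_pos_iff.1 (by omega)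
      exact ⟨ht.mem h₃, by omega⟩
  · intro v
    have := hH.fl_le v
    unfold setFlags
    split_ifs <;> omega
  · intro v hv
    rw [Ne, addTrail_eq_nil]
    unfold setFlags at hv
    split_ifs at hv with h
    · tauto
    · have := hH.fl_ne v hv
      tauto
  · intro v hv
    unfold setFlags at hv
    split_ifs at hv with h
    rw [← List.length_eq_zero_iff, hlen, if_neg (by tauto : ¬ v = x), if_neg (by tauto : ¬ v = y)]
    split_ifs with h₁
    · simp [hm v h₁]
    · simpa using hH.two v hv
  · intro v
    rw [hlen]
    have h₁ := hH.four v
    by_cases h₂ : v ∈ m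
    · rw [hm v h₂]
      split_ifs <;> simp
    · rw [if_neg h₂]
      by_cases h₃ : v = x ∨ v = y
      · have h₄ := (hlt v (by simp; tauto)).2
        have h₅ := hH.two v h₄
        rw [← List.length_eq_zero_iff] at h₅
        split_ifs <;> omega
      · push Not at h₃
        rw [if_neg h₃.1, if_neg h₃.2]
        omega
  · obtain ⟨rk, hrk⟩ := hH.rank
    -- New vertices are ranked by their place on the path. Its links to older vertices go through
    -- the ends, which are flagged, so the two rankings never have to be compared.
    refine ⟨fun z => if z ∈ m then m.idxOf z else rk z, ?_⟩
    have hP : ∀ v, setFlags fl x y v = 0 → v ≠ x ∧ v ≠ y ∧ fl v = 0 := by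
      intro v hv
      unfold setFlags at hv
      split_ifs at hv with h
      tauto
    have hidx : ∀ a b, (a, b) ∈ trailEdges y m x → a ≠ y → b ≠ x →
        a ∈ m ∧ b ∈ m ∧ m.idxOf b = m.idxOf a + 1 := by
      intro a b hab ha hb
      obtain ⟨i, hi, rfl, rfl⟩ := mem_trailEdges_inner hab ha hb
      refine ⟨List.getElem_mem _, List.getElem_mem _, ?_⟩
      rw [hmn.idxOf_getElem, hmn.idxOf_getElem]
    have hnb : ∀ v w, setFlags fl x y v = 0 → setFlags fl x y w = 0 →
        w ∈ (trailEdges y m x).foldl addEdge H v →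
        (v ∈ m ∧ w ∈ m ∧ ((w, v) ∈ trailEdges y m x ∧ m.idxOf v = m.idxOf w + 1 ∨
          (v, w) ∈ trailEdges y m x ∧ m.idxOf w = m.idxOf v + 1) ∧ (H v).count w = 0) ∨
        (v ∉ m ∧ w ∉ m ∧ w ∈ H v ∧ (v, w) ∉ trailEdges y m x ∧ (w, v) ∉ trailEdges y m x) := by
      intro v w hv hw hvw
      obtain ⟨hv₁, hv₂, -⟩ := hP v hv
      obtain ⟨hw₁, hw₂, -⟩ := hP w hw
      have h₁ := List.count_pos_iff.2 hvw
      rw [count_foldl_addEdge] at h₁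
      by_cases h₂ : (v, w) ∈ trailEdges y m x
      · obtain ⟨h₃, h₄, h₅⟩ := hidx _ _ h₂ hv₂ hw₁
        exact .inl ⟨h₃, h₄, .inr ⟨h₂, h₅⟩, by rw [hm v h₃]; rfl⟩
      · by_cases h₃ : (w, v) ∈ trailEdges y m x
        · obtain ⟨h₄, h₅, h₆⟩ := hidx _ _ h₃ hw₂ hv₁
          exact .inl ⟨h₅, h₄, .inl ⟨h₃, h₆⟩, by rw [hm v h₅]; rfl⟩
        · rw [List.count_eq_zero.2 h₂, List.count_eq_zero.2 h₃] at h₁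
          have h₄ : w ∈ H v := List.count_pos_iff.1 (by omega)
          refine .inr ⟨fun h => ?_, fun h => ?_, h₄, h₂, h₃⟩
          · rw [hm v h] at h₄
            simp at h₄
          · have h₅ := List.count_pos_iff.2 h₄
            rw [hH.symm, hm w h] at h₅
            simp at h₅
    intro v hv w hw hw0
    obtain ⟨hv₁, hv₂, hv₃⟩ := hP v hv
    obtain ⟨hw₁, hw₂, hw₃⟩ := hP w hw0
    obtain ⟨h₁, h₂, h₃, h₄⟩ | ⟨h₁, h₂, h₃, h₄, h₅⟩ := hnb v w hv hw0 hw
    · simp only [if_pos h₁, if_pos h₂]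
      refine ⟨by omega, fun h₅ => ⟨?_, ?_⟩⟩
      · rw [count_foldl_addEdge, h₄]
        have h₆ : (v, w) ∉ trailEdges y m x := fun h => by
          have := (hidx _ _ h hv₂ hw₁).2.2
          omega
        rw [List.count_eq_zero.2 h₆]
        have := hcnt (w, v)
        omega
      · intro w' hw' hw'0 h₆
        obtain ⟨h₇, h₈, h₉, h₁₀⟩ | ⟨h₇, -⟩ := hnb v w' hv hw'0 hw'
        · rw [if_pos h₈] at h₆
          exact (List.idxOf_inj h₈).1 (by omega)
        · exact absurd h₁ h₇
    · simp only [if_neg h₁, if_neg h₂]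
      obtain ⟨h₆, h₇⟩ := hrk v hv₃ w h₃ hw₃
      refine ⟨h₆, fun h₈ => ⟨?_, ?_⟩⟩
      · rw [count_foldl_addEdge, List.count_eq_zero.2 h₄, List.count_eq_zero.2 h₅]
        exact (h₇ h₈).1
      · intro w' hw' hw'0 h₉
        obtain ⟨h₁₀, -⟩ | ⟨-, h₁₁, h₁₂, -⟩ := hnb v w' hv hw'0 hw'
        · exact absurd h₁₀ h₁
        · rw [if_neg h₁₁] at h₉
          exact (h₇ h₈).2 w' h₁₂ (hP w' hw'0).2.2 h₉

end AddTrail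

/-! ### The subgraph built by the algorithm -/

/-- A subgraph with flags, together with disjoint cycles in it. -/
structure Packing (n : ℕ) (L H : ℕ → List ℕ) (fl : ℕ → ℕ) (p q : ℕ) (Cs : List (List ℕ)) : Prop
    extends FlaggedSubgraph n L H fl where
  sum_length : ∑ v ∈ Finset.range n, (H v).length =
    2 * ((Finset.range n).filter fun v => H v ≠ []).card + 2 * p
  sum_fl : ∑ v ∈ Finset.range n, fl v ≤ 2 * p + q
  empty : q = 0 → p = 0 ∧ ∀ v, H v = []
  length_eq : Cs.length = q
  cycle : ∀ C ∈ Cs, IsCycleList L C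
  disjoint : Cs.Pairwise List.Disjoint
  used : ∀ C ∈ Cs, ∀ v ∈ C, H v ≠ []

section Packing

variable {n : ℕ} {L H : ℕ → List ℕ} {fl : ℕ → ℕ} {y x p q : ℕ} {m : List ℕ} {Cs : List (List ℕ)}

lemma packing_empty (n : ℕ) (L : ℕ → List ℕ) :
    Packing n L (fun _ => []) (fun _ => 0) 0 0 [] where
  out := by simp
  symm := by simp
  count_le := by simp
  loop := by simp
  fl_le := by simp
  fl_ne := by simp
  two := by simp
  four := by simp
  rank := ⟨fun _ => 0, by intro v _ w hw; simp at hw⟩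
  sum_length := by simp
  sum_fl := by simp
  empty := by simp
  length_eq := rfl
  cycle := by simp
  disjoint := .nil
  used := by simp

lemma sum_length_addTrail (hlt : ∀ v ∈ y :: (m ++ [x]), v < n) :
    ∑ v ∈ Finset.range n, ((trailEdges y m x).foldl addEdge H v).length =
      ∑ v ∈ Finset.range n, (H v).length + 2 * (m.length + 1) := by
  simp only [length_addTrail, Finset.sum_add_distrib]
  rw [sum_count_eq (l := y :: m) fun a ha => Finset.mem_range.2 (hlt a (by simp at ha ⊢; tauto)),
    sum_count_eq (l := m ++ [x]) fun a ha => Finset.mem_range.2 (hlt a (List.mem_cons_of_mem _ ha))]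
  simp
  ring

lemma sum_setFlags_le (s : Finset ℕ) :
    ∑ v ∈ s, setFlags fl x y v ≤ ∑ v ∈ s, fl v + if x = y then 1 else 2 := by
  have h : ∀ v, setFlags fl x y v ≤
      fl v + (if v = x then 1 else 0) + if x = y then 0 else if v = y then 1 else 0 := by
    intro v
    unfold setFlags
    by_cases h₁ : v = x
    · simp only [h₁, true_or, if_true]
      omega
    · by_cases h₂ : v = y
      · have : x ≠ y := fun h => h₁ (h₂.trans h.symm)
        simp [h₂, this]
      · simp [h₁, h₂]
  refine (Finset.sum_le_sum fun v _ => h v).trans ?_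
  rw [Finset.sum_add_distrib, Finset.sum_add_distrib, Finset.sum_ite_eq']
  split_ifs
  all_goals try rw [Finset.sum_ite_eq']
  all_goals try simp only [Finset.sum_const_zero]
  all_goals try split_ifs
  all_goals omega

/-- A disjoint cycle brings as many edges as vertices, so the surplus `p` is unchanged, and one flag
suffices to break it. -/
lemma Packing.add_cycle (hP : Packing n L H fl p q Cs) (ht : IsTrail L x m x)
    (hs : ∀ v w, (L v).count w = (L w).count v)
    (hlt : ∀ v ∈ x :: (m ++ [x]), v < n ∧ fl v = 0) (hm : ∀ v ∈ m, H v = []) (hx : H x = []) :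
    Packing n L ((trailEdges x m x).foldl addEdge H) (setFlags fl x x) p (q + 1)
      (Cs ++ [m ++ [x]]) where
  toFlaggedSubgraph := hP.add_trail ht hs hlt hm (.inl rfl) fun _ h => absurd rfl h
  sum_length := by
    rw [sum_length_addTrail fun v hv => (hlt v hv).1, hP.sum_length]
    have : ((Finset.range n).filter fun v => (trailEdges x m x).foldl addEdge H v ≠ []).card =
        ((Finset.range n).filter fun v => H v ≠ []).card + (m.length + 1) := by
      rw [show m.length + 1 = (m ++ [x]).toFinset.card by
        rw [List.toFinset_card_of_nodup ht.nodup_right]; simp]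
      rw [← Finset.card_union_of_disjoint]
      · congr 1
        ext v
        simp only [ne_eq, addTrail_eq_nil, Finset.mem_filter, Finset.mem_range, Finset.mem_union,
          List.mem_toFinset, List.mem_append, List.mem_singleton]
        have : v ∈ m ∨ v = x → v < n := fun h => (hlt v (by simp; tauto)).1
        tauto
      · rw [Finset.disjoint_left]
        intro v hv hv'
        simp only [Finset.mem_filter, List.mem_toFinset, List.mem_append,
          List.mem_singleton] at hv hv'
        obtain h | rfl := hv'
        exacts [hv.2 (hm v h), hv.2 hx]
    rw [this]
    ring
  sum_fl := by
    have h₁ := sum_setFlags_le (fl := fl) (x := x) (y := x) (Finset.range n)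
    have h₂ := hP.sum_fl
    rw [if_pos rfl] at h₁
    omega
  empty := by simp
  length_eq := by simp [hP.length_eq]
  cycle := by
    intro C hC
    rw [List.mem_append, List.mem_singleton] at hC
    obtain hC | rfl := hC
    exacts [hP.cycle C hC, ⟨m, x, rfl, ht⟩]
  disjoint := by
    rw [List.pairwise_append]
    refine ⟨hP.disjoint, by simp, fun C hC C' hC' v hv hv' => hP.used C hC v hv ?_⟩
    rw [List.mem_singleton] at hC'
    subst hC'
    rw [List.mem_append, List.mem_singleton] at hv'
    obtain h | rfl := hv'
    exacts [hm v h, hx]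
  used := by
    intro C hC v hv
    rw [Ne, addTrail_eq_nil]
    rw [List.mem_append, List.mem_singleton] at hC
    obtain hC | rfl := hC
    · have := hP.used C hC v hv
      tauto
    · rw [List.mem_append, List.mem_singleton] at hv
      tauto

/-- An ear brings one edge more than new vertices and at most two flags. It needs a vertex of `H` to
start from, so no ear precedes the first cycle; this keeps `empty` true. -/
lemma Packing.add_ear (hP : Packing n L H fl p q Cs) (ht : IsTrail L y m x)
    (hs : ∀ v w, (L v).count w = (L w).count v)
    (hlt : ∀ v ∈ y :: (m ++ [x]), v < n ∧ fl v = 0) (hm : ∀ v ∈ m, H v = []) (hx : H x ≠ [])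
    (hy : H y ≠ [])
    (hopen : m = [] → x ≠ y → (H y).count x + 1 ≤ (L y).count x) :
    Packing n L ((trailEdges y m x).foldl addEdge H) (setFlags fl x y) (p + 1) q Cs where
  toFlaggedSubgraph := hP.add_trail ht hs hlt hm (.inr ⟨hx, hy⟩) hopen
  sum_length := by
    rw [sum_length_addTrail fun v hv => (hlt v hv).1, hP.sum_length]
    have hmn := (List.nodup_cons.1 ht.nodup_left).2
    have : ((Finset.range n).filter fun v => (trailEdges y m x).foldl addEdge H v ≠ []).card =
        ((Finset.range n).filter fun v => H v ≠ []).card + m.length := by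
      rw [← List.toFinset_card_of_nodup hmn]
      rw [← Finset.card_union_of_disjoint]
      · congr 1
        ext v
        simp only [ne_eq, addTrail_eq_nil, Finset.mem_filter, Finset.mem_range, Finset.mem_union,
          List.mem_toFinset]
        have h₁ : v ∈ m ∨ v = x ∨ v = y → v < n := fun h => (hlt v (by simp; tauto)).1
        have h₂ : v = x → H v ≠ [] := by rintro rfl; exact hx
        have h₃ : v = y → H v ≠ [] := by rintro rfl; exact hy
        tauto
      · rw [Finset.disjoint_left]
        intro v hv hv'
        simp only [Finset.mem_filter, List.mem_toFinset] at hv hv'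
        exact hv.2 (hm v hv')
    rw [this]
    ring
  sum_fl := by
    have h₁ := sum_setFlags_le (fl := fl) (x := x) (y := y) (Finset.range n)
    have h₂ := hP.sum_fl
    split_ifs at h₁ <;> omega
  empty := fun hq => absurd ((hP.empty hq).2 x) hx
  length_eq := hP.length_eq
  cycle := hP.cycle
  disjoint := hP.disjoint
  used := by
    intro C hC v hv
    rw [Ne, addTrail_eq_nil]
    have := hP.used C hC v hv
    tauto

/-! ### Extracting short cycles -/

/-- `Cs` are disjoint cycles of `H`, with few flagged vertices, whose vertices are marked by
`dd`. -/
structure Extraction (n : ℕ) (H : ℕ → List ℕ) (fl : ℕ → ℕ) (B : ℕ) (dd : ℕ → ℕ)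
    (Cs : List (List ℕ)) : Prop where
  cycle : ∀ C ∈ Cs, IsCycleList H C
  disjoint : Cs.Pairwise List.Disjoint
  marked : ∀ v, dd v ≠ 0 ↔ ∃ C ∈ Cs, v ∈ C
  many : edgeEnds H ((Finset.range n).filter fun v => H v ≠ [])
      ((Finset.range n).filter fun v => H v ≠ []) +
      2 * ((Finset.range n).filter fun v => H v ≠ [] ∧ dd v = 0).card ≤
    edgeEnds H ((Finset.range n).filter fun v => H v ≠ [] ∧ dd v = 0)
      ((Finset.range n).filter fun v => H v ≠ [] ∧ dd v = 0) +
      2 * ((Finset.range n).filter fun v => H v ≠ []).card + 4 * (B * Cs.length)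

lemma extraction_zero (n : ℕ) (H : ℕ → List ℕ) (fl : ℕ → ℕ) (B : ℕ) :
    Extraction n H fl B (fun _ => 0) [] where
  cycle := by simp
  disjoint := .nil
  marked := by simp
  many := by simp

lemma FlaggedSubgraph.length_le (hH : FlaggedSubgraph n L H fl) (v : ℕ) :
    (H v).length ≤ 2 + 2 * fl v := by
  by_cases h : fl v = 0
  · obtain h | h := hH.two v h
    · simp [h]
    · omega
  · have := hH.four v
    omega

/-- Degrees are at most two, plus two at flagged vertices, so by `IsTrail.edgeEnds_sdiff` a cycle
with at most `B` flags costs at most `4 * B` of the surplus of edge ends. -/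
lemma Extraction.add {B : ℕ} {dd dd' : ℕ → ℕ} (hE : Extraction n H fl B dd Cs)
    (hH : FlaggedSubgraph n L H fl) (ht : IsTrail H x m x) (hdd : ∀ v ∈ m ++ [x], dd v = 0)
    (hne : ∀ v ∈ m ++ [x], H v ≠ [])
    (hdd' : ∀ v, dd' v ≠ 0 ↔ dd v ≠ 0 ∨ v ∈ m ++ [x]) (hB : ((m ++ [x]).map fl).sum ≤ B) :
    Extraction n H fl B dd' (Cs ++ [m ++ [x]]) where
  cycle := by
    intro C hC
    rw [List.mem_append, List.mem_singleton] at hC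
    obtain hC | rfl := hC
    exacts [hE.cycle C hC, ⟨m, x, rfl, ht⟩]
  disjoint := by
    rw [List.pairwise_append]
    refine ⟨hE.disjoint, by simp, fun C hC C' hC' v hv hv' => ?_⟩
    rw [List.mem_singleton] at hC'
    subst hC'
    exact (hE.marked v).2 ⟨C, hC, hv⟩ (hdd v hv')
  marked := by
    intro v
    rw [hdd', hE.marked]
    simp [or_and_right, exists_or]
  many := by
    have h₂ := hE.many
    set A := (Finset.range n).filter fun v => H v ≠ [] ∧ dd v = 0
    have hA : ((Finset.range n).filter fun v => H v ≠ [] ∧ dd' v = 0) =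
        A \ (m ++ [x]).toFinset := by
      ext v
      have := hdd' v
      simp only [A, Finset.mem_filter, Finset.mem_sdiff, List.mem_toFinset]
      tauto
    have hsub : (m ++ [x]).toFinset ⊆ A := by
      intro v hv
      rw [List.mem_toFinset] at hv
      have h₁ := hne v hv
      refine Finset.mem_filter.2 ⟨?_, h₁, hdd v hv⟩
      rw [Finset.mem_range]
      by_contra h
      exact h₁ (hH.out v (by omega))
    have h₁ := ht.edgeEnds_sdiff hH.symm (fun v hv => (hH.loop v hv).2)
      (fun v _ => hH.length_le v) hsub
    have h₃ : ∑ v ∈ (m ++ [x]).toFinset, fl v ≤ B := by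
      rwa [List.sum_toFinset _ ht.nodup_right]
    rw [hA, List.length_append, List.length_singleton, mul_add, mul_one]
    omega

/-- As long as few cycles have been extracted, there is a vertex near which there is a cycle. -/
lemma Packing.not_treeBall (hP : Packing n L H fl p q Cs) {D k : ℕ} {dd : ℕ → ℕ}
    {Es : List (List ℕ)} (hE : Extraction n H fl (2 * D + 1) dd Es) (hk : Es.length < k)
    (hp : 8 * (2 * D + 1) * k < p) (hq : q ≤ k) (hD : 4 ^ D * (3 * p) < 5 ^ D)
    (hb : ∀ r < n, H r ≠ [] → dd r = 0 → fl r = 1 →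
      TreeBall H ((Finset.range n).filter fun v => H v ≠ [] ∧ dd v = 0) fl D r) : False := by
  have h₂ := hE.many
  set A := (Finset.range n).filter fun v => H v ≠ [] ∧ dd v = 0
  have hkp : k ≤ p := by nlinarith
  have hfA : ∑ v ∈ A, fl v ≤ 3 * p :=
    (Finset.sum_le_sum_of_subset (Finset.filter_subset _ _)).trans (hP.sum_fl.trans (by omega))
  have h₁ := edgeEnds_le_of_treeBall (L := H) (A := A) (fw := fl) (D := D)
    (fun r hr hfr => by
      simp only [A, Finset.mem_filter, Finset.mem_range] at hr
      exact hb r hr.1 hr.2.1 hr.2.2 hfr) hP.fl_le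
    (fun v _ hv => by have := hP.length_le v; omega) hP.symm
    ((Nat.mul_le_mul_left _ hfA).trans_lt hD)
  have h₃ : edgeEnds H ((Finset.range n).filter fun v => H v ≠ [])
      ((Finset.range n).filter fun v => H v ≠ []) = ∑ v ∈ Finset.range n, (H v).length := by
    rw [← Finset.sum_filter_of_ne (p := fun v => H v ≠ [])]
    · refine Finset.sum_congr rfl fun v _ => sum_count_eq fun w hw => ?_
      have h := List.count_pos_iff.2 hw
      rw [hP.symm] at h
      exact Finset.mem_filter.2 ⟨Finset.mem_range.2 (hP.lt hw),
        List.ne_nil_of_mem (List.count_pos_iff.1 h)⟩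
    · intro v _ hv h
      simp [h] at hv
  rw [h₃, hP.sum_length] at h₂
  -- In edge ends, the surplus over twice the number of vertices is `2 * p` at the start and at
  -- least `2 * p - 4 * (2 * D + 1) * k` now, while `h₁` and `hfA` allow at most 3p/2. This would
  -- force `p ≤ 8 * (2 * D + 1) * k`.
  have h₄ : 4 * ((2 * D + 1) * Es.length) ≤ 4 * ((2 * D + 1) * k) := by gcongr
  have h₅ : 8 * (2 * D + 1) * k = 2 * (4 * ((2 * D + 1) * k)) := by ring
  omega

/-- Loops are listed twice in `H`, so multiplicities can only be compared for distinct vertices.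
That suffices, because the two vertices of a cycle of length two are distinct. -/
lemma FlaggedSubgraph.isCycleList (hH : FlaggedSubgraph n L H fl) {C : List ℕ}
    (hC : IsCycleList H C) : IsCycleList L C := by
  obtain ⟨m, x, rfl, h⟩ := hC
  have hmem : ∀ a b, b ∈ H a → b ∈ L a := by
    intro a b hab
    by_cases h : a = b
    · subst h
      exact (hH.loop a hab).1
    · exact List.count_pos_iff.1 ((List.count_pos_iff.2 hab).trans_le (hH.count_le a b h))
  refine ⟨m, x, rfl, h.chain.imp hmem, h.nodup_right, h.nodup_left, ?_⟩
  rintro a rfl -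
  have hne : x ≠ a := by
    rintro rfl
    simpa using h.nodup_left
  exact (h.two a rfl rfl).trans (hH.count_le x a hne)

end Packing

/-! ### What a search from a single root yields -/

namespace GraphSearch

variable {c : Ctx} {lo rtop hs hb tail : ℕ} {d : Data}

/-- A search from a single root that has not found a collision has found a tree. -/
lemma Inv.treeBall (hI : Inv c lo 1 tail hb tail d) (hrc : c.rc = 0) {r : ℕ} (hr : d.pos r = 1)
    (hfr : c.fw r = 1) {A : Finset ℕ} (hA : ∀ w ∈ A, c.xb w = 0) :
    TreeBall c.L A c.fw c.D r := by
  have hlo : lo = 0 := by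
    obtain ⟨h, h'⟩ | ⟨h, h'⟩ := hI.stage <;> omega
  subst hlo
  have hskr : d.sk r = 0 := by
    obtain ⟨-, h | ⟨u, -, h₁, h₂⟩⟩ := hI.glob r (by omega)
    · exact h
    · omega
  have hdr := hI.root_dep r (by omega) hskr
  refine ⟨d.pos, fun v => d.sk v - 1, d.dep, by omega, hdr.trans hfr, ?_, ?_⟩
  · intro v hv hvr
    have : d.pos v ≠ 1 := fun h => hvr (hI.pos_inj hv (h.trans hr.symm))
    obtain ⟨u, h₁, h₂, h₃, -, h₅⟩ := hI.par v (by omega)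
    have : d.sk v - 1 = u := by omega
    simp only [this]
    exact ⟨by omega, h₃, h₅⟩
  · intro v hv hvD w hw
    dsimp only
    refine (hI.scan v hv (hI.pos_le v) hvD w (hA w hw)).trans ?_
    have hsl := (hI.glob v (by omega)).1
    rw [Data.skip, hsl, if_neg (by omega : ¬ 0 = w + 1), add_zero]
    gcongr ?_ + ?_
    · split_ifs with h₁ h₂ h₂ <;> try omega
      refine absurd ⟨?_, by omega⟩ h₂
      rintro rfl
      omega
    · split_ifs with h₁ h₂ h₂ <;> try omega
      obtain ⟨h₃, h₄⟩ := h₁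
      refine absurd ⟨⟨by omega, ?_⟩, by omega⟩ h₂
      rintro rfl
      omega

/-- The weight of `m` is the sum of the two depths minus twice the depth of the meeting vertex `x`,
which itself weighs at most its depth. The scanned end has depth at most `c.D`, the other at most
`c.D + 1`. -/
lemma Climb.sum_weight_le (h : Climb c lo rtop d v w x x m)
    (hI : Inv c lo rtop hs hb tail d) (hC : Coll c lo d v w) :
    ((m ++ [x]).map c.fw).sum ≤ 2 * c.D + 1 := by
  have h₁ := h.weight
  have h₂ := hC.dep
  have h₃ := hC.pos_right
  have h₄ := h.pos_x
  obtain ⟨-, -, -, -, -, h₅⟩ := hI.vis w (by omega)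
  obtain ⟨-, -, -, -, h₆, -⟩ := hI.vis x (by omega)
  simp
  omega

end GraphSearch

/-! ### Cycles and feedback vertex sets from adjacency lists -/

namespace Graph

variable {β : Type*} {G : Graph ℕ β} {n : ℕ} {adj : ℕ → List ℕ}

/-- The adjacency lists of a graph with vertices `0, …, n - 1`, extended by empty lists. -/
def extendLists (n : ℕ) (adj : ℕ → List ℕ) (v : ℕ) : List ℕ := if v < n then adj v else []

lemma IsAdjacencyLists.encard (h : G.IsAdjacencyLists n adj) (v w : ℕ) :
    {e | G.IsLink e v w}.encard = (((extendLists n adj) v).count w : ℕ∞) := by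
  unfold extendLists
  split_ifs with hv
  · exact h.2 v hv w
  · have : {e | G.IsLink e v w} = ∅ := by
      ext e
      simp only [Set.mem_ofPred_eq, Set.mem_empty_iff_false, iff_false]
      intro he
      have := he.left_mem
      rw [h.1] at this
      exact hv this
    simp [this]

lemma IsAdjacencyLists.symm (h : G.IsAdjacencyLists n adj) (v w : ℕ) :
    (extendLists n adj v).count w = (extendLists n adj w).count v := by
  have h₁ := h.encard v w
  have h₂ := h.encard w v
  simp only [G.isLink_comm (x := w)] at h₂
  rw [h₁] at h₂
  exact_mod_cast h₂

lemma IsAdjacencyLists.exists_isLink (h : G.IsAdjacencyLists n adj) {v w : ℕ}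
    (hw : w ∈ extendLists n adj v) : ∃ e, G.IsLink e v w := by
  have h₁ := h.encard v w
  have h₂ := List.count_pos_iff.2 hw
  by_contra! h₃
  have : {e | G.IsLink e v w} = ∅ := by
    ext e
    simpa using h₃ e
  rw [this, Set.encard_empty] at h₁
  have : (extendLists n adj v).count w = 0 := by exact_mod_cast h₁.symm
  omega

lemma IsAdjacencyLists.mem_of_isLink (h : G.IsAdjacencyLists n adj) {v w : ℕ} {e : β}
    (he : G.IsLink e v w) : w ∈ extendLists n adj v := by
  have h₁ := h.encard v w
  by_contra h₂
  rw [List.count_eq_zero.2 h₂] at h₁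
  have h₃ : e ∈ {e | G.IsLink e v w} := he
  rw [Nat.cast_zero, Set.encard_eq_zero] at h₁
  rw [h₁] at h₃
  exact h₃

lemma IsAdjacencyLists.count_le_one (h : G.IsAdjacencyLists n adj) {v w : ℕ} {e e' : β}
    (hc : (extendLists n adj v).count w ≤ 1) (he : G.IsLink e v w) (he' : G.IsLink e' v w) :
    e = e' := by
  have h₁ := h.encard v w
  have h₂ : {e | G.IsLink e v w}.encard ≤ 1 := by
    rw [h₁]
    exact_mod_cast hc
  exact Set.encard_le_one_iff.1 h₂ e e' he he'

lemma IsAdjacencyLists.exists_ne (h : G.IsAdjacencyLists n adj) {v w : ℕ}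
    (hc : 2 ≤ (extendLists n adj v).count w) :
    ∃ e e', G.IsLink e v w ∧ G.IsLink e' v w ∧ e ≠ e' := by
  have h₁ := h.encard v w
  have h₂ : 1 < {e | G.IsLink e v w}.encard := by
    rw [h₁]
    exact_mod_cast hc
  exact Set.one_lt_encard_iff.1 h₂

/-- An edge determines its pair of ends, so edges chosen at different positions can coincide only if
the cycle has length two. In that case two different parallel edges are taken. -/
lemma IsAdjacencyLists.isCycleSeq (h : G.IsAdjacencyLists n adj) {C : List ℕ}
    (hC : IsCycleList (extendLists n adj) C) : G.IsCycleSeq C := by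
  obtain ⟨m, x, rfl, ht⟩ := hC
  refine ⟨by simp, ht.nodup_right, ?_⟩
  set C := m ++ [x] with hCdef
  have hlen : C.length = m.length + 1 := by simp [hCdef]
  have hlink : ∀ i : Fin C.length, ∃ e, G.IsLink e C[i]
      (C[((i : ℕ) + 1) % C.length]'(Nat.mod_lt _ (Nat.zero_lt_of_lt i.isLt))) := by
    rintro ⟨i, hi⟩
    apply h.exists_isLink
    have hch := List.isChain_iff_getElem.1 ht.chain
    by_cases h₁ : i + 1 < C.length
    · have := hch (i + 1) (by simp; omega)
      simp only [Nat.mod_eq_of_lt h₁]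
      simpa using this
    · obtain rfl : i = m.length := by omega
      have := hch 0 (by simp)
      have h₂ : (m.length + 1) % C.length = 0 := by rw [hlen]; simp
      simp only [h₂]
      simpa [hCdef] using this
  by_cases hm : ∃ a, m = [a]
  · obtain ⟨a, rfl⟩ := hm
    obtain ⟨e, e', he, he', hne⟩ := h.exists_ne (ht.two a rfl rfl)
    refine ⟨fun i => if (i : ℕ) = 0 then e else e', ?_, ?_⟩
    · rintro ⟨i, hi⟩ ⟨j, hj⟩ hij
      simp only [hCdef, List.cons_append, List.nil_append, List.length_cons,
        List.length_nil] at hi hj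
      simp only at hij
      ext
      split_ifs at hij with h₁ h₂ h₂
      · exact h₁.trans h₂.symm
      · exact absurd hij hne
      · exact absurd hij.symm hne
      · simp
        omega
    · rintro ⟨i, hi⟩
      simp only [hCdef, List.cons_append, List.nil_append, List.length_cons, List.length_nil] at hi
      obtain rfl | rfl : i = 0 ∨ i = 1 := by omega
      · simpa [hCdef] using he.symm
      · simpa [hCdef] using he'
  · choose e he using hlink
    refine ⟨e, ?_, he⟩
    rintro ⟨i, hi⟩ ⟨j, hj⟩ hij
    ext
    have h₁ := he ⟨i, hi⟩
    have h₂ := he ⟨j, hj⟩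
    rw [hij] at h₁
    obtain ⟨h₃, -⟩ | ⟨h₃, h₄⟩ := h₁.eq_and_eq_or_eq_and_eq h₂
    · exact ht.nodup_right.getElem_inj_iff.1 h₃
    · have h₅ : i = (j + 1) % C.length := ht.nodup_right.getElem_inj_iff.1 h₃
      have h₆ : (i + 1) % C.length = j := ht.nodup_right.getElem_inj_iff.1 h₄
      have h₇ : m.length ≠ 1 := fun h => hm (List.length_eq_one_iff.1 h)
      rw [hlen] at h₅ h₆ hi hj
      show i = j
      by_cases h₈ : j + 1 = m.length + 1
      · rw [h₈, Nat.mod_self] at h₅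
        subst h₅
        by_cases h₉ : m.length = 0
        · omega
        · rw [Nat.mod_eq_of_lt (by omega)] at h₆
          omega
      · rw [Nat.mod_eq_of_lt (by omega)] at h₅
        subst h₅
        by_cases h₉ : j + 1 = m.length
        · rw [h₉, Nat.mod_self] at h₆
          omega
        · rw [Nat.mod_eq_of_lt (by omega)] at h₆
          omega

/-- A vertex of maximal rank on a cycle has its predecessor and its successor below it. By the
ranking they are the same vertex, joined by a single edge, so the cycle would be a loop; but
adjacent vertices have different ranks. -/
lemma IsAdjacencyLists.isFeedbackVertexSet (h : G.IsAdjacencyLists n adj) {xb rk : ℕ → ℕ}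
    (hr : IsForestRanking (extendLists n adj) (fun v => xb v = 0) rk) {F : Set ℕ}
    (hF : ∀ v, v ∈ F ↔ v < n ∧ xb v ≠ 0) : G.IsFeedbackVertexSet F := by
  refine ⟨fun v hv => by rw [h.1]; exact ((hF v).1 hv).1, ?_⟩
  rintro l ⟨hne, hnd, e, hinj, hl⟩
  have hpos : 0 < l.length := List.length_pos_iff.2 hne
  simp only [deleteVerts_isLink] at hl
  have hx : ∀ (i : ℕ) (hi : i < l.length), xb l[i] = 0 := by
    intro i hi
    obtain ⟨h₁, h₂, -⟩ := hl ⟨i, hi⟩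
    have h₃ := h₁.left_mem
    rw [h.1] at h₃
    by_contra h₄
    exact h₂ ((hF _).2 ⟨h₃, h₄⟩)
  obtain ⟨⟨i, hi⟩, -, hmax⟩ := Finset.exists_max_image Finset.univ
    (fun i : Fin l.length => rk l[i]) ⟨⟨0, hpos⟩, Finset.mem_univ _⟩
  have hmax : ∀ (j : ℕ) (hj : j < l.length), rk l[j] ≤ rk l[i] := fun j hj =>
    hmax ⟨j, hj⟩ (Finset.mem_univ _)
  obtain ⟨j, hj, hji, hne⟩ : ∃ j < l.length, (j + 1) % l.length = i ∧ (j = i → l.length = 1) := by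
    obtain - | i := i
    · exact ⟨l.length - 1, by omega, by rw [Nat.sub_add_cancel (by omega)]; simp, by omega⟩
    · exact ⟨i, by omega, Nat.mod_eq_of_lt hi, by omega⟩
  have h₁ := (hl ⟨i, hi⟩).1
  have h₂ := (hl ⟨j, hj⟩).1
  have hk : (i + 1) % l.length < l.length := Nat.mod_lt _ hpos
  simp only [hji] at h₂
  have h₁ : G.IsLink (e ⟨i, hi⟩) l[i] (l[(i + 1) % l.length]) := h₁
  have h₂ : G.IsLink (e ⟨j, hj⟩) l[i] l[j] := h₂.symm
  have h₃ := h.mem_of_isLink h₁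
  have h₄ := h.mem_of_isLink h₂
  obtain ⟨h₅, h₆⟩ := hr _ (hx i hi) _ h₃ (hx _ hk)
  obtain ⟨h₇, -⟩ := hr _ (hx i hi) _ h₄ (hx _ hj)
  obtain ⟨h₈, h₉⟩ := h₆ (by have := hmax _ hk; omega)
  have h₁₀ := h₉ _ h₄ (hx _ hj) (by have := hmax _ hj; omega)
  rw [h₁₀] at h₂
  have h₁₁ : (⟨i, hi⟩ : Fin l.length) = ⟨j, hj⟩ := hinj (h.count_le_one h₈ h₁ h₂)
  have h₁₂ := hne (Fin.mk.inj_iff.1 h₁₁).symm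
  have h₁₃ : (i + 1) % l.length = i := by
    rw [h₁₂, Nat.mod_one]
    omega
  simp [h₁₃] at h₅

end Graph

/-! ### Searching for a cycle or an ear -/

namespace WordRAM

open GraphSearch Prog WordRAM.Expr

variable {S W : ℕ}

/-- The rule for loops that increment a register until a bound is reached. -/
lemma Runs.count {r rb B : ℕ} {P : Prog} {s : State} (J : ℕ → State → Prop) (hrb : rb ∉ P.wregs)
    (h₀ : J (s.reg r) s) (hle : s.reg r ≤ s.reg rb)
    (h : ∀ i s', s.reg r ≤ i → i < s.reg rb → s'.reg r = i → s'.reg rb = s.reg rb →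
      P.Frame s s' → s'.Ok W → J i s' →
      Runs S W P s' B fun s'' => s''.reg r = i + 1 ∧ J (i + 1) s'') :
    Runs S W (.while ((reg r).less (reg rb)) P) s ((s.reg rb - s.reg r) * (B + 4) + 4) fun s' =>
      s'.reg r = s.reg rb ∧ J (s.reg rb) s' := by
  refine (RunsT.loop (fun s' => s.reg r ≤ s'.reg r ∧ s'.reg r ≤ s.reg rb ∧ J (s'.reg r) s')
    (fun s' => (s.reg rb - s'.reg r) * (B + 4)) ⟨le_rfl, hle, h₀⟩ ?_).toRuns ?_
  · rintro s' ⟨h₁, h₂, h₃⟩ hO hF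
    have hb : s'.reg rb = s.reg rb := hF.reg _ hrb
    refine ⟨by simp, fun he => ?_⟩
    simp only [ne_eq, less_eq_zero, not_not, eval_reg, hb] at he
    refine (h _ s' h₁ he rfl hb hF hO h₃).toT.mono ?_
    rintro s'' t - - ⟨ht, hr, hJ⟩
    rw [hr]
    refine ⟨⟨by omega, by omega, hJ⟩, ?_⟩
    have : s.reg rb - s'.reg r = (s.reg rb - (s'.reg r + 1)) + 1 := by omega
    rw [this, add_mul]
    simp
    omega
  · rintro s' t - hF ⟨ht, ⟨h₁, h₂, h₃⟩, he⟩
    have hb : s'.reg rb = s.reg rb := (hF.reg _ (by simpa [Prog.wregs]))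
    simp only [less_eq_zero, eval_reg, hb] at he
    have : s'.reg r = s.reg rb := by omega
    rw [this] at h₃
    simp at ht
    exact ⟨by omega, this, h₃⟩

/-- The arrays `adj` and `deg` contain lists of length at most `4`. -/
def ListRep (adj deg : ℕ → ℕ) (H : ℕ → List ℕ) : Prop :=
  ∀ v, arraySlice adj (4 * v) (4 * v + deg v) = H v

lemma ListRep.length {adj deg : ℕ → ℕ} {H : ℕ → List ℕ} (h : ListRep adj deg H) (v : ℕ) :
    deg v = (H v).length := by
  rw [← h v, length_arraySlice]
  omega

lemma ListRep.getElem {adj deg : ℕ → ℕ} {H : ℕ → List ℕ} (h : ListRep adj deg H) {v i : ℕ}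
    (hi : i < (H v).length) : adj (4 * v + i) = (H v)[i] := by
  have := h v
  simp only [← this]
  rw [getElem_arraySlice]

/-- Reset the positions of all vertices. -/
def clearPos : Prog :=
  rI ≔ 0 ;; .while ((reg rI).less (reg rN)) (store bPos (reg rI) 0 ;; rI ≔ reg rI + 1)

lemma clearPos_runs {n : ℕ} {s : State} (hN : s.reg rN = n) (hS : n < S) (hW : n + 1 < W)
    (hp : ∀ v, n ≤ v → s.mem bPos v = 0) :
    Runs S W clearPos s (20 * (n + 1)) fun s' => s'.mem bPos = fun _ => 0 := by
  refine Runs.seq (T₁ := 2) (T₂ := n * 14 + 4) (Q₁ := fun s' => s' = s.setReg rI 0)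
    (Runs.of_wp ⟨by simp; omega, rfl⟩ (by simp [maxCost])) ?_ (by omega)
  rintro s' - - rfl
  refine (Runs.count (B := 10) (fun i s' => ∀ v, v < i ∨ n ≤ v → s'.mem bPos v = 0)
    (by simp [wregs]) (by simpa using hp) (by simp) ?_).mono (by simp [hN]) ?_
  · intro i s' _ hi hr hb hF _ hJ
    simp [hN] at hi
    refine Runs.of_wp' (fun Q' hQ => ?_) (by simp [maxCost])
    simp only [wp]
    simp [hr]
    refine ⟨by omega, by omega, by omega, hQ _ ⟨by simp, fun v hv => ?_⟩⟩
    simp only [State.setReg_mem, State.setMem_mem, if_true, Function.update_apply]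
    split_ifs with h
    · rfl
    · exact hJ v (by omega)
  · rintro s' - - ⟨-, hJ⟩
    ext v
    refine hJ v ?_
    simp [hN]
    omega

/-- The state after the first vertices have been tested for being roots. -/
structure RootInv (H : ℕ → List ℕ) (fl : ℕ → ℕ) (r t : ℕ) (d : Data) : Prop where
  le : t ≤ r
  que : ∀ i < t, d.pos (d.que i) = i + 1
  vis : ∀ v, d.pos v ≠ 0 → v < r ∧ fl v = 0 ∧ H v ≠ [] ∧ d.pos v ≤ t ∧ d.que (d.pos v - 1) = v ∧
    d.dep v = 0 ∧ ∀ w, d.skip v w = (H v).count w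
  all : ∀ v < r, fl v = 0 → H v ≠ [] → d.pos v ≠ 0

/-- Put all unflagged vertices of the subgraph into the queue. -/
def pushRoots : Prog :=
  rR ≔ 0 ;; .while ((reg rR).less (reg rN))
    (ite (((mem bInf (reg rR)).same 0).both (mem bDeg (reg rR)))
      (pushRoot (mem bHadj (4 * reg rR) + 1) (mem bHadj (4 * reg rR + 1) + 1)) skip ;;
    rR ≔ reg rR + 1)

/-- Unflagged vertices of `H` have exactly two neighbours in `H`, so two cells per vertex can record
all edges that the search must ignore. The shift by one frees 0 to mean no neighbour. -/
lemma RootInv.push {H : ℕ → List ℕ} {fl : ℕ → ℕ} {r t : ℕ} {d : Data} (h : RootInv H fl r t d)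
    (h₁ : fl r = 0) {a b : ℕ} (h₂ : H r = [a, b]) :
    RootInv H fl (r + 1) (t + 1) (d.push t r (a + 1) (b + 1) 0) := by
  have hr0 : d.pos r = 0 := by
    by_contra h₃
    have := (h.vis r h₃).1
    omega
  refine ⟨by have := h.le; omega, ?_, ?_, ?_⟩
  · intro i hi
    rw [push_que]
    split_ifs with h₃
    · simp [push_pos, h₃]
    · have h₄ := h.que i (by omega)
      rw [push_pos, if_neg, h₄]
      intro h₅
      rw [h₅] at h₄
      omega
  · intro v hv
    rw [push_pos] at hv
    by_cases h₃ : v = r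
    · subst h₃
      refine ⟨by omega, h₁, by simp [h₂], by simp [push_pos], by simp [push_pos, push_que],
        by simp [push_dep], fun w => ?_⟩
      simp [Data.skip, push_sk, push_sl, h₂, List.count_cons]
      omega
    · rw [if_neg h₃] at hv
      obtain ⟨h₄, h₅, h₆, h₇, h₈, h₉, h₁₀⟩ := h.vis v hv
      refine ⟨by omega, h₅, h₆, by rw [push_pos, if_neg h₃]; omega, ?_, ?_, ?_⟩
      · rw [push_pos, if_neg h₃, push_que, if_neg (by omega), h₈]
      · rw [push_dep, if_neg h₃, h₉]
      · intro w
        rw [push_skip h₃, h₁₀]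
  · intro v hv hv₁ hv₂
    rw [push_pos]
    split_ifs with h₃
    · omega
    · exact h.all v (by omega) hv₁ hv₂

lemma RootInv.skip {H : ℕ → List ℕ} {fl : ℕ → ℕ} {r t : ℕ} {d : Data} (h : RootInv H fl r t d)
    (h₁ : fl r ≠ 0 ∨ H r = []) : RootInv H fl (r + 1) t d := by
  refine ⟨by have := h.le; omega, h.que, fun v hv => ?_, fun v hv hv₁ hv₂ => ?_⟩
  · obtain ⟨h₂, h₃⟩ := h.vis v hv
    exact ⟨by omega, h₃⟩
  · refine h.all v ?_ hv₁ hv₂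
    by_contra h₂
    obtain rfl : v = r := by omega
    tauto

lemma pushRoots_runs {n : ℕ} {L H : ℕ → List ℕ} {fl : ℕ → ℕ} {s : State}
    (hN : s.reg rN = n) (hS : 4 * n + 4 < S) (hW : 4 * n + 4 < W)
    (hp : s.mem bPos = fun _ => 0) (hT : s.reg rTail = 0) (hfl : s.mem bInf = fl)
    (hH : ListRep (s.mem bHadj) (s.mem bDeg) H) (hF : FlaggedSubgraph n L H fl) :
    Runs S W pushRoots s (100 * (n + 1)) fun s' => RootInv H fl n (s'.reg rTail) s'.sd := by
  refine Runs.seq (T₁ := 2) (T₂ := n * 84 + 4) (Q₁ := fun s' => s' = s.setReg rR 0)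
    (Runs.of_wp ⟨by simp; omega, rfl⟩ (by simp [maxCost])) ?_ (by omega)
  rintro s' - - rfl
  refine (Runs.count (B := 80) (fun i s' => RootInv H fl i (s'.reg rTail) s'.sd)
    (by simp [wregs, pushRoot]) ?_ (by simp) ?_).mono (by simp [hN]) ?_
  · refine ⟨by simp [hT], by simp [hT], fun v hv => ?_, by simp⟩
    exact absurd (congrFun hp v) hv
  · intro i s' _ hi hr hb hFr hOk hJ
    simp [hN] at hi
    have hfl' : s'.mem bInf = fl := (hFr.mem _ (by simp [wbanks, pushRoot])).trans hfl
    have hdeg : s'.mem bDeg = s.mem bDeg := hFr.mem _ (by simp [wbanks, pushRoot])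
    have hadj : s'.mem bHadj = s.mem bHadj := hFr.mem _ (by simp [wbanks, pushRoot])
    have hlen := hH.length i
    have hle := hJ.le
    refine Runs.of_wp' (fun Q' hQ => ?_) (by simp [maxCost, pushRoot])
    simp only [wp, pushRoot]
    simp only [eval_reg, eval_mem, eval_add, eval_mul, eval_ofNat, both_eq_zero, same_eq_zero,
      safe_reg, safe_mem, safe_add, safe_mul, safe_ofNat, safe_same, safe_both,
      State.setReg_reg, State.setReg_mem, State.setMem_reg, State.setMem_mem, true_and,
      Nat.reduceEqDiff, if_true, if_false, ne_eq, not_or, not_not, hr, hfl', hdeg, hadj]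
    refine ⟨by omega, fun hx => ?_, fun hx => ⟨by omega, hQ _ ⟨by simp, ?_⟩⟩⟩
    · have hl : (H i).length = 2 := by
        obtain h | h := hF.two i hx.1
        · rw [h] at hlen
          exact absurd hlen hx.2
        · exact h
      obtain ⟨a, b, hab⟩ := List.length_eq_two.1 hl
      have h₀ : s.mem bHadj (4 * i) = a := by
        have := hH.getElem (v := i) (i := 0) (by omega)
        simpa [hab] using this
      have h₁ : s.mem bHadj (4 * i + 1) = b := by
        have := hH.getElem (v := i) (i := 1) (by omega)
        simpa [hab] using this
      have ha : a < n := hF.lt (v := i) (by simp [hab])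
      have hb : b < n := hF.lt (v := i) (by simp [hab])
      rw [h₀, h₁]
      repeat refine ⟨by omega, ?_⟩
      refine hQ _ ⟨by simp, ?_⟩
      have := hJ.push hx.1 hab
      simpa [State.sd, Data.push, hx.1] using this
    · have := hJ.skip (by rw [← List.length_eq_zero_iff]; omega)
      simpa using this
  · rintro s' - - ⟨-, hJ⟩
    simpa [hN] using hJ

/-- The data of the search for a cycle or an ear. -/
def earCtx (n D rc : ℕ) (L H : ℕ → List ℕ) (fl : ℕ → ℕ) : Ctx where
  n := n
  rc := rc
  D := D
  L := L
  xb := fl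
  fw := fl
  h v w := (H v).count w
  R v := fl v = 0 ∧ H v ≠ []

/-- The conditions for adjacency lists. -/
structure SymmLists (n : ℕ) (L : ℕ → List ℕ) : Prop where
  out : ∀ v, n ≤ v → L v = []
  symm : ∀ v w, (L v).count w = (L w).count v

lemma SymmLists.lt {n : ℕ} {L : ℕ → List ℕ} (h : SymmLists n L) {v w : ℕ} (hw : w ∈ L v) :
    w < n := by
  have h₁ := List.count_pos_iff.2 hw
  rw [h.symm] at h₁
  by_contra h₂
  rw [h.out w (by omega)] at h₁
  simp at h₁

lemma SymmLists.mem_symm {n : ℕ} {L : ℕ → List ℕ} (h : SymmLists n L) {v w : ℕ} (hw : w ∈ L v) :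
    v ∈ L w := by
  have h₁ := List.count_pos_iff.2 hw
  rw [h.symm] at h₁
  exact List.count_pos_iff.1 h₁

lemma _root_.FlaggedSubgraph.symmLists {n : ℕ} {L H : ℕ → List ℕ} {fl : ℕ → ℕ}
    (h : FlaggedSubgraph n L H fl) : SymmLists n H := ⟨h.out, h.symm⟩

lemma earCtx_valid {n D rc : ℕ} {L H : ℕ → List ℕ} {fl : ℕ → ℕ} (hL : SymmLists n L)
    (hF : FlaggedSubgraph n L H fl) : (earCtx n D rc L H fl).Valid where
  lt v _ w hw := hL.lt hw
  symm v _ w _ hw := hL.mem_symm hw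
  fw_le := hF.fl_le
  h_root v w _ hw hh := by
    refine ⟨hw, fun h => hh ?_⟩
    show (H v).count w = 0
    rw [hF.symm, h]
    rfl

lemma RootInv.inv {n D t : ℕ} {L H : ℕ → List ℕ} {fl : ℕ → ℕ} {d : Data}
    (h : RootInv H fl n t d) (hF : FlaggedSubgraph n L H fl) :
    Inv (earCtx n D t L H fl) 0 t 0 0 t d where
  rc_le := le_rfl
  lo_le := Nat.zero_le _
  rtop_le := le_rfl
  hb_le := Nat.zero_le _
  hs_le := Nat.zero_le _
  stage := .inl ⟨rfl, rfl⟩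
  que := h.que
  vis v hv := by
    obtain ⟨h₄, h₅, h₆, h₇, h₈, h₉, h₁₀⟩ := h.vis v hv
    have : (earCtx n D t L H fl).fw v = 0 := h₅
    exact ⟨h₄, h₇, h₈, h₅, by omega, by omega⟩
  flat _ v hv := (h.vis v hv).2.2.2.2.2.1
  par v hv := by
    have := (h.vis v (by omega)).2.2.2.1
    omega
  glob v hv := by
    have hv : t < d.pos v := hv
    have := (h.vis v (by omega)).2.2.2.1
    omega
  root_dep v hv := by
    have hv : t < d.pos v := hv
    have := (h.vis v (by omega)).2.2.2.1
    omega
  child v w hw := by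
    have hw : t < d.pos w := hw.1
    have := (h.vis w (by omega)).2.2.2.1
    omega
  scan v hv hv' := by omega
  closed v hv hv' := by omega
  root v := by
    constructor
    · rintro ⟨h₁, h₂⟩
      have hv : v < n := by
        by_contra h₃
        exact h₂ (hF.out v (by omega))
      have := h.all v hv h₁ h₂
      exact ⟨this, (h.vis v this).2.2.2.1⟩
    · rintro ⟨h₁, -⟩
      obtain ⟨-, h₂, h₃, -⟩ := h.vis v h₁
      exact ⟨h₂, h₃⟩
  root_skip v hv w _ := by
    have hv' : v < n := by
      by_contra h₃
      exact hv.2 (hF.out v (by omega))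
    exact (h.vis v (h.all v hv' hv.1 hv.2)).2.2.2.2.2.2 w

/-- Search for a cycle or an ear. -/
def earSearch : Prog :=
  clearPos ;; rTail ≔ 0 ;; pushRoots ;;
  rHead ≔ 0 ;; rTop ≔ reg rTail ;; rFound ≔ 0 ;; rR ≔ 0 ;;
  searchLoop bInf bAdj (mem bOff (reg rV)) (mem bOff (reg rV + 1))

/-- The adjacency lists of the input. -/
structure InputRep (S W n : ℕ) (L : ℕ → List ℕ) (s : State) : Prop where
  regN : s.reg rN = n
  lists : ∀ v < n, s.mem bOff (v + 1) = s.mem bOff v + (L v).length ∧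
    ∀ i (h : i < (L v).length), s.mem bAdj (s.mem bOff v + i) = (L v)[i] ∧
      s.mem bOff v + i + 1 < S ∧ s.mem bOff v + i + 1 < W

/-- Here the bound of two edges per pair enters the running time: a list meets each flagged vertex
at most twice, so its excluded entries are bounded in terms of the number of flags. -/
lemma countP_le_of_count_le {l : List ℕ} {fl : ℕ → ℕ} {n : ℕ} (hl : ∀ a ∈ l, a < n)
    (hc : ∀ w, l.count w ≤ 2) (hfl : ∀ v, fl v ≤ 1) :
    l.countP (fun w => fl w ≠ 0) ≤ 2 * ∑ v ∈ Finset.range n, fl v := by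
  rw [List.countP_eq_length_filter, ← sum_count_eq (s := Finset.range n), Finset.mul_sum]
  · refine Finset.sum_le_sum fun v _ => ?_
    by_cases h : fl v = 0
    · rw [List.count_eq_zero.2]
      · omega
      · simp [h]
    · have := hfl v
      have := (List.filter_sublist (l := l) (p := fun w => fl w ≠ 0)).count_le v
      have := hc v
      omega
  · intro a ha
    exact Finset.mem_range.2 (hl a (List.mem_of_mem_filter ha))

/-- In this search the excluded vertices are exactly those of positive weight. All depths are
therefore 0 and the depth limit has no effect, so a search without collision has seen all unflagged
vertices. -/
lemma earSearch_runs {n D b : ℕ} {L H : ℕ → List ℕ} {fl : ℕ → ℕ} {s : State}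
    (hL : SymmLists n L) (hc : ∀ v w, (L v).count w ≤ 2)
    (hS : 4 * n + 4 < S) (hW : 4 * n + 4 < W) (hD : s.reg rDepth = D) (hDW : D + 2 < W)
    (hI : InputRep S W n L s)
    (hp : ∀ v, n ≤ v → s.mem bPos v = 0) (hfl : s.mem bInf = fl)
    (hH : ListRep (s.mem bHadj) (s.mem bDeg) H) (hF : FlaggedSubgraph n L H fl)
    (hb : 2 * ∑ v ∈ Finset.range n, fl v ≤ b) :
    Runs S W earSearch s (400 * ((b + 11) * (n + 1))) fun s' =>
      (∀ v, n ≤ v → s'.mem bPos v = 0) ∧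
      ((s'.reg rFound = 0 ∧ ∃ rk, IsForestRanking L (fun v => fl v = 0) rk) ∨
        (s'.reg rFound = 1 ∧ ∃ rc lo tail, Inv (earCtx n D rc L H fl) lo (s'.reg rTop) 0 tail tail
          s'.sd ∧ Coll (earCtx n D rc L H fl) lo s'.sd (s'.reg rV) (s'.reg rW))) := by
  have hN := hI.regN
  refine Runs.seq (clearPos_runs hN (by omega) (by omega) hp) (T₂ := 100 * (n + 1) +
    (20 + 200 * ((b + 11) * (n + 1)))) ?_ (by nlinarith)
  intro s₁ hO₁ hF₁ hp₁
  refine Runs.seq (T₁ := 2) (T₂ := 100 * (n + 1) + (18 + 200 * ((b + 11) * (n + 1))))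
    (Q₁ := fun s' => s' = s₁.setReg rTail 0) (Runs.of_wp ⟨by simp; omega, rfl⟩ (by simp [maxCost]))
    ?_ (by omega)
  rintro s₂ hO₂ hF₂ rfl
  have hN₁ : s₁.reg rN = n := (hF₁.reg _ (by simp [clearPos, wregs])).trans hN
  have hD₁ : s₁.reg rDepth = D := (hF₁.reg _ (by simp [clearPos, wregs])).trans hD
  have hm₁ : ∀ b, b < 5 ∨ 9 < b → s₁.mem b = s.mem b := fun b hb =>
    hF₁.mem _ (by simp [clearPos, wbanks]; omega)
  refine Runs.seq (pushRoots_runs (n := n) (L := L) (H := H) (fl := fl) (by simpa using hN₁)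
    (by omega) (by omega) (by simpa using hp₁) (by simp) (by simp [hm₁, hfl]) (by simp [hm₁, hH])
    hF) ?_ le_rfl
  intro s₃ hO₃ hF₃ hR
  have hN₃ : s₃.reg rN = n := (hF₃.reg _ (by simp [pushRoots, pushRoot, wregs])).trans
    (by simpa using hN₁)
  have hD₃ : s₃.reg rDepth = D := (hF₃.reg _ (by simp [pushRoots, pushRoot, wregs])).trans
    (by simpa using hD₁)
  have hm₃ : ∀ b, b < 5 ∨ 9 < b → s₃.mem b = s.mem b := fun b hb =>
    (hF₃.mem _ (by simp [pushRoots, pushRoot, wbanks]; omega)).trans (hm₁ b hb)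
  refine RunsT.toRuns (Q := fun s' t => t ≤ 18 + 200 * ((b + 11) * (n + 1)) ∧ _) ?_
    fun _ _ _ _ h => h
  refine .assign_seq (by simp; omega) (.assign_seq (by simp) (.assign_seq (by simp; omega)
    (.assign_seq (by simp; omega) ?_)))
  set c := earCtx n D (s₃.reg rTail) L H fl with hcdef
  have hval : c.Valid := earCtx_valid hL hF
  have hinv := hR.inv (D := D) hF
  refine (searchLoop_runs (b := b) (r₀ := 0) (st := 0) hval ⟨?_, ?_, hDW, ?_, ?_, ?_, ?_,
    ?_, ?_, ?_, ?_, ?_, ?_⟩ ⟨?_, ?_, ?_, ?_, ?_, 0, ?_, .inl ⟨?_, ?_⟩⟩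
    (.inr fun v hv => hv)).toT.mono
      ?_
  · show 2 * n + 2 < S
    omega
  · show 2 * n + 2 < W
    omega
  · omega
  · omega
  · simp
  · simp
  · simpa [hcdef, earCtx] using hN₃
  · simpa [hcdef, earCtx] using hD₃
  · simp [hm₃, hfl, hcdef, earCtx]
  · simp [hm₃, hfl, hcdef, earCtx]
  · intro v hv
    exact (countP_le_of_count_le (fun a ha => hL.lt ha) (hc v) hF.fl_le).trans hb
  · refine ⟨s.mem bOff, fun v hv => ⟨?_, ?_⟩⟩
    · intro s' h₁ h₂ h₃
      have hv : v < n := hv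
      simp only [State.setReg_mem, hm₃ bOff (by omega)] at h₁
      rw [show c.L v = L v from rfl]
      simp [h₁, h₃, (hI.lists v hv).1]
      omega
    · intro i hi
      have hi : i < (L v).length := hi
      simp only [State.setReg_mem, hm₃ bAdj (by omega)]
      exact (hI.lists v hv).2 i hi
  · simp
  · simp
  · simp
  · simp
  · exact fun _ h => absurd rfl h
  · simp
  · simp
  · simpa using hinv
  · rintro s' t hO' hF' ⟨ht, hI', hfin⟩
    have hn : c.n = n := rfl
    rw [hn] at ht hfin
    refine ⟨by simp; omega, ?_⟩
    obtain ⟨-, -, -, hvis, -, lo, -, hcase⟩ := hI'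
    have hpos : ∀ hs hb, Inv c lo (s'.reg rTop) hs hb (s'.reg rTail) s'.sd →
        ∀ v, n ≤ v → s'.mem bPos v = 0 := by
      intro hs hb hInv v hv
      by_contra h
      have : v < n := (hInv.vis v h).1
      omega
    rcases hcase with ⟨h₀, hInv⟩ | ⟨h₁, hInv, hColl⟩
    · refine ⟨hpos _ _ hInv, .inl ⟨h₀, ?_⟩⟩
      obtain ⟨h₁, h₂⟩ := hfin h₀
      rw [h₁] at hInv
      obtain ⟨rk, hrk⟩ := hF.rank
      have hflat : ∀ v, s'.sd.pos v ≠ 0 → s'.sd.dep v = 0 := hInv.flat fun v hv => hv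
      -- The sum of all ranks plus one serves as a number above the rank of every initial root.
      exact ⟨_, hInv.isForestRanking (n := n) (H := H) (rk := rk)
        (M := ∑ v ∈ Finset.range n, rk v + 1) hL.out
        (fun v hv => by rw [hflat v hv]; omega)
        (fun v hv hx => hvis h₀ v (by omega) (by omega) hx) hL.symm (fun _ _ => rfl)
        (fun v hv => by
          have hvn : v < n := by
            by_contra h
            exact hv.2 (hF.out v (by omega))
          have := Finset.single_le_sum (f := rk) (fun _ _ => Nat.zero_le _)
            (Finset.mem_range.2 hvn)
          omega)
        (fun v hv w hw hw0 => by
          obtain ⟨h₃, h₄⟩ := hrk v hv.1 w hw hw0.1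
          exact ⟨h₃, fun h₅ => ⟨(h₄ h₅).1, fun w' hw' hR' => (h₄ h₅).2 w' hw' hR'.1⟩⟩)⟩
    · exact ⟨hpos _ _ hInv, .inr ⟨h₁, _, lo, _, hInv, hColl⟩⟩

end WordRAM

/-! ### Adding the trail of a collision to the subgraph -/

namespace WordRAM

open GraphSearch Prog WordRAM.Expr

section TrailCases

variable {n D rc lo rtop hs hb tail : ℕ} {L H : ℕ → List ℕ} {fl : ℕ → ℕ} {d : Data}

/-- The trail of a collision is a new cycle, or an ear. -/
lemma _root_.GraphSearch.Climb.trail_cases {v w x y : ℕ} {m : List ℕ} (hL : SymmLists n L)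
    (hF : FlaggedSubgraph n L H fl) (hI : Inv (earCtx n D rc L H fl) lo rtop hs hb tail d)
    (hC : Coll (earCtx n D rc L H fl) lo d v w)
    (h : Climb (earCtx n D rc L H fl) lo rtop d v w x y m)
    (hend : x = y ∨ d.pos x ≤ rtop ∧ d.pos y ≤ rtop) :
    IsTrail L y m x ∧ (∀ v ∈ y :: (m ++ [x]), v < n ∧ fl v = 0) ∧ (∀ v ∈ m, H v = []) ∧
      (x = y ∧ H x = [] ∨ H x ≠ [] ∧ H y ≠ [] ∧
        (m = [] → x ≠ y → (H y).count x + 1 ≤ (L y).count x)) := by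
  have hx := h.pos_x
  have hy := h.pos_y
  have hrc : rc ≤ rtop := hI.rc_le
  have hroot : ∀ v, (fl v = 0 ∧ H v ≠ []) ↔ d.pos v ≠ 0 ∧ d.pos v ≤ rc := hI.root
  refine ⟨h.isTrail hI.rc_le hC hL.symm, ?_, ?_, ?_⟩
  · intro z hz
    have : d.pos z ≠ 0 := by
      simp only [List.mem_cons, List.mem_append, List.not_mem_nil, or_false] at hz
      obtain rfl | hz | rfl := hz
      · omega
      · have := h.big z hz
        omega
      · omega
    obtain ⟨h₁, -, -, h₂, -⟩ := hI.vis z this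
    exact ⟨h₁, h₂⟩
  · intro z hz
    have h₁ := h.nonroot z hz
    by_contra h₂
    have := ((hroot z).1 ⟨(hI.vis z (by omega)).2.2.2.1, h₂⟩).2
    omega
  · by_cases hxy : x = y
    · subst hxy
      by_cases h₁ : H x = []
      · exact .inl ⟨rfl, h₁⟩
      · exact .inr ⟨h₁, h₁, fun _ h => absurd rfl h⟩
    · obtain ⟨h₁, h₂⟩ := hend.resolve_left hxy
      -- In the first stage the roots are the unflagged vertices of `H`. A later tree has only one
      -- root, so two ends that are both roots coincide.
      have hst : (lo = 0 ∧ rtop = rc) ∨ (rc ≤ lo ∧ rtop = lo + 1) := hI.stage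
      obtain ⟨rfl, rfl⟩ | ⟨-, rfl⟩ := hst
      · have hRx := (hroot x).2 ⟨by omega, h₁⟩
        have hRy := (hroot y).2 ⟨by omega, h₂⟩
        refine .inr ⟨hRx.2, hRy.2, fun hm _ => ?_⟩
        -- The ear is the colliding edge itself. The search ignores as many copies as `H` contains,
        -- so the collision shows a further one.
        obtain ⟨rfl, rfl⟩ := h.shape_zero hm
        have h₃ : d.skip x y + _ + 1 ≤ (L x).count y := hC.count
        have h₄ : d.skip x y = (H x).count y := hI.root_skip x hRx y hRy.1
        rw [hF.symm, hL.symm]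
        omega
      · exact absurd (hI.pos_inj (by omega) (by omega)) hxy

end TrailCases

variable {S W : ℕ}

/-- Add the vertex in register `b` to the list of the vertex in register `a`. -/
def addHalf (a b : ℕ) : Prog :=
  store bHadj (4 * reg a + mem bDeg (reg a)) (reg b) ;;
  store bDeg (reg a) (mem bDeg (reg a) + 1)

/-- Add the edges of the trail to the subgraph. -/
def addEdges : Prog :=
  rI ≔ reg rLo + 1 ;; .while ((reg rI).less (reg rHi))
    (rA ≔ mem bTrail (reg rI - 1) ;; rB ≔ mem bTrail (reg rI) ;;
    addHalf rA rB ;; addHalf rB rA ;; rI ≔ reg rI + 1)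

/-- Each vertex owns four consecutive cells; the degree bound keeps different lists from
overlapping. -/
lemma ListRep.push {adj deg : ℕ → ℕ} {H : ℕ → List ℕ} (h : ListRep adj deg H)
    (h₄ : ∀ v, (H v).length ≤ 4) {a : ℕ} (ha : (H a).length < 4) (b : ℕ) :
    ListRep (Function.update adj (4 * a + deg a) b) (Function.update deg a (deg a + 1))
      fun v => H v ++ if v = a then [b] else [] := by
  intro v
  dsimp only
  have hv := h₄ v
  rw [← h.length] at ha hv
  by_cases hva : v = a
  · subst hva
    rw [Function.update_self, ← add_assoc, arraySlice_snoc (by omega), h v, if_pos rfl]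
  · rw [Function.update_of_ne hva, if_neg hva, List.append_nil, ← h v]
    exact arraySlice_congr fun i h₁ h₂ => Function.update_of_ne (by omega) _ _

lemma addEdge_eq (H : ℕ → List ℕ) (a b : ℕ) :
    addEdge H (a, b) = fun v => (H v ++ if v = a then [b] else []) ++ if v = b then [a] else [] :=
  rfl

lemma arraySlice_zip {A : ℕ → ℕ} {lo e y x : ℕ} {m : List ℕ}
    (h : arraySlice A lo e = y :: (m ++ [x])) (i : ℕ) (hi : i < (trailEdges y m x).length) :
    (trailEdges y m x)[i] = (A (lo + i), A (lo + i + 1)) := by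
  have hl := congrArg List.length h
  rw [length_arraySlice] at hl
  rw [length_trailEdges] at hi
  simp at hl
  have h₁ : (y :: m)[i]'(by simpa using hi) = A (lo + i) := by
    rw [← getElem_arraySlice (A := A) (lo := lo) (hi := e) (i := i)
      (by rw [length_arraySlice]; omega)]
    simp only [h, ← List.cons_append]
    rw [List.getElem_append_left]
  have h₂ : (m ++ [x])[i]'(by simp; omega) = A (lo + i + 1) := by
    rw [add_assoc, ← getElem_arraySlice (A := A) (lo := lo) (hi := e) (i := i + 1)
      (by rw [length_arraySlice]; omega)]
    simp only [h, List.getElem_cons_succ]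
  simp only [trailEdges, List.getElem_zip, h₁, h₂]

lemma addEdges_runs {n y x lo hi : ℕ} {m : List ℕ} {H : ℕ → List ℕ} {s : State}
    (hS : 4 * n + 4 < S) (hW : 4 * n + 4 < W) (hlo : s.reg rLo = lo) (hhi : s.reg rHi = hi)
    (hlt : lo < hi) (hle : hi ≤ 2 * n)
    (hT : arraySlice (s.mem bTrail) lo hi = y :: (m ++ [x]))
    (hn : ∀ v ∈ y :: (m ++ [x]), v < n)
    (hH : ListRep (s.mem bHadj) (s.mem bDeg) H)
    (h₄ : ∀ v, ((trailEdges y m x).foldl addEdge H v).length ≤ 4) :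
    Runs S W addEdges s (300 * (n + 1)) fun s' =>
      ListRep (s'.mem bHadj) (s'.mem bDeg) ((trailEdges y m x).foldl addEdge H) := by
  have hl := congrArg List.length hT
  rw [length_arraySlice] at hl
  simp at hl
  have hlE : (trailEdges y m x).length = hi - lo - 1 := by
    rw [length_trailEdges]
    omega
  refine Runs.seq (T₁ := 4) (T₂ := (hi - (lo + 1)) * 104 + 4)
    (Q₁ := fun s' => s' = s.setReg rI (lo + 1))
    (Runs.of_wp ⟨by simp; omega, by simp [hlo]⟩ (by simp [maxCost])) ?_ (by omega)
  rintro s' - - rfl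
  -- Lists only grow, so the bound for the final degrees holds at every intermediate stage, which is
  -- what writing into blocks of four cells requires.
  have hmono : ∀ i v, (((trailEdges y m x).take i).foldl addEdge H v).length ≤ 4 := by
    intro i v
    refine le_trans ?_ (h₄ v)
    rw [length_foldl_addEdge, length_foldl_addEdge]
    have h₁ := ((List.take_sublist i (trailEdges y m x)).map Prod.fst).count_le v
    have h₂ := ((List.take_sublist i (trailEdges y m x)).map Prod.snd).count_le v
    omega
  refine (Runs.count (B := 100) (fun i s' => ListRep (s'.mem bHadj) (s'.mem bDeg)
    (((trailEdges y m x).take (i - (lo + 1))).foldl addEdge H))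
    (by simp [wregs, addHalf]) ?_ ?_ ?_).mono (by simp [hhi]) ?_
  · simpa using hH
  · simp
    omega
  · intro i s' hi₁ hi₂ hr hb hFr hOk hJ
    simp [hhi] at hi₁ hi₂
    have htr : s'.mem bTrail = s.mem bTrail := hFr.mem _ (by simp [wbanks, addHalf])
    obtain ⟨j, rfl⟩ : ∃ j, i = lo + 1 + j := ⟨i - (lo + 1), by omega⟩
    rw [Nat.add_sub_cancel_left] at hJ
    have hjl : j < (trailEdges y m x).length := by omega
    have hstep : ((trailEdges y m x).take (j + 1)).foldl addEdge H =
        addEdge (((trailEdges y m x).take j).foldl addEdge H)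
          (s.mem bTrail (lo + j), s.mem bTrail (lo + j + 1)) := by
      rw [List.take_succ_eq_append_getElem hjl, List.foldl_append, List.foldl_cons, List.foldl_nil,
        arraySlice_zip hT j hjl]
    have hmem := List.getElem_mem hjl
    rw [arraySlice_zip hT j hjl] at hmem
    have ha : s.mem bTrail (lo + j) < n := by
      have := List.mem_map_of_mem (f := Prod.fst) hmem
      rw [trailEdges_fst] at this
      refine hn _ ?_
      simp at this ⊢
      tauto
    have hb : s.mem bTrail (lo + j + 1) < n := by
      have := List.mem_map_of_mem (f := Prod.snd) hmem
      rw [trailEdges_snd] at this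
      exact hn _ (List.mem_cons_of_mem _ this)
    have hm₁ := hmono (j + 1)
    have hm₀ := hmono j
    rw [hstep] at hm₁
    set a := s.mem bTrail (lo + j) with hadef
    set b := s.mem bTrail (lo + j + 1) with hbdef
    set H₀ := ((trailEdges y m x).take j).foldl addEdge H with hH₀
    have hla : (H₀ a).length < 4 := by
      have := hm₁ a
      simp [addEdge] at this
      omega
    have hR₁ := hJ.push hm₀ hla b
    have hm' : ∀ v, (H₀ v ++ if v = a then [b] else []).length ≤ 4 := by
      intro v
      have := hm₁ v
      simp only [addEdge, List.length_append] at this ⊢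
      omega
    have hlb : (H₀ b ++ if b = a then [b] else []).length < 4 := by
      have := hm₁ b
      simp [addEdge] at this ⊢
      omega
    have hR₂ := hR₁.push hm' hlb a
    have hd₁ := hR₁.length b
    have hda := hJ.length a
    rw [← hd₁] at hlb
    refine Runs.of_wp' (fun Q' hQ => ?_) (by simp [maxCost, addHalf])
    simp only [wp, addHalf]
    have e₁ : lo + 1 + j - 1 = lo + j := by omega
    have e₂ : s.mem bTrail (lo + 1 + j) = b := by rw [hbdef, add_right_comm]
    simp only [eval_reg, eval_mem, eval_add, eval_mul, eval_ofNat, eval_sub, safe_sub,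
      safe_reg, safe_mem, safe_add, safe_mul, safe_ofNat,
      State.setReg_reg, State.setReg_mem, State.setMem_reg, State.setMem_mem, true_and,
      Nat.reduceEqDiff, if_true, if_false, hr, htr, e₁, e₂, ← hadef]
    refine ⟨by omega, by omega, by omega, by omega, by omega, by omega, by omega, by omega,
      by omega, by omega, by omega, hQ _ ⟨by simp, ?_⟩⟩
    rw [show lo + 1 + j + 1 - (lo + 1) = j + 1 by omega, hstep, addEdge_eq]
    simpa using hR₂
  · rintro s' - - ⟨-, hJ⟩
    simp only [State.setReg_reg, Nat.reduceEqDiff, if_false, hhi] at hJ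
    rwa [List.take_of_length_le (by omega)] at hJ

end WordRAM

/-- Disjoint cycles have at most `n` vertices altogether, and the length cell of each cycle is paid
by one of its vertices. So the output buffer fits into `2 * n` cells. -/
lemma Packing.length_flatMap_le {n : ℕ} {L H : ℕ → List ℕ} {fl : ℕ → ℕ} {p q : ℕ}
    {Cs : List (List ℕ)} (hP : Packing n L H fl p q Cs) :
    (Cs.flatMap fun C => C.length :: C).length ≤ 2 * n := by
  have h₁ : Cs.flatten.Nodup := by
    rw [List.nodup_flatten]
    refine ⟨fun C hC => ?_, hP.disjoint⟩
    obtain ⟨m, x, rfl, h⟩ := hP.cycle C hC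
    exact h.nodup_right
  have h₂ : Cs.flatten.length ≤ n := by
    have : Cs.flatten.toFinset ⊆ Finset.range n := by
      intro v hv
      rw [List.mem_toFinset, List.mem_flatten] at hv
      obtain ⟨C, hC, hv⟩ := hv
      have := hP.used C hC v hv
      rw [Finset.mem_range]
      by_contra h
      exact this (hP.out v (by omega))
    have := Finset.card_le_card this
    rwa [List.toFinset_card_of_nodup h₁, Finset.card_range] at this
  have h₃ : ∀ Cs : List (List ℕ), (∀ C ∈ Cs, C ≠ []) →
      (Cs.flatMap fun C => C.length :: C).length ≤ 2 * Cs.flatten.length := by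
    intro Cs
    induction Cs with
    | nil => simp
    | cons C Cs ih =>
      intro h
      have h₄ := ih fun C hC => h C (List.mem_cons_of_mem _ hC)
      have h₅ := List.length_pos_iff.2 (h C (by simp))
      simp only [List.flatMap_cons, List.length_append, List.length_cons, List.flatten_cons]
      omega
  refine (h₃ Cs fun C hC => ?_).trans (by omega)
  obtain ⟨m, x, rfl, -⟩ := hP.cycle C hC
  simp

/-! ### One round of the growing phase -/

namespace WordRAM

open GraphSearch Prog WordRAM.Expr

variable {S W : ℕ}

/-- Append the cycle in `bTrail`, preceded by its length, to `bBuf`. -/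
def copyTrail : Prog :=
  store bBuf (reg rBuf) (reg rHi - reg rLo - 1) ;; rBuf ≔ reg rBuf + 1 ;; rI ≔ reg rLo + 1 ;;
  .while ((reg rI).less (reg rHi))
    (store bBuf (reg rBuf) (mem bTrail (reg rI)) ;; rBuf ≔ reg rBuf + 1 ;; rI ≔ reg rI + 1)

lemma copyTrail_runs {n lo hi bp : ℕ} {s : State} {l : List ℕ} (hlo : s.reg rLo = lo)
    (hhi : s.reg rHi = hi) (hbp : s.reg rBuf = bp) (hlt : lo < hi) (hle : hi ≤ 2 * n)
    (hS : bp + (hi - lo) ≤ 2 * n) (hS' : 4 * n + 4 < S) (hW : 4 * n + 4 < W)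
    (hl : arraySlice (s.mem bBuf) 0 bp = l) :
    Runs S W copyTrail s (100 * (n + 1)) fun s' => arraySlice (s'.mem bBuf) 0 (s'.reg rBuf) =
      l ++ (hi - lo - 1) :: arraySlice (s.mem bTrail) (lo + 1) hi := by
  refine RunsT.toRuns (Q := fun s' t => t ≤ 100 * (n + 1) ∧ _) ?_ fun _ _ _ _ h => h
  refine .store_seq (by simp) (by simp; omega) (by simp; omega)
    (.assign_seq (by simp; omega) (.assign_seq (by simp; omega) ?_))
  simp only [eval_reg, eval_add, eval_sub, eval_ofNat, State.setMem_reg, State.setReg_reg,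
    Nat.reduceEqDiff, if_false, hbp, hlo, hhi]
  refine (Runs.count (B := 40) (fun i s' => s'.reg rBuf = bp + 1 + (i - (lo + 1)) ∧
    arraySlice (s'.mem bBuf) 0 (s'.reg rBuf) =
      l ++ (hi - lo - 1) :: arraySlice (s.mem bTrail) (lo + 1) i)
    (by simp [wregs]) ?_ (by simp [hhi]; omega) ?_).toT.mono ?_
  · simp [arraySlice_snoc, hl]
    simp [arraySlice]
  · intro i s' hi₁ hi₂ hr hb hF hO ⟨hJ₁, hJ₂⟩
    simp [hhi] at hi₁ hi₂
    have htr : s'.mem bTrail = s.mem bTrail := hF.mem _ (by simp [wbanks])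
    refine Runs.of_wp' (fun Q' hQ => ?_) (by simp [maxCost])
    simp only [wp]
    simp [hr, htr, hJ₁]
    refine ⟨by omega, by omega, by omega, by omega, hQ _ ⟨by simp, by simp; omega, ?_⟩⟩
    · rw [hJ₁] at hJ₂
      simp only [State.setReg_mem, State.setReg_reg, State.setMem_mem, if_true,
        Nat.reduceEqDiff, if_false]
      rw [arraySlice_snoc (by omega), hJ₂, arraySlice_succ (by omega)]
      simp
  · rintro s' t - - ⟨ht, -, h⟩
    simp [hhi] at ht h
    refine ⟨?_, h.2⟩
    simp
    omega

/-- Mark the ends of the trail in `bTrail` and add it to the subgraph. -/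
def addEar : Prog :=
  ite (mem bDeg (reg rX)) (rEars ≔ reg rEars + 1) (copyTrail ;; rCycles ≔ reg rCycles + 1) ;;
  store bInf (reg rX) 1 ;; store bInf (reg rY) 1 ;; addEdges

/-- The memory contains a packing. -/
structure PackRep (S W n D : ℕ) (L H : ℕ → List ℕ) (fl : ℕ → ℕ) (p q : ℕ) (Cs : List (List ℕ))
    (s : State) : Prop where
  pack : Packing n L H fl p q Cs
  input : InputRep S W n L s
  depth : s.reg rDepth = D
  inf : s.mem bInf = fl
  lists : ListRep (s.mem bHadj) (s.mem bDeg) H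
  ears : s.reg rEars = p
  cycles : s.reg rCycles = q
  buf : arraySlice (s.mem bBuf) 0 (s.reg rBuf) = Cs.flatMap fun C => C.length :: C
  pos : ∀ v, n ≤ v → s.mem bPos v = 0

/-- Programs that do not touch the representation of a packing. -/
lemma PackRep.congr {n D : ℕ} {L H : ℕ → List ℕ} {fl : ℕ → ℕ} {p q : ℕ} {Cs : List (List ℕ)}
    {s s' : State} (h : PackRep S W n D L H fl p q Cs s)
    (hr : ∀ r ∈ [rN, rDepth, rEars, rCycles, rBuf], s'.reg r = s.reg r)
    (hm : ∀ b ∈ [bOff, bAdj, bInf, bDeg, bHadj, bBuf], s'.mem b = s.mem b)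
    (hp : ∀ v, n ≤ v → s'.mem bPos v = 0) : PackRep S W n D L H fl p q Cs s' where
  pack := h.pack
  input := ⟨(hr _ (by simp)).trans h.input.regN, by
    rw [hm bOff (by simp), hm bAdj (by simp)]; exact h.input.lists⟩
  depth := (hr _ (by simp)).trans h.depth
  inf := (hm _ (by simp)).trans h.inf
  lists := by rw [hm bHadj (by simp), hm bDeg (by simp)]; exact h.lists
  ears := (hr _ (by simp)).trans h.ears
  cycles := (hr _ (by simp)).trans h.cycles
  buf := by rw [hm bBuf (by simp), hr rBuf (by simp)]; exact h.buf
  pos := hp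

/-- The degree of `x` in `H` tells the cases apart: it is zero exactly for a new cycle, which is
then also copied to the output buffer. -/
lemma addEar_runs {n D : ℕ} {L H : ℕ → List ℕ} {fl : ℕ → ℕ} {p q : ℕ} {Cs : List (List ℕ)}
    {s : State} {x y : ℕ} {m : List ℕ} (hL : SymmLists n L) (h : PackRep S W n D L H fl p q Cs s)
    (hS : 4 * n + 4 < S) (hW : 4 * n + 4 < W) (hpW : p + 1 < W) (hqW : q + 1 < W)
    (hx : s.reg rX = x) (hy : s.reg rY = y)
    (ht : IsTrail L y m x) (hn : ∀ v ∈ y :: (m ++ [x]), v < n ∧ fl v = 0) (hm : ∀ v ∈ m, H v = [])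
    (hcase : x = y ∧ H x = [] ∨ H x ≠ [] ∧ H y ≠ [] ∧
        (m = [] → x ≠ y → (H y).count x + 1 ≤ (L y).count x))
    (hT : arraySlice (s.mem bTrail) (s.reg rLo) (s.reg rHi) = y :: (m ++ [x]))
    (hlt : s.reg rLo < s.reg rHi) (hle : s.reg rHi ≤ 2 * n) :
    Runs S W addEar s (500 * (n + 1)) fun s' => ∃ H' fl' p' q' Cs',
      PackRep S W n D L H' fl' p' q' Cs' s' ∧
      (p' = p + 1 ∧ q' = q ∨ p' = p ∧ q' = q + 1) := by
  have hxn : x < n := (hn x (by simp)).1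
  have hyn : y < n := (hn y (by simp)).1
  have hlen := h.lists.length x
  have hlT := congrArg List.length hT
  rw [length_arraySlice] at hlT
  simp at hlT
  suffices H₁ : Runs S W (ite (mem bDeg (reg rX)) (rEars ≔ reg rEars + 1)
      (copyTrail ;; rCycles ≔ reg rCycles + 1)) s (120 * (n + 1)) fun s' =>
      ∃ p' q' Cs', Packing n L ((trailEdges y m x).foldl addEdge H) (setFlags fl x y) p' q' Cs' ∧
        (p' = p + 1 ∧ q' = q ∨ p' = p ∧ q' = q + 1) ∧ s'.reg rEars = p' ∧ s'.reg rCycles = q' ∧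
        arraySlice (s'.mem bBuf) 0 (s'.reg rBuf) = Cs'.flatMap fun C => C.length :: C by
    refine Runs.seq H₁ (T₂ := 20 + 300 * (n + 1)) ?_ (by omega)
    rintro s₁ hO₁ hF₁ ⟨p', q', Cs', hP, hpq, hp, hq, hbuf⟩
    refine RunsT.toRuns (Q := fun s' t => t ≤ 20 + 300 * (n + 1) ∧ _) ?_ fun _ _ _ _ h => h
    have hreg : ∀ r ∈ [rN, rDepth, rX, rY, rLo, rHi], s₁.reg r = s.reg r := fun r hr =>
      hF₁.reg _ (by simp at hr; simp [copyTrail, wregs]; omega)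
    have hmem : ∀ b, b ≠ bBuf → s₁.mem b = s.mem b := fun r hr =>
      hF₁.mem _ (by simp [copyTrail, wbanks]; omega)
    have hx₁ : s₁.reg rX = x := (hreg _ (by simp)).trans hx
    have hy₁ : s₁.reg rY = y := (hreg _ (by simp)).trans hy
    refine .store_seq (by simp) (by simp; omega) (by simp; omega)
      (.store_seq (by simp) (by simp; omega) (by simp; omega) ?_)
    simp only [eval_reg, eval_ofNat, State.setMem_reg, hx₁, hy₁]
    refine (addEdges_runs (n := n) (y := y) (x := x) (m := m) (lo := s.reg rLo)
      (hi := s.reg rHi) (H := H) hS hW (by simp [hreg]) (by simp [hreg]) hlt hle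
      (by simpa [hmem] using hT) (fun v hv => (hn v hv).1) (by simpa [hmem] using h.lists)
      hP.four).toT.mono ?_
    rintro s' t - hF ⟨ht, hR⟩
    have hreg' : ∀ r, r ≠ rI → r ≠ rA → r ≠ rB → s'.reg r = s₁.reg r := fun r h₁ h₂ h₃ =>
      hF.reg _ (by simp [addEdges, addHalf, wregs]; omega)
    have hmem' : ∀ b, b ≠ bHadj → b ≠ bDeg → b ≠ bInf → s'.mem b = s₁.mem b := fun b h₁ h₂ h₃ =>
      (hF.mem _ (by simp [addEdges, addHalf, wbanks]; omega)).trans (by simp [h₃])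
    refine ⟨by simp; omega, _, _, p', q', Cs', ⟨hP, ⟨?_, ?_⟩, ?_, ?_, hR, ?_, ?_, ?_, ?_⟩, hpq⟩
    · rw [hreg' _ (by simp) (by simp) (by simp), hreg _ (by simp)]
      exact h.input.regN
    · rw [hmem' _ (by simp) (by simp) (by simp), hmem _ (by simp),
        hmem' _ (by simp) (by simp) (by simp), hmem _ (by simp)]
      exact h.input.lists
    · rw [hreg' _ (by simp) (by simp) (by simp), hreg _ (by simp)]
      exact h.depth
    · rw [hF.mem _ (by simp [addEdges, addHalf, wbanks])]
      simp only [State.setMem_mem, if_true]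
      rw [hmem _ (by simp), h.inf]
      ext v
      simp only [Function.update_apply, setFlags]
      split_ifs <;> first | rfl | omega
    · rw [hreg' _ (by simp) (by simp) (by simp), hp]
    · rw [hreg' _ (by simp) (by simp) (by simp), hq]
    · rw [hreg' _ (by simp) (by simp) (by simp), hmem' _ (by simp) (by simp) (by simp), hbuf]
    · rw [hmem' _ (by simp) (by simp) (by simp), hmem _ (by simp)]
      exact h.pos
  refine Runs.ite (T₁ := 100 * (n + 1) + 10) (by simp [hx]; omega) (fun he => ?_) (fun he => ?_)
    (by simp; omega)
  · simp [hx, hlen] at he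
    obtain ⟨h₁, h₂⟩ | ⟨h₁, h₂, h₃⟩ := hcase
    · exact absurd h₂ he
    refine Runs.of_wp' (fun Q' hQ => ?_) (by simp [maxCost])
    simp only [wp]
    simp [h.ears]
    exact ⟨⟨by omega, hpW⟩, hQ _ ⟨p + 1, q, Cs, h.pack.add_ear ht hL.symm hn hm h₁ h₂ h₃,
      .inl ⟨rfl, rfl⟩, by simp, by simp [h.cycles], by simpa using h.buf⟩⟩
  · simp [hx, hlen] at he
    obtain ⟨rfl, h₂⟩ | ⟨h₁, -⟩ := hcase
    swap
    · exact absurd he h₁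
    have hP := h.pack.add_cycle ht hL.symm hn hm he
    have hbl := congrArg List.length h.buf
    have hle' := hP.length_flatMap_le
    rw [length_arraySlice] at hbl
    simp only [List.flatMap_append, List.length_append, List.flatMap_cons, List.flatMap_nil,
      List.length_cons, List.length_nil] at hle'
    refine Runs.seq (copyTrail_runs (n := n) rfl rfl rfl hlt hle (by omega) hS hW h.buf)
      (T₂ := 4) ?_ (by omega)
    intro s' hO hF hb
    refine Runs.of_wp' (fun Q' hQ => ?_) (by simp [maxCost])
    have hq : s'.reg rCycles = q := (hF.reg _ (by simp [copyTrail, wregs])).trans h.cycles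
    have hp : s'.reg rEars = p := (hF.reg _ (by simp [copyTrail, wregs])).trans h.ears
    simp only [wp]
    simp [hq]
    refine ⟨⟨by omega, hqW⟩, hQ _ ⟨p, q + 1, _, hP, .inr ⟨rfl, rfl⟩, by simp [hp], by simp, ?_⟩⟩
    have hsl : arraySlice (s.mem bTrail) (s.reg rLo + 1) (s.reg rHi) = m ++ [x] := by
      rw [arraySlice_pred hlt] at hT
      exact (List.cons.inj hT).2
    simp only [State.setReg_mem, State.setReg_reg, Nat.reduceEqDiff, if_false]
    rw [hb, hsl]
    simp
    omega

/-- One round: find a cycle or an ear, and add it. -/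
def earRound : Prog := earSearch ;; ite (reg rFound) (climb ;; addEar) skip

lemma earRound_runs {n D b : ℕ} {L H : ℕ → List ℕ} {fl : ℕ → ℕ} {p q : ℕ} {Cs : List (List ℕ)}
    {s : State} (hL : SymmLists n L) (hc : ∀ v w, (L v).count w ≤ 2)
    (h : PackRep S W n D L H fl p q Cs s)
    (hS : 4 * n + 4 < S) (hW : 4 * n + 4 < W) (hDW : D + 2 < W) (hpW : p + 1 < W) (hqW : q + 1 < W)
    (hb : 2 * (2 * p + q) ≤ b) :
    Runs S W earRound s (1300 * ((b + 11) * (n + 1))) fun s' =>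
      (s'.reg rFound = 0 ∧ PackRep S W n D L H fl p q Cs s' ∧
        ∃ rk, IsForestRanking L (fun v => fl v = 0) rk) ∨
      (s'.reg rFound = 1 ∧ ∃ H' fl' p' q' Cs', PackRep S W n D L H' fl' p' q' Cs' s' ∧
        (p' = p + 1 ∧ q' = q ∨ p' = p ∧ q' = q + 1)) := by
  have hF := h.pack.toFlaggedSubgraph
  refine Runs.seq (earSearch_runs (b := b) hL hc hS hW h.depth hDW h.input h.pos h.inf h.lists hF
    ((Nat.mul_le_mul_left _ h.pack.sum_fl).trans hb)) (T₂ := 10 + 800 * (n + 1)) ?_ (by nlinarith)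
  intro s₁ hO₁ hF₁ ⟨hpos, hcase⟩
  have h₁ : PackRep S W n D L H fl p q Cs s₁ := h.congr
    (fun r hr => hF₁.reg _ (by
      simp at hr
      simp [earSearch, clearPos, pushRoots, pushRoot, searchLoop, scanVertex, scanList, scanEntry,
        freshRoot, wregs]
      omega))
    (fun r hr => hF₁.mem _ (by
      simp at hr
      simp [earSearch, clearPos, pushRoots, pushRoot, searchLoop, scanVertex, scanList, scanEntry,
        freshRoot, wbanks]
      omega)) hpos
  refine Runs.ite (T₁ := 800 * (n + 1)) (by simp) (fun he => ?_) (fun he => ?_)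
    (by simp only [cost_reg]; omega)
  · rcases hcase with ⟨h₀, -⟩ | ⟨hfd, rc, lo, tail, hI, hC⟩
    · exact absurd h₀ he
    refine Runs.seq (T₂ := 500 * (n + 1)) (climb_runs (earCtx_valid hL hF) (by
      show 2 * n + 2 < S
      omega) (by
      show 2 * n + 2 < W
      omega) h₁.input.regN rfl hI hC) ?_ (by
        show 300 * (n + 1) + _ ≤ _
        omega)
    rintro s₂ hO₂ hF₂ ⟨m, hcl, hend, hT, hlt, hle⟩
    have hreg : ∀ r ∈ [rN, rDepth, rEars, rCycles, rBuf, rFound], s₂.reg r = s₁.reg r :=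
      fun r hr => hF₂.reg _ (by simp at hr; simp [climb, climbLoop, wregs]; omega)
    have hmem : ∀ r, r ≠ bTrail → s₂.mem r = s₁.mem r :=
      fun r hr => hF₂.mem _ (by simp [climb, climbLoop, wbanks]; omega)
    have h₂ : PackRep S W n D L H fl p q Cs s₂ := h₁.congr
      (fun r hr => hreg r (by simp at hr ⊢; omega))
      (fun b hb => hmem b (by simp at hb; omega)) (by rw [hmem _ (by simp)]; exact hpos)
    obtain ⟨ht, hn, hm, hcase⟩ := hcl.trail_cases hL hF hI hC hend
    refine (addEar_runs hL h₂ hS hW hpW hqW rfl rfl ht hn hm hcase hT hlt hle).mono le_rfl ?_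
    intro s₃ hO₃ hF₃ h₃
    refine .inr ⟨?_, h₃⟩
    rw [hF₃.reg _ (by simp [addEar, copyTrail, addEdges, addHalf, wregs]), hreg _ (by simp), hfd]
  · rcases hcase with ⟨h₀, hrk⟩ | ⟨hfd, -⟩
    · exact Runs.of_wp (.inl ⟨h₀, h₁, hrk⟩) (by simp [maxCost]; omega)
    · simp [hfd] at he

end WordRAM

/-! ### The growing phase and its three ways to stop -/

namespace WordRAM

open GraphSearch Prog WordRAM.Expr

variable {S W : ℕ}

/-- Add cycles and ears until there are enough of them, or there are none left. -/
def packLoop : Prog :=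
  rFound ≔ 1 ;;
  .while (((reg rFound).both ((reg rCycles).less (reg rK))).both ((reg rEars).less (reg rLimit)))
    earRound

/-- Each round increases `p` or `q` by one or clears `rFound`, so `(k - q) + (T - p) + rFound`
counts the remaining rounds. The cost of a round is bounded by way of the number of flags, at most
`2 * T + k`. -/
lemma packLoop_runs {n D b k T : ℕ} {L H : ℕ → List ℕ} {fl : ℕ → ℕ} {p q : ℕ} {Cs : List (List ℕ)}
    {s : State} (hL : SymmLists n L) (hc : ∀ v w, (L v).count w ≤ 2)
    (h : PackRep S W n D L H fl p q Cs s) (hk : s.reg rK = k) (hT : s.reg rLimit = T)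
    (hS : 4 * n + 4 < S) (hW : 4 * n + 4 < W) (hDW : D + 2 < W) (hTW : T < W) (hkW : k < W)
    (hp : p ≤ T) (hq : q ≤ k) (hb : 2 * (2 * T + k) ≤ b) :
    Runs S W packLoop s ((k + T + 3) * (1300 * ((b + 11) * (n + 1)) + 30)) fun s' =>
      ∃ H fl p q Cs, PackRep S W n D L H fl p q Cs s' ∧
        ((s'.reg rFound = 0 ∧ q < k ∧ p ≤ T ∧ ∃ rk, IsForestRanking L (fun v => fl v = 0) rk) ∨
        (s'.reg rFound ≠ 0 ∧ (q = k ∨ (q < k ∧ p = T)))) := by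
  set B := 1300 * ((b + 11) * (n + 1)) + 30 with hB
  refine RunsT.toRuns (Q := fun s' t => t ≤ (k + T + 3) * B ∧ _) ?_ fun _ _ _ _ h => h
  refine .assign_seq (by simp; omega) ?_
  refine (RunsT.loop (fun s' => s'.reg rFound ≤ 1 ∧ ∃ H fl p q Cs,
      PackRep S W n D L H fl p q Cs s' ∧
      p ≤ T ∧ q ≤ k ∧ (s'.reg rFound = 0 → q < k ∧ ∃ rk, IsForestRanking L (fun v => fl v = 0) rk))
    (fun s' => B * ((k - s'.reg rCycles) + (T - s'.reg rEars) + s'.reg rFound)) ?_ ?_).mono ?_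
  · refine ⟨by simp, H, fl, p, q, Cs, h.congr ?_ (by simp) (by simpa using h.pos), hp, hq, by simp⟩
    intro r hr
    simp at hr ⊢
    omega
  · rintro s' ⟨hf, H, fl, p, q, Cs, h', hp, hq, -⟩ hO hF
    have hk' : s'.reg rK = k := by
      rw [hF.reg _ (by simp [earRound, earSearch, clearPos, pushRoots, pushRoot, searchLoop,
        scanVertex, scanList, scanEntry, freshRoot, climb, climbLoop, addEar, copyTrail,
        addEdges, addHalf, wregs])]
      simpa using hk
    have hT' : s'.reg rLimit = T := by
      rw [hF.reg _ (by simp [earRound, earSearch, clearPos, pushRoots, pushRoot, searchLoop,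
        scanVertex, scanList, scanEntry, freshRoot, climb, climbLoop, addEar, copyTrail,
        addEdges, addHalf, wregs])]
      simpa using hT
    refine ⟨by simp; omega, fun he => ?_⟩
    simp only [ne_eq, both_eq_zero, less_eq_zero, eval_reg, not_or, not_not,
      hk', hT', h'.cycles, h'.ears] at he
    obtain ⟨⟨he₁, he₂⟩, he₃⟩ := he
    refine (earRound_runs (b := b) hL hc h' hS hW hDW (by omega) (by omega) (by omega)).toT.mono ?_
    rintro s'' t - - ⟨ht, hcase⟩
    have hcost : (((reg rFound).both ((reg rCycles).less (reg rK))).both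
      ((reg rEars).less (reg rLimit))).cost = 17 := by simp
    rcases hcase with ⟨h₀, h'', hrk⟩ | ⟨h₁, H', fl', p', q', Cs', h'', hpq⟩
    · refine ⟨⟨by omega, H, fl, p, q, Cs, h'', hp, hq, fun _ => ⟨he₂, hrk⟩⟩, ?_⟩
      rw [h''.cycles, h''.ears, h'.cycles, h'.ears, h₀, hcost,
        show s'.reg rFound = 1 by omega, mul_add B _ 1, add_zero]
      omega
    · refine ⟨⟨by omega, H', fl', p', q', Cs', h'', by omega, by omega, by omega⟩, ?_⟩
      rw [h''.cycles, h''.ears, h'.cycles, h'.ears, h₁, hcost, show s'.reg rFound = 1 by omega,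
        show k - q + (T - p) + 1 = (k - q' + (T - p') + 1) + 1 by omega, mul_add B (_ + 1) 1]
      omega
  · rintro s' t - hF ⟨ht, ⟨hf, H', fl', p', q', Cs', h', hp', hq', hrk⟩, he⟩
    have hk' : s'.reg rK = k := by
      rw [hF.reg _ (by simp [earRound, earSearch, clearPos, pushRoots, pushRoot, searchLoop,
        scanVertex, scanList, scanEntry, freshRoot, climb, climbLoop, addEar, copyTrail,
        addEdges, addHalf, wregs])]
      simpa using hk
    have hT' : s'.reg rLimit = T := by
      rw [hF.reg _ (by simp [earRound, earSearch, clearPos, pushRoots, pushRoot, searchLoop,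
        scanVertex, scanList, scanEntry, freshRoot, climb, climbLoop, addEar, copyTrail,
        addEdges, addHalf, wregs])]
      simpa using hT
    refine ⟨?_, H', fl', p', q', Cs', h', ?_⟩
    · simp [h.cycles, h.ears] at ht
      have h₁ : B * (k - q + (T - p) + 1) ≤ B * (k + T + 1) := by gcongr <;> omega
      have h₂ : (k + T + 3) * B = B * (k + T + 1) + 2 * B := by ring
      simp
      omega
    · simp only [both_eq_zero, less_eq_zero, eval_reg, hk', hT', h'.cycles, h'.ears] at he
      by_cases h₀ : s'.reg rFound = 0
      · exact .inl ⟨h₀, (hrk h₀).1, hp', (hrk h₀).2⟩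
      · exact .inr ⟨h₀, by omega⟩

/-! ### Searching for a short cycle in the subgraph -/

/-- The data of the search for a short cycle. -/
def cycleCtx (n D : ℕ) (H : ℕ → List ℕ) (fl dd : ℕ → ℕ) : Ctx where
  n := n
  rc := 0
  D := D
  L := H
  xb := dd
  fw := fl
  h _ _ := 0
  R _ := False

lemma cycleCtx_valid {n D : ℕ} {L H : ℕ → List ℕ} {fl dd : ℕ → ℕ}
    (hF : FlaggedSubgraph n L H fl) : (cycleCtx n D H fl dd).Valid where
  lt _ _ _ hw := hF.lt hw
  symm _ _ _ _ hw := hF.symmLists.mem_symm hw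
  fw_le := hF.fl_le
  h_root _ _ h _ _ := h.elim

lemma cycleCtx_inv {n D r : ℕ} {L H : ℕ → List ℕ} {fl dd : ℕ → ℕ} {d : Data}
    (hF : FlaggedSubgraph n L H fl) (hd : ∀ v, d.pos v = 0) (hr : r < n) (hx : dd r = 0) :
    Inv (cycleCtx n D H fl dd) 0 1 0 0 1 (d.push 0 r 0 0 (fl r)) := by
  have h₀ : Inv (cycleCtx n D H fl dd) 0 0 0 0 0 d :=
    { rc_le := le_rfl
      lo_le := le_rfl
      rtop_le := le_rfl
      hb_le := le_rfl
      hs_le := le_rfl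
      stage := .inl ⟨rfl, rfl⟩
      que := by simp
      vis := fun v hv => absurd (hd v) hv
      flat := fun _ v hv => absurd (hd v) hv
      par := fun v hv => by rw [hd] at hv; omega
      glob := fun v hv => by rw [hd] at hv; omega
      root_dep := fun v hv => by rw [hd] at hv; omega
      child := fun v w hw => by
        have := hw.1
        rw [hd] at this
        omega
      scan := fun v hv => absurd (hd v) hv
      closed := fun v hv => absurd (hd v) hv
      root := fun v => by
        rw [hd]
        simp [cycleCtx]
      root_skip := fun v hv => hv.elim }
  exact h₀.push_root hr hx (hd r) le_rfl (.inr rfl) (cycleCtx_valid hF)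

/-- Search for a short cycle near the vertex in register `rStart`. -/
def cycleSearch : Prog :=
  clearPos ;; rTail ≔ 0 ;; rR ≔ reg rStart ;; pushRoot 0 0 ;;
  rHead ≔ 0 ;; rTop ≔ reg rTail ;; rR ≔ reg rN ;;
  searchLoop bDead bHadj (4 * reg rV) (4 * reg rV + mem bDeg (reg rV))

/-- What is known after a successful search for a short cycle. -/
def CycleFound (n D : ℕ) (H : ℕ → List ℕ) (fl dd : ℕ → ℕ) (s : State) : Prop :=
  s.reg rFound = 1 ∧ s.reg rTop = 1 ∧ ∃ lo tail,
    Inv (cycleCtx n D H fl dd) lo (s.reg rTop) 0 tail tail s.sd ∧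
    Coll (cycleCtx n D H fl dd) lo s.sd (s.reg rV) (s.reg rW)

/-- The counter of candidate roots starts at `n`, so the search never leaves the tree of `r` and the
depth limit is harmless. Degrees in `H` are at most four, so a search takes linear time. -/
lemma cycleSearch_runs {n D r : ℕ} {L H : ℕ → List ℕ} {fl dd : ℕ → ℕ} {p q : ℕ}
    {Cs : List (List ℕ)} {s : State} (h : PackRep S W n D L H fl p q Cs s)
    (hS : 4 * n + 4 < S) (hW : 4 * n + 4 < W) (hDW : D + 2 < W) (hdd : s.mem bDead = dd)
    (hr : s.reg rStart = r) (hrn : r < n) (hr₁ : fl r = 1) (hr₂ : dd r = 0)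
    (hf : s.reg rFound = 0) :
    Runs S W cycleSearch s (4000 * (n + 1)) fun s' =>
      (∀ v, n ≤ v → s'.mem bPos v = 0) ∧ ((s'.reg rFound = 0 ∧
        TreeBall H ((Finset.range n).filter fun v => H v ≠ [] ∧ dd v = 0) fl D r) ∨
      CycleFound n D H fl dd s') := by
  have hF := h.pack.toFlaggedSubgraph
  refine Runs.seq (clearPos_runs h.input.regN (by omega) (by omega) h.pos)
    (T₂ := 100 + 3000 * (n + 1)) ?_ (by omega)
  intro s₁ hO₁ hF₁ hp₁
  have hreg₁ : ∀ r, r ≠ rI → s₁.reg r = s.reg r := fun r hr =>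
    hF₁.reg _ (by simp [clearPos, wregs]; omega)
  have hm₁ : ∀ b, b < 5 ∨ 9 < b → s₁.mem b = s.mem b := fun b hb =>
    hF₁.mem _ (by simp [clearPos, wbanks]; omega)
  set c := cycleCtx n D H fl dd with hcdef
  have hval : c.Valid := cycleCtx_valid hF
  refine RunsT.toRuns (Q := fun s' t => t ≤ 100 + 3000 * (n + 1) ∧ _) ?_
    fun _ _ _ _ h => h
  refine .assign_seq (by simp; omega) (.assign_seq (by simp) ?_)
  simp only [eval_ofNat, eval_reg, State.setReg_reg, Nat.reduceEqDiff, if_false,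
    hreg₁ rStart (by simp), hr]
  refine RunsT.seq (Q₁ := fun s₂ t => t ≤ 40 ∧ (∀ r, r ≠ rTail → r ≠ rR → r ≠ rI →
      s₂.reg r = s.reg r) ∧ s₂.reg rTail = 1 ∧ (∀ b, b < 5 ∨ 9 < b → s₂.mem b = s.mem b) ∧
      s₂.sd = s₁.sd.push 0 r 0 0 (fl r))
    ((Runs.of_wp' (T := 40) (fun Q' hQ => ?_) (by simp [maxCost, pushRoot])).toT) ?_
  · simp only [wp, pushRoot]
    simp [hm₁, h.inf]
    repeat refine ⟨by omega, ?_⟩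
    refine hQ _ ⟨?_, ?_, ?_, ?_⟩
    · intro r h₁ h₂ h₃
      simp [h₁, h₂, hreg₁ r h₃]
    · simp
    · intro b hb
      simp only [State.setMem_mem, State.setReg_mem]
      rw [if_neg (by omega), if_neg (by omega), if_neg (by omega), if_neg (by omega),
        if_neg (by omega), hm₁ b hb]
    · simp [State.sd, Data.push]
  rintro s₂ t₂ hO₂ hF₂ ⟨ht₂, hreg₂, hT₂, hm₂, hsd₂⟩
  have hinv : Inv c 0 1 0 0 1 s₂.sd := by
    rw [hsd₂]
    exact cycleCtx_inv hF (fun v => congrFun hp₁ v) hrn hr₂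
  refine .assign_seq (by simp; omega) (.assign_seq (by simp) (.assign_seq (by simp) ?_))
  simp only [eval_ofNat, eval_reg, State.setReg_reg, Nat.reduceEqDiff, if_false, hT₂,
    hreg₂ rN (by simp) (by simp) (by simp), h.input.regN]
  refine (searchLoop_runs (b := 4) (r₀ := n) (st := r) hval ⟨?_, ?_, hDW, ?_, ?_, ?_, ?_,
    ?_, ?_, ?_, ?_, ?_, ?_⟩ ⟨?_, ?_, ?_, ?_, ?_, 0, ?_, .inl ⟨?_, ?_⟩⟩ (.inl rfl)).toT.mono
      ?_
  · show 2 * n + 2 < S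
    omega
  · show 2 * n + 2 < W
    omega
  · omega
  · omega
  · simp
  · simp
  · simpa [hreg₂, hcdef, cycleCtx] using h.input.regN
  · simpa [hreg₂, hcdef, cycleCtx] using h.depth
  · simpa [hm₂, hcdef, cycleCtx] using hdd
  · simpa [hm₂, hcdef, cycleCtx] using h.inf
  · intro v hv
    exact List.countP_le_length.trans (hF.four v)
  · refine ⟨fun v => 4 * v, fun v hv => ⟨?_, ?_⟩⟩
    · intro s' h₁ h₂ h₃
      have hv : v < n := hv
      have h₄ := hF.four v
      simp only [State.setReg_mem, hm₂ bDeg (by omega)] at h₂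
      rw [show c.L v = H v from rfl]
      simp [h₂, h₃, h.lists.length]
      omega
    · intro i hi
      have hv : v < n := hv
      have h₄ := hF.four v
      have hi : i < (H v).length := hi
      simp only [State.setReg_mem, hm₂ bHadj (by omega)]
      exact ⟨h.lists.getElem hi, by omega, by omega⟩
  · simp
  · simp
  · simp [hcdef, cycleCtx]
  · simp
    omega
  · intro _ _
    exact ⟨by simp, by simp [hsd₂, push_pos]⟩
  · simp
  · simpa [hreg₂] using hf
  · simpa [hT₂] using hinv
  · rintro s' t hO' hF' ⟨ht, hI', hfin⟩
    have hn : c.n = n := rfl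
    rw [hn] at ht hfin
    refine ⟨by simp; omega, ?_⟩
    obtain ⟨-, -, -, -, hfix, lo, -, hcase⟩ := hI'
    obtain ⟨hT', hpr⟩ := hfix rfl (by omega)
    have hpos : ∀ hs hb, Inv c lo (s'.reg rTop) hs hb (s'.reg rTail) s'.sd →
        ∀ v, n ≤ v → s'.mem bPos v = 0 := by
      intro hs hb hInv v hv
      by_contra h
      have : v < n := (hInv.vis v h).1
      omega
    rcases hcase with ⟨h₀, hInv⟩ | ⟨h₁, hInv, hColl⟩
    · refine ⟨hpos _ _ hInv, .inl ⟨h₀, ?_⟩⟩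
      rw [(hfin h₀).1, hT'] at hInv
      exact hInv.treeBall rfl hpr hr₁ fun w hw => (Finset.mem_filter.1 hw).2.2
    · exact ⟨hpos _ _ hInv, .inr ⟨h₁, hT', lo, _, hInv, hColl⟩⟩

end WordRAM

/-! ### Extracting `k` disjoint short cycles -/

namespace WordRAM

open GraphSearch Prog WordRAM.Expr

variable {S W : ℕ}

/-- Find a short cycle. -/
def findCycle : Prog :=
  rFound ≔ 0 ;; rStart ≔ 0 ;;
  .while (((reg rFound).same 0).both ((reg rStart).less (reg rN)))
    (ite ((mem bInf (reg rStart)).both ((mem bDead (reg rStart)).same 0)) cycleSearch skip ;;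
    rStart ≔ reg rStart + 1)

lemma CycleFound.congr {n D : ℕ} {H : ℕ → List ℕ} {fl dd : ℕ → ℕ} {s s' : State}
    (h : CycleFound n D H fl dd s) (hr : ∀ r, r ≠ rStart → s'.reg r = s.reg r)
    (hm : s'.mem = s.mem) : CycleFound n D H fl dd s' := by
  have hsd : s'.sd = s.sd := by simp [State.sd, hm]
  unfold CycleFound
  rw [hsd, hr _ (by simp), hr _ (by simp), hr _ (by simp), hr _ (by simp)]
  exact h

lemma sum_Ico_eq_add {fl : ℕ → ℕ} {r n : ℕ} (h : r < n) :
    ∑ v ∈ Finset.Ico r n, fl v = fl r + ∑ v ∈ Finset.Ico (r + 1) n, fl v :=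
  Finset.sum_eq_sum_Ico_succ_bot h _

/-- Only flagged vertices that are not deleted serve as starting points, so at most `2 * p + q`
linear searches are made; the potential is the number of flags still ahead. If all failed, all balls
would be trees, which `Packing.not_treeBall` excludes. -/
lemma findCycle_runs {n D b k : ℕ} {L H : ℕ → List ℕ} {fl dd : ℕ → ℕ} {p q : ℕ}
    {Cs Es : List (List ℕ)} {s : State} (h : PackRep S W n D L H fl p q Cs s)
    (hS : 4 * n + 4 < S) (hW : 4 * n + 4 < W) (hDW : D + 2 < W) (hdd : s.mem bDead = dd)
    (hE : Extraction n H fl (2 * D + 1) dd Es) (hk : Es.length < k)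
    (hp : 8 * (2 * D + 1) * k < p) (hq : q ≤ k) (hD : 4 ^ D * (3 * p) < 5 ^ D)
    (hb : 2 * p + q ≤ b) :
    Runs S W findCycle s (4100 * ((b + 1) * (n + 1))) fun s' =>
      PackRep S W n D L H fl p q Cs s' ∧ CycleFound n D H fl dd s' := by
  have hF := h.pack.toFlaggedSubgraph
  have hsum := h.pack.sum_fl
  refine RunsT.toRuns (Q := fun s' t => t ≤ 4100 * ((b + 1) * (n + 1)) ∧ _) ?_
    fun _ _ _ _ h => h
  refine .assign_seq (by simp; omega) (.assign_seq (by simp; omega) ?_)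
  refine (RunsT.loop (fun s' => PackRep S W n D L H fl p q Cs s' ∧ s'.mem bDead = dd ∧
      s'.reg rStart ≤ n ∧ ((s'.reg rFound = 0 ∧ ∀ r < s'.reg rStart, dd r = 0 → fl r = 1 →
        TreeBall H ((Finset.range n).filter fun v => H v ≠ [] ∧ dd v = 0) fl D r) ∨
      CycleFound n D H fl dd s'))
    (fun s' => 4000 * (n + 1) * ∑ v ∈ Finset.Ico (s'.reg rStart) n, fl v +
      50 * (n - s'.reg rStart)) ⟨?_, ?_, ?_, .inl ⟨?_, ?_⟩⟩ ?_).mono ?_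
  · refine h.congr ?_ (by simp) (by simpa using h.pos)
    intro r hr
    simp at hr
    obtain rfl | rfl | rfl | rfl | rfl := hr <;> simp
  · simpa using hdd
  · simp
  · simp
  · simp
  · rintro s' ⟨h', hdd', hle, hcase⟩ hO hFr
    have hN := h'.input.regN
    refine ⟨by simp; omega, fun he => ?_⟩
    simp only [ne_eq, both_eq_zero, same_eq_zero, less_eq_zero, eval_reg, eval_ofNat, not_or,
      not_not, hN] at he
    obtain ⟨he₁, he₂⟩ := he
    have htree : ∀ r < s'.reg rStart, dd r = 0 → fl r = 1 →
        TreeBall H ((Finset.range n).filter fun v => H v ≠ [] ∧ dd v = 0) fl D r := by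
      rcases hcase with ⟨-, h₁⟩ | ⟨h₁, -⟩
      · exact h₁
      · omega
    rw [sum_Ico_eq_add he₂]
    have hfr := hF.fl_le (s'.reg rStart)
    set r := s'.reg rStart with hr
    refine RunsT.seq (Q₁ := fun s'' t => t ≤ 20 + 4000 * (n + 1) * fl r ∧ s''.reg rStart = r ∧
      PackRep S W n D L H fl p q Cs s'' ∧ s''.mem bDead = dd ∧
      ((s''.reg rFound = 0 ∧ (dd r = 0 → fl r = 1 →
        TreeBall H ((Finset.range n).filter fun v => H v ≠ [] ∧ dd v = 0) fl D r)) ∨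
      CycleFound n D H fl dd s'')) (.ite ?_ (fun hx => ?_) (fun hx => ?_)) ?_
    · simp
      omega
    · simp only [ne_eq, both_eq_zero, same_eq_zero, eval_mem, eval_reg, eval_ofNat, not_or,
        not_not, ← hr, h'.inf, hdd'] at hx
      have hr₁ : fl r = 1 := by omega
      refine (cycleSearch_runs h' hS hW hDW hdd' hr.symm he₂ hr₁ hx.2 he₁).toT.mono ?_
      rintro s'' t - hF'' ⟨ht, hpos, hcase'⟩
      refine ⟨by simp [hr₁]; omega, hF''.reg _ (by
        simp [cycleSearch, clearPos, pushRoot, searchLoop, scanVertex, scanList, scanEntry,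
          freshRoot, wregs]), h'.congr (fun r hr => hF''.reg _ (by
        simp at hr
        simp [cycleSearch, clearPos, pushRoot, searchLoop, scanVertex, scanList, scanEntry,
          freshRoot, wregs]
        omega)) (fun r hr => hF''.mem _ (by
        simp at hr
        simp [cycleSearch, clearPos, pushRoot, searchLoop, scanVertex, scanList, scanEntry,
          freshRoot, wbanks]
        omega)) hpos, (hF''.mem _ (by
        simp [cycleSearch, clearPos, pushRoot, searchLoop, scanVertex, scanList, scanEntry,
          freshRoot, wbanks])).trans hdd', ?_⟩
      rcases hcase' with ⟨h₁, h₂⟩ | h₁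
      · exact .inl ⟨h₁, fun _ _ => h₂⟩
      · exact .inr h₁
    · simp only [both_eq_zero, same_eq_zero, eval_mem, eval_reg, eval_ofNat,
        ← hr, h'.inf, hdd'] at hx
      refine .skip ⟨by simp; omega, hr.symm, h', hdd', .inl ⟨he₁, fun h₁ h₂ => ?_⟩⟩
      omega
    · rintro s'' t - - ⟨ht, hr', h'', hdd'', hcase'⟩
      refine (Runs.of_wp' (T := 4) (Q := fun s₃ => s₃ = s''.setReg rStart (r + 1))
        (fun Q' hQ => ?_) (by simp [maxCost])).toT.mono ?_
      · simp only [wp]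
        simp [hr']
        exact ⟨by omega, hQ _ rfl⟩
      · rintro _ t' - - ⟨ht', rfl⟩
        refine ⟨⟨h''.congr ?_ (by simp) (by simpa using h''.pos), by simpa using hdd'',
          by simp; omega, ?_⟩, ?_⟩
        · intro r hr
          simp at hr ⊢
          omega
        · rcases hcase' with ⟨h₁, h₂⟩ | h₁
          · refine .inl ⟨by simpa using h₁, fun u hu hu₁ hu₂ => ?_⟩
            simp at hu
            by_cases hur : u = r
            · rw [hur] at hu₁ hu₂ ⊢
              exact h₂ hu₁ hu₂
            · exact htree u (by omega) hu₁ hu₂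
          · exact .inr (h₁.congr (fun r hr => by simp [hr]) rfl)
        · simp only [State.setReg_reg, if_true]
          rw [show n - r = n - (r + 1) + 1 by omega, mul_add (4000 * (n + 1))]
          simp
          omega
  · rintro s' t - hFr ⟨ht, ⟨h', hdd', hle, hcase⟩, he⟩
    refine ⟨?_, h', ?_⟩
    · simp at ht
      have h₁ : 4000 * (n + 1) * ∑ v ∈ Finset.Ico 0 n, fl v ≤ 4000 * (n + 1) * b := by
        gcongr
        rw [← Finset.range_eq_Ico]
        omega
      have h₂ : 4100 * ((b + 1) * (n + 1)) =
          4000 * (n + 1) * b + 100 * ((n + 1) * b) + 4100 * (n + 1) := by ring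
      rw [← Finset.range_eq_Ico] at h₁
      simp
      omega
    · rcases hcase with ⟨h₁, h₂⟩ | h₁
      · simp only [both_eq_zero, same_eq_zero, less_eq_zero, eval_reg, eval_ofNat, h₁,
          h'.input.regN] at he
        exact (h.pack.not_treeBall hE hk hp hq hD fun r hr _ hr₁ hr₂ =>
          h₂ r (by omega) hr₁ hr₂).elim
      · exact h₁

/-- Output the cycle in `bTrail` and mark its vertices. -/
def emitCycle : Prog :=
  .emit (reg rHi - reg rLo - 1) ;; rI ≔ reg rLo + 1 ;;
  .while ((reg rI).less (reg rHi))
    (.emit (mem bTrail (reg rI)) ;; store bDead (mem bTrail (reg rI)) 1 ;; rI ≔ reg rI + 1)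

lemma emitCycle_runs {n lo hi : ℕ} {s : State} {dd : ℕ → ℕ} {l : List ℕ} (hlo : s.reg rLo = lo)
    (hhi : s.reg rHi = hi) (hlt : lo < hi) (hle : hi ≤ 2 * n)
    (hS : 4 * n + 4 < S) (hW : 4 * n + 4 < W) (hdd : s.mem bDead = dd)
    (hl : arraySlice (s.mem bTrail) (lo + 1) hi = l) (hn : ∀ v ∈ l, v < n) :
    Runs S W emitCycle s (100 * (n + 1)) fun s' => s'.out = s.out ++ l.length :: l ∧
      ∀ v, s'.mem bDead v ≠ 0 ↔ dd v ≠ 0 ∨ v ∈ l := by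
  have hll : l.length = hi - lo - 1 := by
    rw [← hl, length_arraySlice]
    omega
  refine RunsT.toRuns (Q := fun s' t => t ≤ 100 * (n + 1) ∧ _) ?_ fun _ _ _ _ h => h
  refine .emit_seq (by simp; omega) (.assign_seq (by simp; omega) ?_)
  simp only [eval_reg, eval_add, eval_sub, eval_ofNat, State.emit_reg, hlo, hhi]
  refine (Runs.count (B := 40) (fun i s' => s'.out =
      s.out ++ (hi - lo - 1) :: arraySlice (s.mem bTrail) (lo + 1) i ∧
      ∀ v, s'.mem bDead v ≠ 0 ↔ dd v ≠ 0 ∨ v ∈ arraySlice (s.mem bTrail) (lo + 1) i)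
    (by simp [wregs]) ?_ (by simp [hhi]; omega) ?_).toT.mono ?_
  · simp [arraySlice, hdd]
  · intro i s' hi₁ hi₂ hr hb hF hO ⟨hJ₁, hJ₂⟩
    simp [hhi] at hi₁ hi₂
    have htr : s'.mem bTrail = s.mem bTrail := hF.mem _ (by simp [wbanks])
    have hmem : s.mem bTrail i < n := by
      refine hn _ ?_
      rw [← hl, arraySlice, List.mem_map]
      refine ⟨i, ?_, rfl⟩
      rw [List.mem_range'_1]
      omega
    refine Runs.of_wp' (fun Q' hQ => ?_) (by simp [maxCost])
    simp only [wp]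
    simp [hr, htr]
    repeat refine ⟨by omega, ?_⟩
    refine hQ _ ⟨by simp, ?_, fun v => ?_⟩
    · rw [arraySlice_succ (by omega)]
      simp [hJ₁]
    · rw [arraySlice_succ (by omega), List.mem_append, List.mem_singleton, ← or_assoc, ← hJ₂ v]
      simp only [State.setReg_mem, State.setMem_mem, if_true, Function.update_apply,
        State.emit_mem]
      split_ifs with h
      · simp [h]
      · simp [h]
  · rintro s' t - - ⟨ht, -, h₁, h₂⟩
    simp [hhi] at ht h₁ h₂
    rw [hl] at h₁
    rw [hll]
    refine ⟨?_, h₁, fun v => ?_⟩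
    · simp
      omega
    · rw [← hl]
      simpa using h₂ v

/-- Output as many disjoint cycles as requested. -/
def extractLoop : Prog :=
  rRound ≔ 0 ;; .while ((reg rRound).less (reg rK))
    (findCycle ;; climb ;; emitCycle ;; rRound ≔ reg rRound + 1)

/-- Greedy removal: each cycle is output at once and its vertices are marked as deleted. The depth
limit bounds its flags by `2 * D + 1`, so the surplus of edges survives until `k` cycles have been
found. -/
lemma extractLoop_runs {n D b k : ℕ} {L H : ℕ → List ℕ} {fl : ℕ → ℕ} {p q : ℕ}
    {Cs : List (List ℕ)} {s : State} (h : PackRep S W n D L H fl p q Cs s)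
    (hS : 4 * n + 4 < S) (hW : 4 * n + 4 < W) (hDW : D + 2 < W) (hkW : k + 1 < W)
    (hdd : s.mem bDead = fun _ => 0) (hk : s.reg rK = k)
    (hp : 8 * (2 * D + 1) * k < p) (hq : q ≤ k) (hD : 4 ^ D * (3 * p) < 5 ^ D)
    (hb : 2 * p + q ≤ b) :
    Runs S W extractLoop s ((k + 1) * (5000 * ((b + 1) * (n + 1)))) fun s' =>
      ∃ Es : List (List ℕ), Es.length = k ∧ (∀ C ∈ Es, IsCycleList L C) ∧
        Es.Pairwise List.Disjoint ∧
        s'.out = s.out ++ Es.flatMap fun C => C.length :: C := by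
  have hF := h.pack.toFlaggedSubgraph
  have hbn : n + 1 ≤ (b + 1) * (n + 1) := Nat.le_mul_of_pos_left _ (by omega)
  refine RunsT.toRuns (Q := fun s' t => t ≤ (k + 1) * (5000 * ((b + 1) * (n + 1))) ∧ _) ?_
    fun _ _ _ _ h => h
  refine .assign_seq (by simp; omega) ?_
  refine (Runs.count (B := 4900 * ((b + 1) * (n + 1))) (fun i s' =>
      PackRep S W n D L H fl p q Cs s' ∧ ∃ Es : List (List ℕ), Es.length = i ∧
      Extraction n H fl (2 * D + 1) (s'.mem bDead) Es ∧
      s'.out = s.out ++ Es.flatMap fun C => C.length :: C) (by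
        simp [findCycle, cycleSearch, clearPos, pushRoot, searchLoop, scanVertex, scanList,
          scanEntry, freshRoot, climb, climbLoop, emitCycle, wregs]) ⟨?_, [], ?_, ?_, ?_⟩
      (by simp) ?_).toT.mono ?_
  · refine h.congr ?_ (by simp) (by simpa using h.pos)
    intro r hr
    simp at hr ⊢
    omega
  · simp
  · simp only [State.setReg_mem, hdd]
    exact extraction_zero _ _ _ _
  · simp
  · rintro i s' - hi hr hb' hFr hO ⟨h', Es, hlen, hE, hout⟩
    simp [hk] at hi
    have hbn4 : 4900 * ((b + 1) * (n + 1)) = 4100 * ((b + 1) * (n + 1)) +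
      800 * ((b + 1) * (n + 1)) := by ring
    refine Runs.seq (findCycle_runs h' hS hW hDW rfl hE (hlen.trans_lt hi) hp hq hD hb)
      (T₂ := 800 * (n + 1)) ?_ (by omega)
    rintro s₁ hO₁ hF₁ ⟨h₁, hfd, hT₁, lo, tail, hI, hC⟩
    have hD₁ : s₁.mem bDead = s'.mem bDead := hF₁.mem _ (by
      simp [findCycle, cycleSearch, clearPos, pushRoot, searchLoop, scanVertex, scanList,
          scanEntry, freshRoot, wbanks])
    have hR₁ : s₁.reg rRound = i := (hF₁.reg _ (by
      simp [findCycle, cycleSearch, clearPos, pushRoot, searchLoop, scanVertex, scanList,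
          scanEntry, freshRoot, wregs])).trans hr
    have hO₁' : s₁.out = s'.out := hF₁.out (by
      simp [findCycle, cycleSearch, clearPos, pushRoot, searchLoop, scanVertex, scanList,
          scanEntry, freshRoot, emits])
    refine Runs.seq (T₁ := 300 * (n + 1)) (climb_runs (cycleCtx_valid hF) (by
      show 2 * n + 2 < S
      omega) (by
      show 2 * n + 2 < W
      omega) h₁.input.regN rfl hI hC) (T₂ := 200 * (n + 1)) ?_ (by omega)
    rintro s₂ hO₂ hF₂ ⟨m, hcl, hend, hT, hlt, hle⟩
    have hle : s₂.reg rHi ≤ 2 * n := hle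
    -- The tree has a single root, so the two walks always meet and the trail is closed.
    have hxy : s₂.reg rX = s₂.reg rY := by
      rcases hend with h | ⟨h₂, h₃⟩
      · exact h
      · have h₄ := hcl.pos_x
        have h₅ := hcl.pos_y
        refine hI.pos_inj (by omega) ?_
        omega
    rw [← hxy] at hcl hT
    set x := s₂.reg rX with hx
    have ht : IsTrail H x m x := hcl.isTrail hI.rc_le hC hF.symm
    have hcyc : ∀ v ∈ m ++ [x], s₁.sd.pos v ≠ 0 := by
      intro v hv
      rw [List.mem_append, List.mem_singleton] at hv
      obtain hv | rfl := hv
      · have := hcl.big v hv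
        omega
      · have := hcl.pos_x
        omega
    have hvis := fun v hv => hI.vis v (hcyc v hv)
    have hne : ∀ v ∈ m ++ [x], H v ≠ [] := by
      intro v hv
      rw [← trailEdges_snd (y := x) (m := m) (x := x), List.mem_map] at hv
      obtain ⟨⟨a, b⟩, hab, rfl⟩ := hv
      exact List.ne_nil_of_mem (hF.symmLists.mem_symm (ht.mem hab))
    have hreg : ∀ r ∈ [rN, rDepth, rEars, rCycles, rBuf, rRound], s₂.reg r = s₁.reg r :=
      fun r hr => hF₂.reg _ (by simp at hr; simp [climb, climbLoop, wregs]; omega)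
    have hmem : ∀ r, r ≠ bTrail → s₂.mem r = s₁.mem r :=
      fun r hr => hF₂.mem _ (by simp [climb, climbLoop, wbanks]; omega)
    have h₂ : PackRep S W n D L H fl p q Cs s₂ := h₁.congr
      (fun r hr => hreg r (by simp at hr ⊢; omega))
      (fun b hb => hmem b (by simp at hb; omega)) (by rw [hmem _ (by simp)]; exact h₁.pos)
    have hsl : arraySlice (s₂.mem bTrail) (s₂.reg rLo + 1) (s₂.reg rHi) = m ++ [x] := by
      rw [arraySlice_pred hlt] at hT
      exact (List.cons.inj hT).2
    refine Runs.seq (emitCycle_runs (n := n) (dd := s'.mem bDead) rfl rfl hlt hle hS hW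
      (by rw [hmem _ (by simp), hD₁]) hsl fun v hv => (hvis v hv).1) (T₂ := 4) ?_ (by omega)
    rintro s₃ hO₃ hF₃ ⟨hout₃, hdd₃⟩
    have hreg₃ : ∀ r, r ≠ rI → s₃.reg r = s₂.reg r := fun r hr =>
      hF₃.reg _ (by simp [emitCycle, wregs]; omega)
    have h₃ : PackRep S W n D L H fl p q Cs s₃ := h₂.congr
      (fun r hr => hreg₃ r (by simp at hr; omega))
      (fun b hb => hF₃.mem b (by simp at hb; simp [emitCycle, wbanks]; omega))
      (by rw [hF₃.mem _ (by simp [emitCycle, wbanks])]; exact h₂.pos)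
    have hE₃ : Extraction n H fl (2 * D + 1) (s₃.mem bDead) (Es ++ [m ++ [x]]) :=
      hE.add hF ht (fun v hv => hD₁ ▸ hD₁ ▸ (hvis v hv).2.2.2.1) hne hdd₃
        (hcl.sum_weight_le hI hC)
    refine Runs.of_wp' (fun Q' hQ => ?_) (by simp [maxCost])
    have hR₃ : s₃.reg rRound = i := by rw [hreg₃ _ (by simp), hreg _ (by simp), hR₁]
    simp only [wp]
    simp [hR₃]
    refine ⟨⟨by omega, by omega⟩, hQ _ ⟨by simp, h₃.congr ?_ (by simp) (by simpa using h₃.pos),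
      Es ++ [m ++ [x]], by simp [hlen], by simpa using hE₃, ?_⟩⟩
    · intro r hr
      simp at hr ⊢
      omega
    · have hO₂' : s₂.out = s₁.out := hF₂.out (by simp [climb, climbLoop, emits])
      simp only [State.setReg_out]
      rw [hout₃, hO₂', hO₁', hout]
      simp
  · rintro s' t - - ⟨ht, -, h', Es, hlen, hE, hout⟩
    simp [hk] at ht hlen
    refine ⟨?_, Es, hlen, fun C hC => hF.isCycleList (hE.cycle C hC), hE.disjoint, hout⟩
    have : (k + 1) * (5000 * ((b + 1) * (n + 1))) = k * (4900 * ((b + 1) * (n + 1)) + 4) +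
      k * (100 * ((b + 1) * (n + 1)) - 4) + 5000 * ((b + 1) * (n + 1)) := by
      rw [← mul_add, show 4900 * ((b + 1) * (n + 1)) + 4 + (100 * ((b + 1) * (n + 1)) - 4) =
        5000 * ((b + 1) * (n + 1)) by omega]
      ring
    simp
    omega

end WordRAM

/-! ### The whole program, its constants and its running time -/

namespace WordRAM

open GraphSearch Prog WordRAM.Expr

variable {S W : ℕ}

/-- Compute the number of binary digits of `k`. -/
def computeSize : Prog :=
  rSize ≔ 0 ;; rA ≔ reg rK ;;
  .while (reg rA) (rA ≔ .op .div (reg rA) 2 ;; rSize ≔ reg rSize + 1)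

lemma computeSize_runs {k : ℕ} {s : State} (hk : s.reg rK = k) (hW : k + 3 < W) :
    Runs S W computeSize s (20 * (k + 1)) fun s' =>
      k < 2 ^ s'.reg rSize ∧ (s'.reg rSize = 0 ∨ 2 ^ (s'.reg rSize - 1) ≤ k) := by
  refine RunsT.toRuns (Q := fun s' t => t ≤ 20 * (k + 1) ∧ _) ?_ fun _ _ _ _ h => h
  refine .assign_seq (by simp; omega) (.assign_seq (by simp) ?_)
  refine (RunsT.loop (fun s' => s'.reg rA = k / 2 ^ s'.reg rSize ∧
    (s'.reg rSize = 0 ∨ 2 ^ (s'.reg rSize - 1) ≤ k)) (fun s' => 20 * s'.reg rA) ?_ ?_).mono ?_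
  · simp [hk]
  · rintro s' ⟨h₁, h₂⟩ - -
    refine ⟨by simp, fun he => ?_⟩
    have he : s'.reg rA ≠ 0 := he
    have h₃ : 2 ^ s'.reg rSize ≤ k := by
      by_contra h
      rw [Nat.div_eq_of_lt (by omega)] at h₁
      exact he h₁
    have h₄ : s'.reg rSize < 2 ^ s'.reg rSize := Nat.lt_two_pow_self
    refine (Runs.of_wp' (T := 8) (Q := fun s'' => s''.reg rA = s'.reg rA / 2 ∧
      s''.reg rSize = s'.reg rSize + 1) (fun Q' hQ => ?_) (by simp [maxCost])).toT.mono ?_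
    · simp only [wp]
      simp
      exact ⟨by omega, ⟨by omega, by omega⟩, hQ _ ⟨by simp, by simp⟩⟩
    · rintro s'' t - - ⟨ht, h₅, h₆⟩
      refine ⟨⟨?_, .inr ?_⟩, ?_⟩
      · rw [h₅, h₆, h₁, Nat.div_div_eq_div_mul, pow_succ]
      · rw [h₆]
        exact h₃
      · simp
        omega
  · rintro s' t - - ⟨ht, ⟨h₁, h₂⟩, he⟩
    have he : s'.reg rA = 0 := he
    simp [hk] at ht
    refine ⟨by simp; omega, ?_, h₂⟩
    rw [he] at h₁
    exact Nat.lt_of_div_eq_zero (by positivity) h₁.symm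

/-- Output the flagged vertices. -/
def emitVertices : Prog :=
  .emit 1 ;; rI ≔ 0 ;; .while ((reg rI).less (reg rN))
    (ite (mem bInf (reg rI)) (.emit (reg rI)) skip ;; rI ≔ reg rI + 1)

lemma emitVertices_runs {n : ℕ} {fl : ℕ → ℕ} {s : State} (hN : s.reg rN = n)
    (hS : n < S) (hW : n + 1 < W) (hfl : s.mem bInf = fl) :
    Runs S W emitVertices s (40 * (n + 1)) fun s' =>
      s'.out = s.out ++ 1 :: (List.range n).filter fun v => fl v ≠ 0 := by
  refine RunsT.toRuns (Q := fun s' t => t ≤ 40 * (n + 1) ∧ _) ?_ fun _ _ _ _ h => h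
  refine .emit_seq (by simp; omega) (.assign_seq (by simp; omega) ?_)
  refine (Runs.count (B := 20) (fun i s' => s'.out =
      s.out ++ 1 :: (List.range i).filter fun v => fl v ≠ 0)
    (by simp [wregs]) ?_ (by simp) ?_).toT.mono ?_
  · simp
  · intro i s' _ hi hr hb hF hO hJ
    simp [hN] at hi
    have hfl' : s'.mem bInf = fl := (hF.mem _ (by simp [wbanks])).trans hfl
    refine Runs.of_wp' (fun Q' hQ => ?_) (by simp [maxCost])
    simp only [wp]
    simp [hr, hfl']
    refine ⟨by omega, fun h => ⟨⟨by omega, by omega⟩, hQ _ ⟨by simp, ?_⟩⟩,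
      fun h => ⟨⟨by omega, by omega⟩, hQ _ ⟨by simp, ?_⟩⟩⟩
    · simp [hJ, List.range_succ, h]
    · simp [hJ, List.range_succ, h]
  · rintro s' t - - ⟨ht, -, h⟩
    simp [hN] at ht
    refine ⟨by simp; omega, ?_⟩
    simpa [hN] using h

/-- Output the cycles that have been collected. -/
def emitBuffer : Prog :=
  .emit 0 ;; rI ≔ 0 ;; .while ((reg rI).less (reg rBuf))
    (.emit (mem bBuf (reg rI)) ;; rI ≔ reg rI + 1)

lemma emitBuffer_runs {n : ℕ} {l : List ℕ} {s : State} (hB : s.reg rBuf ≤ 2 * n)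
    (hS : 4 * n + 4 < S) (hW : 4 * n + 4 < W) (hl : arraySlice (s.mem bBuf) 0 (s.reg rBuf) = l) :
    Runs S W emitBuffer s (40 * (n + 1)) fun s' => s'.out = s.out ++ 0 :: l := by
  refine RunsT.toRuns (Q := fun s' t => t ≤ 40 * (n + 1) ∧ _) ?_ fun _ _ _ _ h => h
  refine .emit_seq (by simp; omega) (.assign_seq (by simp; omega) ?_)
  refine (Runs.count (B := 10) (fun i s' => s'.out =
      s.out ++ 0 :: arraySlice (s.mem bBuf) 0 i)
    (by simp [wregs]) ?_ (by simp) ?_).toT.mono ?_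
  · simp [arraySlice]
  · intro i s' _ hi hr hb hF hO hJ
    simp at hi
    have hbuf : s'.mem bBuf = s.mem bBuf := hF.mem _ (by simp [wbanks])
    refine Runs.of_wp' (fun Q' hQ => ?_) (by simp [maxCost])
    simp only [wp]
    simp [hr, hbuf]
    refine ⟨by omega, ⟨by omega, by omega⟩, hQ _ ⟨by simp, ?_⟩⟩
    rw [arraySlice_succ (by omega)]
    simp [hJ]
  · rintro s' t - - ⟨ht, -, h⟩
    simp at ht h
    refine ⟨by simp; omega, ?_⟩
    rw [h, hl]

/-- The whole program. -/
def cyclesOrVertices : Prog :=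
  computeSize ;; rLimit ≔ 1024 * reg rK * reg rSize ;; rDepth ≔ 56 * reg rSize ;; packLoop ;;
  ite (reg rFound) (ite ((reg rCycles).less (reg rK)) (.emit 0 ;; extractLoop) emitBuffer)
    emitVertices

/-- The choice of the depth limit. From `2 * 4 ^ 4 = 512 ≤ 625 = 5 ^ 4`, the ratio `(5 / 4) ^ (56 *
l)` is at least `2 ^ (14 * l)`. Twelve of the fourteen factors `2 ^ l` absorb the constant 3072 and
the other two absorb `k` and `l`. -/
lemma four_pow_mul_lt {k l : ℕ} (hk : k < 2 ^ l) (hl : l ≠ 0) :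
    4 ^ (56 * l) * (3 * (1024 * k * l)) < 5 ^ (56 * l) := by
  have h₁ : 2 ^ (14 * l) * 4 ^ (56 * l) ≤ 5 ^ (56 * l) := by
    have : 56 * l = 4 * (14 * l) := by ring
    rw [this, pow_mul 4, pow_mul 5, ← mul_pow]
    exact Nat.pow_le_pow_left (by norm_num) _
  have h₂ : l < 2 ^ l := Nat.lt_two_pow_self
  have h₃ : 3 * (1024 * k * l) < 2 ^ (14 * l) := by
    calc 3 * (1024 * k * l) = 3072 * (k * l) := by ring
      _ ≤ 3072 * (2 ^ l * 2 ^ l) := by gcongr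
      _ < 2 ^ 12 * (2 ^ l * 2 ^ l) := by
          gcongr
          norm_num
      _ ≤ 2 ^ (12 * l) * (2 ^ l * 2 ^ l) := by
          gcongr
          · norm_num
          · omega
      _ = 2 ^ (14 * l) := by
          rw [← pow_add, ← pow_add]
          congr 1
          ring
  calc 4 ^ (56 * l) * (3 * (1024 * k * l)) < 4 ^ (56 * l) * 2 ^ (14 * l) := by gcongr
    _ ≤ 5 ^ (56 * l) := by rwa [mul_comm]

/-- The dominant third term is the growing phase: `O(K ^ 2)` rounds, each of time `O(K ^ 2 * (n +
1))`. The extraction contributes `O(K ^ 3 * (n + 1))`. The crude estimate `l ≤ k` suffices here. -/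
lemma time_bound {K n b b' k l : ℕ} (hK : K = k + 1) (hl : l ≤ k)
    (hb : b = 2 * (2 * (1024 * k * l) + k)) (hb' : b' = 2 * (1024 * k * l) + k) :
    20 * (k + 1) + 20 + (k + 1024 * k * l + 3) * (1300 * ((b + 11) * (n + 1)) + 30) + 20 +
      (k + 1) * (5000 * ((b' + 1) * (n + 1))) + 40 * (n + 1) ≤
    10 ^ 10 * (K ^ 4 * (n + 1)) := by
  have hkl : k * l ≤ k * k := Nat.mul_le_mul_left _ hl
  have h₁ : b' + 1 ≤ 2049 * K ^ 2 := by
    subst hb' hK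
    nlinarith
  have h₂ : b + 11 ≤ 4110 * K ^ 2 := by
    subst hb hK
    nlinarith
  have h₃ : k + 1024 * k * l + 3 ≤ 1030 * K ^ 2 := by
    subst hK
    nlinarith
  have h₄ : 1 ≤ K := by omega
  have h₅ : K ≤ K ^ 4 := Nat.le_self_pow (by norm_num) _
  have h₆ : K ^ 3 ≤ K ^ 4 := Nat.pow_le_pow_right h₄ (by norm_num)
  have h₇ : K ^ 2 ≤ K ^ 4 := Nat.pow_le_pow_right h₄ (by norm_num)
  have h₈ : 1 ≤ K ^ 4 := Nat.one_le_pow _ _ h₄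
  have hn : 1 ≤ n + 1 := by omega
  calc _ ≤ 20 * K ^ 4 * (n + 1) + 20 * K ^ 4 * (n + 1) +
        1030 * K ^ 2 * (1300 * (4110 * K ^ 2 * (n + 1)) + 30 * K ^ 2 * (n + 1)) +
        20 * K ^ 4 * (n + 1) +
        5000 * K ^ 4 * 2049 * (n + 1) + 40 * K ^ 4 * (n + 1) := by
        gcongr ?_ + ?_ + ?_ + ?_ + ?_ + ?_
        · rw [← hK]
          nlinarith
        · nlinarith
        · gcongr
          nlinarith [Nat.one_le_pow 2 K h₄]
        · nlinarith
        · rw [← hK]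
          calc K * (5000 * ((b' + 1) * (n + 1))) ≤ K * (5000 * (2049 * K ^ 2 * (n + 1))) := by
                gcongr
            _ = 5000 * K ^ 3 * 2049 * (n + 1) := by ring
            _ ≤ _ := by gcongr
        · nlinarith
    _ = (20 + 20 + 1030 * (1300 * 4110 + 30) + 20 + 5000 * 2049 + 40) * (K ^ 4 * (n + 1)) := by
        ring
    _ ≤ _ := by
        gcongr
        norm_num

lemma getD_flatMap_range {adj : ℕ → List ℕ} {n v i : ℕ} (hv : v < n)
    (hi : i < (adj v).length) :
    ((List.range n).flatMap adj).getD (∑ u ∈ Finset.range v, (adj u).length + i) 0 =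
      (adj v)[i] := by
  have hlen : ∀ v, ((List.range v).flatMap adj).length =
      ∑ u ∈ Finset.range v, (adj u).length := by
    intro v
    induction v with
    | zero => simp
    | succ v ih => rw [List.range_succ, List.flatMap_append, List.length_append, ih,
        Finset.sum_range_succ]; simp
  induction n with
  | zero => omega
  | succ n ih =>
    rw [List.range_succ, List.flatMap_append]
    by_cases h : v < n
    · have h₁ : ∑ u ∈ Finset.range v, (adj u).length + i < ((List.range n).flatMap adj).length := by
        rw [hlen]
        have : ∑ u ∈ Finset.range (v + 1), (adj u).length ≤ ∑ u ∈ Finset.range n, (adj u).length :=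
          Finset.sum_le_sum_of_subset (by
            intro a ha
            rw [Finset.mem_range] at ha ⊢
            omega)
        rw [Finset.sum_range_succ] at this
        omega
      rw [List.getD_append _ _ _ _ h₁, ih h]
    · obtain rfl : v = n := by omega
      rw [List.getD_append_right _ _ _ _ (by rw [hlen]; omega), hlen, Nat.add_sub_cancel_left]
      simp [hi]

end WordRAM

namespace WordRAM

open GraphSearch Prog WordRAM.Expr

variable {S W : ℕ}

lemma length_filter_range {n : ℕ} {fl : ℕ → ℕ} (h : ∀ v, fl v ≤ 1) :
    ((List.range n).filter fun v => fl v ≠ 0).length = ∑ v ∈ Finset.range n, fl v := by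
  induction n with
  | zero => simp
  | succ n ih =>
    rw [List.range_succ, List.filter_append, List.length_append, ih, Finset.sum_range_succ]
    congr 1
    have := h n
    by_cases h₀ : fl n = 0
    · simp [h₀]
    · simp [show fl n = 1 by omega]

/-- The digit count `l` is returned together with `2 ^ (l - 1) ≤ k`, so that the logarithm enters
only at the very end. The case `k ≤ 1` is listed separately because `k log k` vanishes there. -/
lemma cyclesOrVertices_runs {n k : ℕ} {L : ℕ → List ℕ} {s : State} (hL : SymmLists n L)
    (hc : ∀ v w, (L v).count w ≤ 2) (hI : InputRep S W n L s) (hk : s.reg rK = k)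
    (hreg : ∀ r, 2 ≤ r → s.reg r = 0) (hmem : ∀ b, 2 ≤ b → s.mem b = fun _ => 0)
    (hout : s.out = []) (hS : 4 * n + 4 < S) (hW : 4 * n + 4 < W)
    (hkW : 1024 * (k * k) + 56 * k + 1100 < W) :
    Runs S W cyclesOrVertices s (10 ^ 10 * ((k + 1) ^ 4 * (n + 1))) fun s' =>
      (∃ Es : List (List ℕ), s'.out = encodeCycles Es ∧ Es.length = k ∧
        (∀ C ∈ Es, IsCycleList L C) ∧ Es.Pairwise List.Disjoint) ∨
      (∃ (fl : ℕ → ℕ) (l : ℕ) (F : List ℕ), F = (List.range n).filter (fun v => fl v ≠ 0) ∧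
        s'.out = encodeVertices F ∧ (∃ rk, IsForestRanking L (fun v => fl v = 0) rk) ∧
        F.length ≤ 2 * (1024 * k * l) + k ∧ (k ≤ 1 → F.length = 0) ∧
        (l = 0 ∨ 2 ^ (l - 1) ≤ k)) := by
  have hT := fun l hl => time_bound (K := k + 1) (n := n) (k := k) (l := l) rfl hl rfl rfl
  have hT₀ := hT 0 (by omega)
  refine Runs.seq (computeSize_runs hk (by omega))
    (T₂ := 10 ^ 10 * ((k + 1) ^ 4 * (n + 1)) - 20 * (k + 1)) ?_ (by omega)
  rintro s₁ - hF₁ ⟨hl, hl'⟩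
  set l := s₁.reg rSize with hldef
  have hlk : l ≤ k := by
    rcases hl' with h | h
    · omega
    · have : l - 1 < 2 ^ (l - 1) := Nat.lt_two_pow_self
      omega
  have hT := hT l hlk
  have hkl : k * l ≤ k * k := Nat.mul_le_mul_left _ hlk
  have hkk : k ≤ k * k := Nat.le_mul_self k
  have hk₁ : s₁.reg rK = k := (hF₁.reg _ (by simp [computeSize, wregs])).trans hk
  have hm₁ : s₁.mem = s.mem := funext fun b => hF₁.mem _ (by simp [computeSize, wbanks])
  have hr₁ : ∀ r, r ≠ rSize → r ≠ rA → s₁.reg r = s.reg r := fun r h h' =>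
    hF₁.reg _ (by simp [computeSize, wregs]; omega)
  have ho₁ : s₁.out = [] := (hF₁.out (by simp [computeSize, emits])).trans hout
  set A := (k + 1024 * k * l + 3) * (1300 * ((2 * (2 * (1024 * k * l) + k) + 11) * (n + 1)) + 30)
  set B := (k + 1) * (5000 * ((2 * (1024 * k * l) + k + 1) * (n + 1)))
  refine RunsT.toRuns (Q := fun s' t => t ≤ 10 ^ 10 * ((k + 1) ^ 4 * (n + 1)) - 20 * (k + 1) ∧ _)
    ?_ fun _ _ _ _ h => h
  refine .assign_seq (by simp [hk₁, ← hldef, mul_assoc]; omega)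
    (.assign_seq (by simp [← hldef]; omega) ?_)
  set s₂ := (s₁.setReg rLimit (Expr.eval s₁ (1024 * reg rK * reg rSize))).setReg rDepth _ with hs₂
  have hlim : s₂.reg rLimit = 1024 * k * l := by simp [hs₂, hk₁, hldef]
  have hdep : s₂.reg rDepth = 56 * l := by simp [hs₂, hldef]
  have hr₂ : ∀ r, r ≠ rSize → r ≠ rA → r ≠ rLimit → r ≠ rDepth → s₂.reg r = s.reg r := by
    intro r h h' h₃ h₄
    simp [hs₂, h₃, h₄, hr₁ r h h']
  have hm₂ : s₂.mem = s.mem := by simp [hs₂, hm₁]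
  have hP : PackRep S W n (56 * l) L (fun _ => []) (fun _ => 0) 0 0 [] s₂ := by
    refine ⟨packing_empty n L, ⟨?_, ?_⟩, hdep, ?_, ?_, ?_, ?_, ?_, ?_⟩
    · rw [hr₂ _ (by simp) (by simp) (by simp) (by simp), hI.regN]
    · rw [hm₂]
      exact hI.lists
    · rw [hm₂, hmem _ (by simp)]
    · intro v
      rw [hm₂, hmem bDeg (by simp)]
      simp [arraySlice]
    · rw [hr₂ _ (by simp) (by simp) (by simp) (by simp), hreg _ (by simp)]
    · rw [hr₂ _ (by simp) (by simp) (by simp) (by simp), hreg _ (by simp)]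
    · rw [hr₂ _ (by simp) (by simp) (by simp) (by simp), hreg _ (by simp)]
      simp [arraySlice]
    · intro v _
      rw [hm₂, hmem _ (by simp)]
  have hK₂ : s₂.reg rK = k := by
    rw [hr₂ _ (by simp) (by simp) (by simp) (by simp), hk]
  have hrun := packLoop_runs hL hc hP hK₂ hlim hS hW (by omega) (by rw [mul_assoc]; omega)
    (by omega) (Nat.zero_le _) (Nat.zero_le _) le_rfl
  refine RunsT.mono (Q := fun s' t => t ≤ A + (20 + B + 40 * (n + 1)) ∧ _) (Runs.toT ?_)
    fun s' t _ _ h => ⟨by have := h.1; simp; omega, h.2⟩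
  refine Runs.seq hrun (T₂ := 20 + B + 40 * (n + 1)) ?_ le_rfl
  rintro s₃ - hF₃ ⟨H, fl, p, q, Cs, hP₃, hcase⟩
  have hK₃ : s₃.reg rK = k := (hF₃.reg _ (by
    simp [packLoop, earRound, earSearch, clearPos, pushRoots, pushRoot, searchLoop, scanVertex,
        scanList, scanEntry, freshRoot, climb, climbLoop, addEar, copyTrail, addEdges, addHalf,
        wregs])).trans hK₂
  have hdd : s₃.mem bDead = fun _ => 0 := (hF₃.mem _ (by
    simp [packLoop, earRound, earSearch, clearPos, pushRoots, pushRoot, searchLoop, scanVertex,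
        scanList, scanEntry, freshRoot, climb, climbLoop, addEar, copyTrail, addEdges, addHalf,
        wbanks])).trans (by rw [hm₂, hmem _ (by simp)])
  have ho₃ : s₃.out = [] := (hF₃.out (by
    simp [packLoop, earRound, earSearch, clearPos, pushRoots, pushRoot, searchLoop, scanVertex,
        scanList, scanEntry, freshRoot, climb, climbLoop, addEar, copyTrail, addEdges, addHalf,
        emits])).trans (by simp [hs₂, ho₁])
  refine Runs.ite (T₁ := 10 + B + 40 * (n + 1)) (by simp) (fun hf => ?_) (fun hf => ?_)
      (by simp; omega)
  · have hf : s₃.reg rFound ≠ 0 := hf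
    rcases hcase with h | ⟨-, hq⟩
    · exact absurd h.1 hf
    refine Runs.ite (T₁ := 2 + B + 40 * (n + 1)) (by simp) (fun hf => ?_) (fun hf => ?_)
      (by simp; omega)
    · simp only [ne_eq, less_eq_zero, eval_reg, not_not, hP₃.cycles, hK₃] at hf
      obtain ⟨-, rfl⟩ : q < k ∧ p = 1024 * k * l := by omega
      have hl₀ : l ≠ 0 := by
        intro h
        rw [h] at hl
        omega
      have hk₀ : 0 < k := by omega
      have hkl₀ : k ≤ k * l := Nat.le_mul_of_pos_right _ (by omega)
      refine Runs.seq (T₁ := 2) (Q₁ := fun s' => s' = s₃.emit 0)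
        (Runs.of_wp (by simp [wp]; omega) (by simp [maxCost])) (T₂ := B) ?_ (by omega)
      rintro s₄ - - rfl
      have hP₄ : PackRep S W n (56 * l) L H fl (1024 * k * l) q Cs (s₃.emit 0) :=
        hP₃.congr (by simp) (by simp) (by simpa using hP₃.pos)
      refine (extractLoop_runs (b := 2 * (1024 * k * l) + k) hP₄ hS hW (by omega) (by omega)
        (by simpa using hdd) (by simpa using hK₃) ?_ (by omega) (four_pow_mul_lt hl hl₀)
        (by omega)).mono le_rfl ?_
      -- The limit of 1024 ears per `k * l` is chosen to exceed this bound, as `k ≤ k * l`.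
      · have : 8 * (2 * (56 * l) + 1) * k = 896 * (k * l) + 8 * k := by ring
        rw [this, mul_assoc]
        omega
      · rintro s' - - ⟨Es, h₁, h₂, h₃, h₄⟩
        refine .inl ⟨Es, ?_, h₁, h₂, h₃⟩
        simp [h₄, ho₃, encodeCycles]
    · simp only [less_eq_zero, eval_reg, hP₃.cycles, hK₃] at hf
      obtain rfl : q = k := by omega
      have hlen : s₃.reg rBuf ≤ 2 * n := by
        have h₁ := hP₃.pack.length_flatMap_le
        have h₂ := congrArg List.length hP₃.buf
        rw [length_arraySlice] at h₂
        omega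
      refine (emitBuffer_runs hlen hS hW hP₃.buf).mono (by omega) ?_
      rintro s' - - h
      exact .inl ⟨Cs, by simp [h, ho₃, encodeCycles], hP₃.pack.length_eq, hP₃.pack.cycle,
        hP₃.pack.disjoint⟩
  · have hf : s₃.reg rFound = 0 := hf
    obtain ⟨-, hq, hp, hrk⟩ : _ ∧ _ := hcase.resolve_right fun h => h.1 hf
    have hlen := length_filter_range (n := n) hP₃.pack.fl_le
    have hsum := hP₃.pack.sum_fl
    refine (emitVertices_runs hP₃.input.regN (by omega) (by omega) hP₃.inf).mono (by omega) ?_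
    rintro s' - - h
    refine .inr ⟨fl, l, _, rfl, by simp [h, ho₃, encodeVertices], hrk, ?_, fun hk1 => ?_, hl'⟩
    · rw [hlen]
      omega
    -- Here `q < k ≤ 1`, so no cycle was found; then there are no ears and no flags either.
    · have := (hP₃.pack.empty (by omega)).1
      rw [hlen]
      omega

end WordRAM

/-! ### The initial state and the final bounds -/

namespace WordRAM

open GraphSearch Prog WordRAM.Expr

section InitialState

variable {β : Type*} {n k : ℕ} {G : Graph ℕ β} {adj : ℕ → List ℕ}

lemma _root_.Graph.IsAdjacencyLists.symmLists (h : G.IsAdjacencyLists n adj) :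
    SymmLists n (Graph.extendLists n adj) where
  out v hv := by simp [Graph.extendLists, Nat.not_lt.2 hv]
  symm := h.symm

lemma _root_.Graph.IsAdjacencyLists.count_le_two (h : G.IsAdjacencyLists n adj)
    (h₂ : ∀ u v, {e | G.IsLink e u v}.encard ≤ 2) (v w : ℕ) :
    (Graph.extendLists n adj v).count w ≤ 2 := by
  have := h₂ v w
  rw [h.encard] at this
  exact_mod_cast this

lemma _root_.Graph.IsAdjacencyLists.length_le (h : G.IsAdjacencyLists n adj)
    (h₂ : ∀ u v, {e | G.IsLink e u v}.encard ≤ 2) {v : ℕ} (hv : v < n) :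
    (adj v).length ≤ 2 * n := by
  have h₃ : Graph.extendLists n adj v = adj v := if_pos hv
  rw [← sum_count_eq (s := Finset.range n)]
  · refine (Finset.sum_le_card_nsmul _ _ 2 fun w _ => ?_).trans (by simp [mul_comm])
    rw [← h₃]
    exact h.count_le_two h₂ v w
  · intro w hw
    rw [← h₃] at hw
    exact Finset.mem_range.2 (h.symmLists.lt hw)

lemma _root_.Graph.IsAdjacencyLists.sum_length_le (h : G.IsAdjacencyLists n adj)
    (h₂ : ∀ u v, {e | G.IsLink e u v}.encard ≤ 2) {i : ℕ} (hi : i ≤ n) :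
    ∑ v ∈ Finset.range i, (adj v).length ≤ 2 * (n * n) := by
  refine (Finset.sum_le_card_nsmul _ _ (2 * n) fun v hv => ?_).trans ?_
  · exact h.length_le h₂ (by have := Finset.mem_range.1 hv; omega)
  · rw [Finset.card_range, smul_eq_mul]
    nlinarith

lemma initialState_ok {W : ℕ} (h : G.IsAdjacencyLists n adj)
    (h₂ : ∀ u v, {e | G.IsLink e u v}.encard ≤ 2) (hW : 2 * (n * n) + n + k + 2 ≤ W) :
    (initialState n k adj).Ok W := by
  refine ⟨by omega, fun r => ?_, fun b i => ?_⟩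
  · simp only [initialState]
    split_ifs <;> omega
  · simp only [initialState]
    split_ifs with h₀ h₁ h₁
    · have := h.sum_length_le h₂ h₁
      omega
    · omega
    · rw [List.getD_eq_getElem?_getD]
      rcases hw : ((List.range n).flatMap adj)[i]? with - | w
      · simp
        omega
      · obtain ⟨v, hv, hwv⟩ := List.mem_flatMap.1 (List.mem_of_getElem? hw)
        have hv : v < n := List.mem_range.1 hv
        have : w < n := h.symmLists.lt (v := v) (by rwa [Graph.extendLists, if_pos hv])
        simp
        omega
    · omega

lemma initialState_inputRep {S W : ℕ} (h : G.IsAdjacencyLists n adj)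
    (h₂ : ∀ u v, {e | G.IsLink e u v}.encard ≤ 2) (hW : 2 * (n * n) + n + k + 2 ≤ W)
    (hS : (∑ v ∈ Finset.range n, (adj v).length) + 1 < S) :
    InputRep S W n (Graph.extendLists n adj) (initialState n k adj) where
  regN := by simp [initialState]
  lists v hv := by
    have h₃ : Graph.extendLists n adj v = adj v := if_pos hv
    have h₄ : ∑ u ∈ Finset.range (v + 1), (adj u).length ≤ ∑ u ∈ Finset.range n, (adj u).length :=
      Finset.sum_le_sum_of_subset (Finset.range_subset_range.2 hv)
    have h₅ := h.sum_length_le h₂ le_rfl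
    rw [Finset.sum_range_succ] at h₄
    simp only [h₃, initialState, if_true, if_pos (show v + 1 ≤ n from hv), if_pos hv.le,
      Finset.sum_range_succ, one_ne_zero, if_false, true_and]
    exact fun i hi => ⟨getD_flatMap_range hv hi, by omega, by omega⟩

end InitialState

/-- From `(l - 1) * log 2 ≤ log k` and `log 2 ≤ log k` follows `l * log 2 ≤ 2 * log k`, hence `l ≤ 3
* log k`. So `2048 * l + 1` is at most `6144 * log k + 1`, which leaves room below `8000 * log k`.
-/
lemma two_pow_log_bound {k l : ℕ} (hk : 2 ≤ k) (hl : l = 0 ∨ 2 ^ (l - 1) ≤ k) :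
    ((2 * (1024 * k * l) + k : ℕ) : ℝ) ≤ 8000 * k * Real.log k := by
  have hk' : (2 : ℝ) ≤ k := by exact_mod_cast hk
  have h2 := Real.log_two_gt_d9
  have h₁ : Real.log 2 ≤ Real.log k := Real.log_le_log (by norm_num) hk'
  have h₂ : (l : ℝ) * Real.log 2 ≤ 2 * Real.log k := by
    rcases hl with rfl | hl
    · simp
      linarith
    · have h₃ : ((2 : ℝ) ^ (l - 1)) ≤ k := by exact_mod_cast hl
      have h₄ := Real.log_le_log (by positivity) h₃
      rw [Real.log_pow] at h₄
      have h₅ : (l : ℝ) ≤ (l - 1 : ℕ) + 1 := by exact_mod_cast (by omega : l ≤ l - 1 + 1)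
      nlinarith
  push_cast
  have h₃ : (l : ℝ) ≤ 3 * Real.log k := by nlinarith [Nat.cast_nonneg (α := ℝ) l]
  have h₄ : (2048 : ℝ) * l + 1 ≤ 8000 * Real.log k := by nlinarith
  nlinarith

end WordRAM

/-- Time `k^{O(1)} · |V|` is `a * (k + 1) ^ a * (n + 1)`.  The memory is polynomial in the input
size (vertices, adjacency-list entries, bits of `k`), and machine words have `O(log (n + k))`
bits. -/
theorem theorem2 :
    ∃ (c : ℝ) (P : WordRAM.Prog) (a : ℕ),
      ∀ {β : Type*} (n k : ℕ) (G : Graph ℕ β) (adj : ℕ → List ℕ),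
        G.IsAdjacencyLists n adj →
        (∀ u v, {e | G.IsLink e u v}.encard ≤ 2) →
        ∃ (t : ℕ) (s : WordRAM.State),
          WordRAM.Exec
            (a * (n + (∑ v ∈ Finset.range n, (adj v).length) + Nat.size k + 1) ^ a)
            (a * (n + k + 1) ^ a)
            P (WordRAM.initialState n k adj) t s ∧
          t ≤ a * (k + 1) ^ a * (n + 1) ∧
          ((∃ Cs : List (List ℕ), s.out = encodeCycles Cs ∧ Cs.length = k ∧
              (∀ C ∈ Cs, G.IsCycleSeq C) ∧ Cs.Pairwise List.Disjoint) ∨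
            (∃ F : List ℕ, s.out = encodeVertices F ∧ F.Nodup ∧
              G.IsFeedbackVertexSet {v | v ∈ F} ∧
              (F.length : ℝ) ≤ c * k * Real.log k)) := by
  -- Only the lower bound for `a` is remembered; the powers with exponent `a` are opaque from here
  -- on and enter solely through the inequalities below.
  obtain ⟨a, ha⟩ : ∃ a : ℕ, 10 ^ 10 ≤ a := ⟨_, le_rfl⟩
  refine ⟨8000, WordRAM.cyclesOrVertices, a, ?_⟩
  intro β n k G adj hG h₂
  set m := ∑ v ∈ Finset.range n, (adj v).length with hm
  have ha₂ : 4 ≤ a := le_trans (by norm_num) ha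
  have hS : 10 ^ 10 * (n + m + Nat.size k + 1) ≤ a * (n + m + Nat.size k + 1) ^ a :=
    Nat.mul_le_mul ha (Nat.le_self_pow (by omega) _)
  have hW : 10 ^ 10 * (n + k + 1) ^ 2 ≤ a * (n + k + 1) ^ a :=
    Nat.mul_le_mul ha (Nat.pow_le_pow_right (by omega) (by omega))
  have hY : n * n + k * k + n + k + 1 ≤ (n + k + 1) ^ 2 := by nlinarith [Nat.zero_le (n * k)]
  have hT : 10 ^ 10 * ((k + 1) ^ 4 * (n + 1)) ≤ a * (k + 1) ^ a * (n + 1) := by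
    rw [mul_assoc]
    exact Nat.mul_le_mul ha (Nat.mul_le_mul_right _ (Nat.pow_le_pow_right (by omega) ha₂))
  generalize a * (n + m + Nat.size k + 1) ^ a = S at *
  generalize a * (n + k + 1) ^ a = W at *
  generalize (n + k + 1) ^ 2 = Y at *
  obtain ⟨t, s, ht, hx, -, -, hs⟩ := WordRAM.cyclesOrVertices_runs (n := n) (k := k) hG.symmLists
    (hG.count_le_two h₂)
    (WordRAM.initialState_inputRep (k := k) hG h₂ (S := S) (W := W) (by omega) (by omega))
    (by simp [WordRAM.initialState])
    (fun r hr => by simp [WordRAM.initialState, show r ≠ 0 by omega, show r ≠ 1 by omega])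
    (fun b hb => by
      funext i
      simp [WordRAM.initialState, show b ≠ 0 by omega, show b ≠ 1 by omega])
    rfl (by omega) (by omega) (by omega)
    (WordRAM.initialState_ok hG h₂ (by omega))
  refine ⟨t, s, hx, ht.trans hT, ?_⟩
  rcases hs with ⟨Cs, h₁, h₃, h₄, h₅⟩ | ⟨fl, l, F, hF, h₁, ⟨rk, hrk⟩, h₃, h₄, h₅⟩
  · exact .inl ⟨Cs, h₁, h₃, fun C hC => hG.isCycleSeq (h₄ C hC), h₅⟩
  · refine .inr ⟨F, h₁, ?_, hG.isFeedbackVertexSet hrk fun v => by simp [hF], ?_⟩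
    · rw [hF]
      exact List.nodup_range.filter _
    · rcases Nat.lt_or_ge 1 k with hk | hk
      · exact le_trans (by exact_mod_cast h₃) (WordRAM.two_pow_log_bound hk h₅)
      -- For `k ≤ 1` the right-hand side is 0, and so is the size of the set.
      · rw [h₄ hk]
        obtain rfl | rfl : k = 0 ∨ k = 1 := by omega
        all_goals simp
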